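/- Let $X$ be a countable set, let $m$ be a measure on all subsets of $X$ with $0<m(x):=m(\{x\})<\infty$ for all $x\in X$, and let $(b,c)$ be a connected graph over $(X,m)$: $b\colon X\times X\to[0,\infty)$ is symmetric with zero diagonal and $\sum_y b(x,y)<\infty$ for all $x$, $c\colon X\to[0,\infty)$, and any two points of $X$ are joined by a finite path along pairs with $b>0$. Let $\mathcal L f(x)=\frac1{m(x)}\sum_y b(x,y)(f(x)-f(y))+\frac{c(x)}{m(x)}f(x)$; a function $u$ with $\sum_y b(x,y)|u(y)|<\infty$ for all $x$ is $1$-harmonic if $\mathcal Lu+u=0$. Forms are symmetric positive forms $Q$ on real Hilbert spaces, with domain $D(Q)$, identified with their quadratic functionals with $Q(f)=\infty$ off $D(Q)$; $Q\le Q'$ is meant pointwise, $Q_1(f)=Q(f)+\|f\|^2$, and $Q$ is closed if $D(Q)$ is complete for the norm $Q_1^{1/2}$. A form on an $L^2$-space is Markovian if $Q(C\circ f)\le Q(f)$ for all $f\in L^2$ and all $C\colon\mathbb R\to\mathbb R$ with $C(0)=0$ and $|C(s)-C(t)|\le|s-t|$. A Dirichlet form in the wide sense is a closed Markovian form; it is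 a Dirichlet form if it is also densely defined. The form $Q^{(N)}$ on $\ell^2(X,m)$ is $Q^{(N)}(f)=\frac12\sum_{x,y}b(x,y)(f(x)-f(y))^2+\sum_xc(x)f(x)^2$, with domain the $f\in\ell^2(X,m)$ for which this is finite, and $Q^{(D)}$ is its restriction to the closure of the finitely supported functions with respect to $(Q^{(N)}_1)^{1/2}$. Every $f\in D(Q^{(N)})$ has a unique Royden decomposition $f=f_0+f_h$ with $f_0\in D(Q^{(D)})$ and $1$-harmonic $f_h\in D(Q^{(N)})$. Let $\hat X$ be the compactification of $X$ (compact Hausdorff, $X$ dense with open points) to which all functions in $D(Q^{(N)})\cap\ell^\infty(X)$ extend continuously, the extensions separating the points of $\hat X$; it is unique up to homeomorphism. The $1$-harmonic boundary $\partial X$ is the set of points of $\hat X\setminus X$ at which the extensions of all functions in $D(Q^{(D)})\cap\ell^\infty(X)$ vanish. Every $f\in D(Q^{(N)})$ extends uniquely to a continuous function $\hat X\to[-\infty,\infty]$; let $\gamma f$ be the restriction of this extension to $\partial X$. Fix $o\in X$ and let $\mu$ be the $1$-harmonic measure of $o$, i.e. the Radon measure on $\partial X$ of mass at most $1$ with $h(o)=\int_{\partial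 X}\gamma f\,d\mu$ whenever $f\in D(Q^{(N)})\cap\ell^\infty(X)$ and $h\in D(Q^{(N)})$ is $1$-harmonic with $\gamma h=\gamma f$, and with $\mu(\{z\})=0$ if $z\in\partial X$ is a point at which all functions in $D(Q^{(N)})\cap\ell^\infty(X)$ vanish. Write $L^2(\partial X)=L^2(\partial X,\mu)$ and regard $\gamma$ as a map $D(Q^{(N)})\to L^2(\partial X)$. For $\varphi\in\gamma D(Q^{(N)})$ let $H\varphi\in D(Q^{(N)})$ be the $1$-harmonic function with $\gamma(H\varphi)=\varphi$. Let $\mathfrak D(b,c)$ be the set of Dirichlet forms $Q$ on $\ell^2(X,m)$ with $Q^{(N)}\le Q\le Q^{(D)}$. For $Q\in\mathfrak D(b,c)$ let $\operatorname{Tr}Q$ be the form on $L^2(\partial X)$ with domain $\gamma D(Q)$ and $\operatorname{Tr}Q(\varphi)=Q_1(H\varphi)$, and let $q^{DN}=\operatorname{Tr}Q^{(N)}$. Let $\operatorname{Tr}\mathfrak D(b,c)$ be the set of Dirichlet forms in the wide sense $q$ on $L^2(\partial X)$ such that $q\ge q^{DN}$ and $q-q^{DN}$, with domain $D(q)$,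 is Markovian. Theorem. For a closed form $Q$ on $\ell^2(X,m)$ the following are equivalent. (i) $Q\in\mathfrak D(b,c)$. (ii) There is $q\in\operatorname{Tr}\mathfrak D(b,c)$ such that $D(Q)=\{f\in D(Q^{(N)}):\gamma f\in D(q)\}$ and, for all $f\in D(Q)$ with Royden decomposition $f=f_0+f_h$, $$Q(f)=Q^{(N)}(f)+q(\gamma f)-q^{DN}(\gamma f)\quad\text{and}\quad Q_1(f)=Q^{(D)}_1(f_0)+q(\gamma f).$$ If $Q\in\mathfrak D(b,c)$, then in (ii) one can choose $q=\operatorname{Tr}Q$, and the map $\mathfrak D(b,c)\to\operatorname{Tr}\mathfrak D(b,c)$, $Q\mapsto\operatorname{Tr}Q$, is a bijection. -/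

import Mathlib

open MeasureTheory Filter Topology
open scoped ENNReal

noncomputable section

namespace GraphForms

/-! ### Forms on a real Hilbert space -/

section AbstractForms

variable {H : Type*} [NormedAddCommGroup H] [InnerProductSpace ℝ H]

/-- A symmetric positive form: a subspace together with a symmetric, positive semidefinite
bilinear map on it. -/
structure SymmPosForm (H : Type*) [NormedAddCommGroup H] [InnerProductSpace ℝ H] where
  domain : Submodule ℝ H
  form : domain →ₗ[ℝ] domain →ₗ[ℝ] ℝ
  symm : ∀ f g, form f g = form g f
  nonneg : ∀ f, 0 ≤ form f f

open Classical in
/-- The `[0,∞]`-valued functional of a form: `S(f,f)` on the domain and `∞` off the domain.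
It determines the form. -/
def SymmPosForm.value (S : SymmPosForm H) (f : H) : ℝ≥0∞ :=
  if h : f ∈ S.domain then ENNReal.ofReal (S.form ⟨f, h⟩ ⟨f, h⟩) else ⊤

/-- From here on forms are identified with their `[0,∞]`-valued functionals; the domain of `Q` is
`{f | Q f < ⊤}` and `Q ≤ Q'` is the pointwise order. -/
def IsForm (Q : H → ℝ≥0∞) : Prop := ∃ S : SymmPosForm H, Q = S.value

/-- `Q₁(f) = Q(f) + ‖f‖²`, the square of the form norm. -/
def one (Q : H → ℝ≥0∞) (f : H) : ℝ≥0∞ := Q f + ENNReal.ofReal (‖f‖ ^ 2)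

/-- A form is closed if its domain is complete with respect to the form norm. -/
def IsClosedForm (Q : H → ℝ≥0∞) : Prop :=
  IsForm Q ∧
    ∀ u : ℕ → H, (∀ n, Q (u n) < ⊤) →
      (∀ ε : ℝ≥0∞, 0 < ε → ∃ N, ∀ n ≥ N, ∀ k ≥ N, one Q (u n - u k) < ε) →
      ∃ f, Q f < ⊤ ∧ Tendsto (fun n => one Q (u n - f)) atTop (𝓝 0)

end AbstractForms

/-! ### Dirichlet forms on an `L²`-space -/

section DirichletForms

variable {Ω : Type*} [MeasurableSpace Ω] {μ : Measure Ω}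

/-- Compatibility with all normal contractions `C`, that is `C 0 = 0` and
`|C s - C t| ≤ |s - t|`. -/
def IsMarkovian (Q : Lp ℝ 2 μ → ℝ≥0∞) : Prop :=
  ∀ (C : ℝ → ℝ) (hC : LipschitzWith 1 C) (h0 : C 0 = 0) (f : Lp ℝ 2 μ), Q (hC.compLp h0 f) ≤ Q f

/-- Dirichlet form in the wide sense: closed and Markovian, not necessarily densely defined. -/
def IsWideDirichletForm (Q : Lp ℝ 2 μ → ℝ≥0∞) : Prop := IsClosedForm Q ∧ IsMarkovian Q

def IsDirichletForm (Q : Lp ℝ 2 μ → ℝ≥0∞) : Prop :=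
  IsWideDirichletForm Q ∧ Dense {f | Q f < ⊤}

open Classical in
/-- The difference `q - q'` on the domain of `q` (used for `q' ≤ q`). -/
def diffOnDomain (q q' : Lp ℝ 2 μ → ℝ≥0∞) (φ : Lp ℝ 2 μ) : ℝ≥0∞ :=
  if q φ < ⊤ then q φ - q' φ else ⊤

end DirichletForms

/-! ### Graphs -/

/-- A graph `(b,c)` over `X`. -/
structure WGraph (X : Type*) where
  b : X → X → ℝ
  c : X → ℝ
  b_nonneg : ∀ x y, 0 ≤ b x y
  b_symm : ∀ x y, b x y = b y x
  b_diag : ∀ x, b x x = 0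
  b_summable : ∀ x, Summable (b x)
  c_nonneg : ∀ x, 0 ≤ c x

namespace WGraph

variable {X : Type*} (G : WGraph X)

/-- Any two vertices are joined by a finite path of edges. -/
def Connected : Prop := ∀ x y, Relation.ReflTransGen (fun u v => 0 < G.b u v) x y

/-- The energy `½ ∑ b(x,y)(f(x)-f(y))² + ∑ c(x) f(x)²` in `[0,∞]`. -/
def energy (f : X → ℝ) : ℝ≥0∞ :=
  2⁻¹ * (∑' x, ∑' y, ENNReal.ofReal (G.b x y * (f x - f y) ^ 2)) +
    ∑' x, ENNReal.ofReal (G.c x * f x ^ 2)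

variable [MeasurableSpace X] (m : Measure X)

/-- The formal Laplacian. -/
def laplacian (f : X → ℝ) (x : X) : ℝ :=
  1 / m.real {x} * (∑' y, G.b x y * (f x - f y)) + G.c x / m.real {x} * f x

/-- `u` lies in the domain of the formal Laplacian and `(𝓛 + 1) u = 0`. -/
def IsOneHarmonic (u : X → ℝ) : Prop :=
  (∀ x, Summable fun y => G.b x y * |u y|) ∧ ∀ x, G.laplacian m u x + u x = 0

/-- The Neumann form `Q^(N)` on `ℓ²(X,m)`. In the theorem every point has positive mass, so an
element of `Lp ℝ 2 m` is the same as a square summable function on `X`. -/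
def neumann (f : Lp ℝ 2 m) : ℝ≥0∞ := G.energy f

/-- `f` lies in the form norm closure of the finitely supported functions in `D(Q^(N))`. -/
def InDirichletDomain (f : Lp ℝ 2 m) : Prop :=
  G.neumann m f < ⊤ ∧ ∀ ε : ℝ≥0∞, 0 < ε →
    ∃ g : Lp ℝ 2 m, (Function.support (g : X → ℝ)).Finite ∧ one (G.neumann m) (f - g) < ε

open Classical in
/-- The Dirichlet form `Q^(D)`: the restriction of `Q^(N)` to the closure of `C_c(X)`. -/
def dirichlet (f : Lp ℝ 2 m) : ℝ≥0∞ := if G.InDirichletDomain m f then G.neumann m f else ⊤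

/-- `f = f₀ + f_h` with `f₀ ∈ D(Q^(D))` and `1`-harmonic `f_h ∈ D(Q^(N))`. -/
def IsRoydenDecomposition (f f₀ fh : Lp ℝ 2 m) : Prop :=
  f = f₀ + fh ∧ G.dirichlet m f₀ < ⊤ ∧ G.neumann m fh < ⊤ ∧ G.IsOneHarmonic m fh

/-! ### The compactification and the `1`-harmonic boundary -/

/-- `D(Q^(N)) ∩ ℓ^∞(X)`. -/
def BddDomain : Type _ :=
  {f : Lp ℝ 2 m // G.neumann m f < ⊤ ∧ ∃ M : ℝ, ∀ x, |f x| ≤ M}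

/-- The point evaluations `x ↦ (f(x))_f`, where `f` runs through `D(Q^(N)) ∩ ℓ^∞(X)`. -/
def evalMap (x : X) : G.BddDomain m → ℝ := fun f => f.1 x

/-- The compactification `X̂`: the closure of the image of `X` under the point evaluations in the
product space `ℝ^(D(Q^(N)) ∩ ℓ^∞(X))`. The continuous extension of `f ∈ D(Q^(N)) ∩ ℓ^∞(X)` is the
coordinate `z ↦ z f`, and these coordinates separate the points. -/
def Compactification : Type _ :=
  {z : G.BddDomain m → ℝ // z ∈ closure (Set.range (G.evalMap m))}

instance : TopologicalSpace (G.Compactification m) :=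
  instTopologicalSpaceSubtype (X := G.BddDomain m → ℝ)

/-- The embedding of `X` into `X̂`. -/
def embed (x : X) : G.Compactification m := ⟨G.evalMap m x, subset_closure ⟨x, rfl⟩⟩

/-- The `1`-harmonic boundary `∂X`: the points of `X̂ \ X` at which (the extensions of) all
functions of `D(Q^(D)) ∩ ℓ^∞(X)` vanish. -/
def Boundary : Type _ :=
  {z : G.Compactification m //
    z ∉ Set.range (G.embed m) ∧ ∀ f : G.BddDomain m, G.dirichlet m f.1 < ⊤ → z.1 f = 0}

instance : TopologicalSpace (G.Boundary m) :=
  instTopologicalSpaceSubtype (X := G.Compactification m)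

/-- The Borel `σ`-algebra of `∂X`. -/
instance : MeasurableSpace (G.Boundary m) := borel _

instance : BorelSpace (G.Boundary m) := ⟨rfl⟩

/-- The preliminary trace `γ₀ f = f|_∂X` of `f ∈ D(Q^(N)) ∩ ℓ^∞(X)`. -/
def preTrace (f : G.BddDomain m) (z : G.Boundary m) : ℝ := z.1.1 f

/-- The value at `z ∈ ∂X` of the continuous extension `X̂ → [-∞,∞]` of a function on `X`, that is
the limit of `f(x)` as `x ∈ X` tends to `z` in `X̂`. -/
def boundaryValue (f : X → ℝ) (z : G.Boundary m) : EReal :=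
  limUnder (comap (G.embed m) (𝓝 z.1)) fun x => (f x : EReal)

/-! ### Harmonic measures and traces -/

/-- `μ` is the `1`-harmonic measure of the vertex `o`: a Radon measure of mass at most one with
`Hφ(o) = ∫ φ dμ` for all `φ = γ₀ f`, where `Hφ ∈ D(Q^(N))` is the `1`-harmonic function with
boundary values `φ`, and without mass at the point of `∂X` at which all functions in
`D(Q^(N)) ∩ ℓ^∞(X)` vanish, should there be such a point. -/
structure IsHarmonicMeasure (o : X) (μ : Measure (G.Boundary m)) : Prop where
  regular : μ.Regular
  mass_le : μ Set.univ ≤ 1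
  integral_eq : ∀ (f : G.BddDomain m) (h : Lp ℝ 2 m), G.neumann m h < ⊤ → G.IsOneHarmonic m h →
    (∀ z, G.boundaryValue m h z = (G.preTrace m f z : EReal)) → h o = ∫ z, G.preTrace m f z ∂μ
  null_infinity : ∀ z : G.Boundary m, (∀ f : G.BddDomain m, G.preTrace m f z = 0) → μ {z} = 0

open Classical in
/-- The `1`-harmonic measure of `o` (by default zero if there were none). -/
def harmonicMeasure (o : X) : Measure (G.Boundary m) :=
  if h : ∃ μ, G.IsHarmonicMeasure m o μ then h.choose else 0

/-- `L²(∂X)`, taken with respect to the `1`-harmonic measure of `o`. -/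
abbrev L2Boundary (o : X) : Type _ := Lp ℝ 2 (G.harmonicMeasure m o)

open Classical in
/-- The trace map `γ : D(Q^(N)) → L²(∂X)`: the class of the boundary values of `f` (by default zero
if the boundary values were not almost everywhere finite and square integrable). -/
def trace (o : X) (f : Lp ℝ 2 m) : G.L2Boundary m o :=
  if h : ∃ φ : G.L2Boundary m o,
      ∀ᵐ z ∂(G.harmonicMeasure m o), G.boundaryValue m f z = (φ z : EReal)
  then h.choose else 0

open Classical in
/-- The `1`-harmonic extension `Hφ`: the function in `D(Q^(N))` with `(𝓛 + 1) Hφ = 0` and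
`γ(Hφ) = φ` (by default zero if there were none). -/
def harmonicExtension (o : X) (φ : G.L2Boundary m o) : Lp ℝ 2 m :=
  if h : ∃ u : Lp ℝ 2 m, G.neumann m u < ⊤ ∧ G.IsOneHarmonic m u ∧ G.trace m o u = φ
  then h.choose else 0

open Classical in
/-- The trace form `Tr Q` on `L²(∂X)`: its domain is `γ D(Q)`, and `Tr Q(φ) = Q₁(Hφ)` there. -/
def traceForm (o : X) (Q : Lp ℝ 2 m → ℝ≥0∞) (φ : G.L2Boundary m o) : ℝ≥0∞ :=
  if ∃ f, Q f < ⊤ ∧ G.trace m o f = φ then one Q (G.harmonicExtension m o φ) else ⊤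

/-- The Dirichlet-to-Neumann form `q^{DN} = Tr Q^(N)`. -/
def dirichletToNeumann (o : X) : G.L2Boundary m o → ℝ≥0∞ := G.traceForm m o (G.neumann m)

/-- `𝔇(b,c)`: the Dirichlet forms `Q` on `ℓ²(X,m)` with `Q^(N) ≤ Q ≤ Q^(D)`. -/
def formClass : Set (Lp ℝ 2 m → ℝ≥0∞) :=
  {Q | IsDirichletForm Q ∧ G.neumann m ≤ Q ∧ Q ≤ G.dirichlet m}

/-- `Tr 𝔇(b,c)`: the Dirichlet forms in the wide sense `q` on `L²(∂X)` with `q ≥ q^{DN}` for which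
`q - q^{DN}`, with domain `D(q)`, is Markovian. -/
def traceClass (o : X) : Set (G.L2Boundary m o → ℝ≥0∞) :=
  {q | IsWideDirichletForm q ∧ G.dirichletToNeumann m o ≤ q ∧
    IsMarkovian (diffOnDomain q (G.dirichletToNeumann m o))}

/-- `Q` is represented by the form `q` on the boundary: `D(Q) = {f ∈ D(Q^(N)) | γf ∈ D(q)}`, and
for `f ∈ D(Q)` with Royden decomposition `f = f₀ + f_h`,
`Q(f) = Q^(N)(f) + q(γf) - q^{DN}(γf)` and `Q₁(f) = Q^(D)₁(f₀) + q(γf)`. -/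
def IsRepresentedBy (o : X) (Q : Lp ℝ 2 m → ℝ≥0∞) (q : G.L2Boundary m o → ℝ≥0∞) : Prop :=
  (∀ f, Q f < ⊤ ↔ G.neumann m f < ⊤ ∧ q (G.trace m o f) < ⊤) ∧
  ∀ f, Q f < ⊤ →
    Q f = G.neumann m f + q (G.trace m o f) - G.dirichletToNeumann m o (G.trace m o f) ∧
    ∃ f₀ fh, G.IsRoydenDecomposition m f f₀ fh ∧
      one Q f = one (G.dirichlet m) f₀ + q (G.trace m o f)

end WGraph

end GraphForms

end

/-! The energy is a weighted sum of squares of differences over edges and of values at vertices.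
With `m` added to the killing term, so is `Q^(N)_1`. Hence `D(Q^(N))` is a Hilbert space (`Dom`) in
which pointwise inequalities between gradients yield inequalities between norms and inner products.
`D(Q^(D))` is a closed subspace (`dirDom`) and an order ideal. By Green's formula its orthogonal
complement consists of the `1`-harmonic functions. The Royden decomposition is therefore an
orthogonal projection (`harm`), and a maximum principle holds for it.

A bounded function that vanishes on `∂X` lies in `D(Q^(D))` (`mem_dirDom_of_boundary_zero`), so the
maximum principle can be read off from boundary values. Together with Hahn–Banach and Riesz–Markov
this produces the harmonic measure. For bounded `f` one gets `∫ (γf)² dμ = harm(f²)(o)`, and a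
Picone inequality bounds this by the form norm (`harm_sq_le`), so `γ` is bounded into `L²(∂X)`. Its
kernel is exactly `D(Q^(D))` (`traceL_eq_zero_iff`), because a nonnegative harmonic function with a
zero vanishes on a connected graph. Thus `γ` is injective on harmonic functions, with inverse `H` on
its range.

Let `Q` lie between `Q^(N)` and `Q^(D)`. The form `Q - Q^(N)` is nonnegative and vanishes on
`D(Q^(D))`, hence it factors through `γ`; this gives both formulas with `q = Tr Q`. The hard point
is that `Q - Q^(N)` is Markovian (`bil_cmp_add_le`). The resolvent approximations of `Q` are jump
forms with killing. For functions vanishing on a finite set `F`, the jumps into `F` act as killing,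
and removing this killing leaves a form that contractions still decrease. In the limit the removed
term is `Q(1_F, f²)`, which equals `Q^(N)(1_F, f²)` because `1_F` has finite support. Restoring the
values on `F` then removes from `Q` all terms of the energy that meet `F`, and `F` exhausts `X`.

Conversely, `Q^(N) + (q - q^{DN}) ∘ γ` (`formOfTrace`) is Markovian as a sum of Markovian
functionals and closed because `γ` is bounded. Its trace is `q`, and every form represented by `q`
equals it, so the two constructions are mutually inverse. -/

noncomputable section

set_option linter.unusedSectionVars false

namespace GraphForms

open scoped RealInnerProductSpace

/-! ### Forms on Hilbert spaces -/

section Abstract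

/-- An additive function with a locally bounded growth is linear. -/
theorem additive_eq_mul {ψ : ℝ → ℝ} (hadd : ∀ s t, ψ (s + t) = ψ s + ψ t) {a b : ℝ}
    (hb : ∀ c, |ψ c| ≤ a * c ^ 2 + b) (c : ℝ) : ψ c = c * ψ 1 := by
  let F : ℝ →+ ℝ := AddMonoidHom.mk' ψ hadd
  have hF : Continuous F := by
    refine F.continuous_of_isBounded_nhds_zero (s := Metric.closedBall 0 1)
      (Metric.closedBall_mem_nhds 0 one_pos) ?_
    refine (Metric.isBounded_iff_subset_closedBall (0 : ℝ)).2 ⟨|a| + b, ?_⟩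
    rintro _ ⟨t, ht, rfl⟩
    rw [mem_closedBall_zero_iff] at ht ⊢
    have h1 : t ^ 2 ≤ 1 := by
      rw [Real.norm_eq_abs] at ht
      exact (sq_le_one_iff_abs_le_one t).2 ht
    calc ‖F t‖ = |ψ t| := rfl
      _ ≤ a * t ^ 2 + b := hb t
      _ ≤ |a| * t ^ 2 + b := by gcongr; exact le_abs_self a
      _ ≤ |a| * 1 + b := by gcongr
      _ = |a| + b := by ring
  have := map_real_smul F hF c 1
  simpa [F] using this

/-- The Jordan–von Neumann construction for nonnegative quadratic functions. -/
theorem exists_bilin_of_parallelogram {V : Type*} [AddCommGroup V] [Module ℝ V] (q : V → ℝ)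
    (h0 : ∀ v, 0 ≤ q v) (hs : ∀ (c : ℝ) v, q (c • v) = c ^ 2 * q v)
    (hp : ∀ v w, q (v + w) + q (v - w) = 2 * q v + 2 * q w) :
    ∃ B : V →ₗ[ℝ] V →ₗ[ℝ] ℝ, (∀ v w, B v w = B w v) ∧ ∀ v, B v v = q v := by
  have hneg : ∀ v, q (-v) = q v := fun v => by simpa using hs (-1) v
  have hq0 : q 0 = 0 := by simpa using hs 0 0
  set p : V → V → ℝ := fun v w => (q (v + w) - q (v - w)) / 4 with hpdef
  have hsymm : ∀ v w, p v w = p w v := fun v w => by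
    simp only [hpdef]
    rw [add_comm v w, ← neg_sub w v, hneg]
  have hadd : ∀ v v' w, p (v + v') w = p v w + p v' w := fun v v' w => by
    -- In the combination `e1 - e2 + e3 - e4` the terms with mixed signs cancel in pairs, since `q`
    -- is even.
    have e1 := hp (v + w) v'
    have e2 := hp (v - w) v'
    have e3 := hp (v' + w) v
    have e4 := hp (v' - w) v
    have i1 : q (v' + w - v) = q (v - w - v') := by rw [← hneg]; congr 1; abel
    have i2 : q (v' - w - v) = q (v + w - v') := by rw [← hneg]; congr 1; abel
    have i3 : v + w + v' = v + v' + w := by abel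
    have i4 : v - w + v' = v + v' - w := by abel
    have i5 : v' + w + v = v + v' + w := by abel
    have i6 : v' - w + v = v + v' - w := by abel
    rw [i3] at e1
    rw [i4] at e2
    rw [i5, i1] at e3
    rw [i6, i2] at e4
    simp only [hpdef]
    linarith
  have hbound : ∀ v w, |p v w| ≤ (q v + q w) / 2 := fun v w => by
    have e := hp v w
    have a1 := h0 (v + w)
    have a2 := h0 (v - w)
    simp only [hpdef]
    rw [abs_le]
    constructor <;> linarith
  have hsmul : ∀ (c : ℝ) v w, p (c • v) w = c * p v w := fun c v w => by
    -- Additivity gives real homogeneity because `p (t • v) w` grows at most quadratically in `t`,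
    -- by `hbound` and `hs`.
    have := additive_eq_mul (ψ := fun t => p (t • v) w) (a := q v / 2) (b := q w / 2)
      (fun s t => by simp only [add_smul, hadd])
      (fun t => (hbound _ _).trans (le_of_eq (by rw [hs]; ring))) c
    simpa using this
  refine ⟨LinearMap.mk₂ ℝ p hadd hsmul (fun v w w' => ?_) (fun c v w => ?_), hsymm, fun v => ?_⟩
  · rw [hsymm, hadd, hsymm w, hsymm w']
  · rw [hsymm, hsmul, hsymm w, smul_eq_mul]
  · have : v + v = (2 : ℝ) • v := (two_smul ℝ v).symm
    simp only [LinearMap.mk₂_apply, hpdef, this, sub_self, hs, hq0]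
    ring

variable {H : Type*} [NormedAddCommGroup H] [InnerProductSpace ℝ H]

namespace SymmPosForm

variable (S : SymmPosForm H)

theorem value_coe (f : S.domain) : S.value f = ENNReal.ofReal (S.form f f) := by
  simp [value]

theorem value_lt_top {f : H} : S.value f < ⊤ ↔ f ∈ S.domain := by
  by_cases h : f ∈ S.domain <;> simp [value, h]

end SymmPosForm

/-- Forms are the functionals that are homogeneous of degree two and satisfy the parallelogram
identity. -/
theorem IsForm.of_parallelogram {Q : H → ℝ≥0∞} (hzero : Q 0 < ⊤)
    (hs : ∀ (c : ℝ) f, Q f < ⊤ → Q (c • f) = ENNReal.ofReal (c ^ 2) * Q f)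
    (hp : ∀ f g, Q f < ⊤ → Q g < ⊤ → Q (f + g) + Q (f - g) = 2 * Q f + 2 * Q g) : IsForm Q := by
  classical
  let D : Submodule ℝ H :=
    { carrier := {f | Q f < ⊤}
      zero_mem' := hzero
      add_mem' := fun {f g} hf hg => by
        have h : Q (f + g) + Q (f - g) < ⊤ := by
          rw [hp f g hf hg]
          exact ENNReal.add_lt_top.2 ⟨ENNReal.mul_lt_top (by simp) hf,
            ENNReal.mul_lt_top (by simp) hg⟩
        exact (ENNReal.add_lt_top.1 h).1
      smul_mem' := fun c f hf => by
        change Q (c • f) < ⊤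
        rw [hs c f hf]
        exact ENNReal.mul_lt_top (by simp) hf }
  have hD : ∀ f, f ∈ D ↔ Q f < ⊤ := fun f => Iff.rfl
  obtain ⟨B, hB, hB'⟩ := exists_bilin_of_parallelogram (V := D) (fun f => (Q f).toReal)
    (fun _ => ENNReal.toReal_nonneg)
    (fun c f => by
      simp only [Submodule.coe_smul, hs c f f.2, ENNReal.toReal_mul,
        ENNReal.toReal_ofReal (sq_nonneg c)])
    (fun f g => by
      have h := congrArg ENNReal.toReal (hp f g f.2 g.2)
      rw [ENNReal.toReal_add (show Q (f + g) < ⊤ from (f + g).2).ne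
          (show Q (f - g) < ⊤ from (f - g).2).ne,
        ENNReal.toReal_add (ENNReal.mul_lt_top (by simp) f.2).ne
          (ENNReal.mul_lt_top (by simp) g.2).ne] at h
      simpa using h)
  refine ⟨⟨D, B, hB, fun f => by rw [hB']; exact ENNReal.toReal_nonneg⟩, ?_⟩
  funext f
  by_cases hf : f ∈ D
  · simp only [SymmPosForm.value, hf, dif_pos, hB']
    exact (ENNReal.ofReal_toReal ((hD f).1 hf).ne).symm
  · simp only [SymmPosForm.value, hf, dif_neg, not_false_eq_true]
    exact not_lt_top_iff.1 hf

/-! ### The form domain as a Hilbert space -/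

/-- The domain of a form with the form norm. -/
def FormSpace (S : SymmPosForm H) : Type _ := S.domain

namespace FormSpace

variable (S : SymmPosForm H)

instance : AddCommGroup (FormSpace S) := inferInstanceAs (AddCommGroup S.domain)
instance : Module ℝ (FormSpace S) := inferInstanceAs (Module ℝ S.domain)

/-- The identification with the domain. -/
def toDomain : FormSpace S ≃ₗ[ℝ] S.domain := LinearEquiv.refl ℝ S.domain

/-- The inner product `S(f,g) + ⟨f,g⟩`. -/
@[reducible] def core : InnerProductSpace.Core ℝ (FormSpace S) where
  inner f g := S.form (toDomain S f) (toDomain S g) + ⟪(toDomain S f : H), (toDomain S g : H)⟫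
  conj_inner_symm f g := by
    simp only [conj_trivial]
    rw [S.symm, real_inner_comm]
  re_inner_nonneg f := add_nonneg (S.nonneg _) real_inner_self_nonneg
  add_left f g h := by
    rw [map_add, map_add, LinearMap.add_apply, Submodule.coe_add, inner_add_left]
    ring
  smul_left f g r := by
    rw [map_smul, map_smul, LinearMap.smul_apply, Submodule.coe_smul, real_inner_smul_left,
      smul_eq_mul, conj_trivial]
    ring
  definite f h := by
    have h1 := S.nonneg (toDomain S f)
    have h2 : 0 ≤ ⟪(toDomain S f : H), (toDomain S f : H)⟫ := real_inner_self_nonneg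
    have h3 : ⟪(toDomain S f : H), (toDomain S f : H)⟫ = 0 := by linarith
    exact (toDomain S).map_eq_zero_iff.1 (Subtype.ext (inner_self_eq_zero.1 h3))

instance : NormedAddCommGroup (FormSpace S) := (core S).toNormedAddCommGroup
instance : InnerProductSpace ℝ (FormSpace S) := InnerProductSpace.ofCore (core S).toCore

variable {S}

theorem inner_eq (f g : FormSpace S) :
    ⟪f, g⟫ = S.form (toDomain S f) (toDomain S g) + ⟪(toDomain S f : H), (toDomain S g : H)⟫ := rfl

theorem norm_sq_eq (f : FormSpace S) :
    ‖f‖ ^ 2 = S.form (toDomain S f) (toDomain S f) + ‖(toDomain S f : H)‖ ^ 2 := by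
  rw [← real_inner_self_eq_norm_sq, inner_eq, real_inner_self_eq_norm_sq]

/-- The inclusion into the ambient space. -/
def incl : FormSpace S →L[ℝ] H :=
  (S.domain.subtype ∘ₗ (toDomain S).toLinearMap).mkContinuous 1 fun f => by
    rw [one_mul]
    refine le_of_sq_le_sq ?_ (norm_nonneg _)
    rw [norm_sq_eq]
    linarith! [S.nonneg (toDomain S f)]

theorem incl_apply (f : FormSpace S) : incl f = (toDomain S f : H) := rfl

theorem incl_injective : Function.Injective (incl (S := S)) := fun _ _ h =>
  (toDomain S).injective (Subtype.ext h)

theorem value_incl (f : FormSpace S) :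
    S.value (incl f) = ENNReal.ofReal (S.form (toDomain S f) (toDomain S f)) :=
  S.value_coe _

theorem value_incl_lt_top (f : FormSpace S) : S.value (incl f) < ⊤ :=
  S.value_lt_top.2 (toDomain S f).2

theorem one_value_incl (f : FormSpace S) : one S.value (incl f) = ENNReal.ofReal (‖f‖ ^ 2) := by
  rw [norm_sq_eq, one, value_incl, ← ENNReal.ofReal_add (S.nonneg _) (sq_nonneg _), incl_apply]

/-- The element of the form space given by an element of the domain. -/
def of (f : H) (hf : S.value f < ⊤) : FormSpace S :=
  (toDomain S).symm ⟨f, S.value_lt_top.1 hf⟩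

@[simp] theorem incl_of (f : H) (hf : S.value f < ⊤) : incl (of f hf : FormSpace S) = f := rfl

theorem ofReal_sq_lt_iff {a : ℝ} (ha : 0 ≤ a) {ε : ℝ} (hε : 0 < ε) :
    ENNReal.ofReal (a ^ 2) < ENNReal.ofReal (ε ^ 2) ↔ a < ε := by
  rw [ENNReal.ofReal_lt_ofReal_iff (by positivity)]
  exact sq_lt_sq₀ ha hε.le

/-- The form space of a closed form is complete. -/
theorem completeSpace (h : IsClosedForm S.value) : CompleteSpace (FormSpace S) := by
  refine Metric.complete_of_cauchySeq_tendsto fun u hu => ?_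
  obtain ⟨f, hf, hlim⟩ := h.2 (fun n => incl (u n)) (fun n => value_incl_lt_top _) (by
    intro ε hε
    obtain ⟨δ, hδ, hδε⟩ : ∃ δ : ℝ, 0 < δ ∧ ENNReal.ofReal (δ ^ 2) ≤ ε := by
      by_cases htop : ε = ⊤
      · exact ⟨1, one_pos, htop ▸ le_top⟩
      · refine ⟨Real.sqrt ε.toReal, Real.sqrt_pos.2 (ENNReal.toReal_pos hε.ne' htop), ?_⟩
        rw [Real.sq_sqrt ENNReal.toReal_nonneg, ENNReal.ofReal_toReal htop]
    obtain ⟨N, hN⟩ := Metric.cauchySeq_iff.1 hu δ hδ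
    refine ⟨N, fun n hn k hk => lt_of_lt_of_le ?_ hδε⟩
    rw [← map_sub, one_value_incl, ofReal_sq_lt_iff (norm_nonneg _) hδ, ← dist_eq_norm]
    exact hN n hn k hk)
  refine ⟨of f hf, ?_⟩
  rw [Metric.tendsto_atTop]
  intro ε hε
  have hpos : (0 : ℝ≥0∞) < ENNReal.ofReal (ε ^ 2) := by simpa using pow_pos hε 2
  obtain ⟨N, hN⟩ := eventually_atTop.1 (hlim.eventually (gt_mem_nhds hpos))
  refine ⟨N, fun n hn => ?_⟩
  have := hN n hn
  rw [← incl_of f hf, ← map_sub, one_value_incl, ofReal_sq_lt_iff (norm_nonneg _) hε] at this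
  rwa [dist_eq_norm]

end FormSpace

/-- Bounded nets that converge along a separating family of functionals converge weakly. -/
theorem tendsto_inner_of_bounded {E : Type*} [NormedAddCommGroup E] [InnerProductSpace ℝ E]
    [CompleteSpace E] {ι : Type*} (e : ι → E →L[ℝ] ℝ) (hsep : ∀ u, (∀ i, e i u = 0) → u = 0)
    {α : Type*} {l : Filter α} {u : α → E} {u₀ : E} {R : ℝ} (hb : ∀ n, ‖u n‖ ≤ R)
    (he : ∀ i, Tendsto (fun n => e i (u n)) l (𝓝 (e i u₀))) (v : E) :
    Tendsto (fun n => ⟪u n, v⟫) l (𝓝 ⟪u₀, v⟫) := by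
  -- The test vectors along which convergence holds form a subspace. It contains the Riesz
  -- representatives of the `e i`, so it is dense, and boundedness extends the convergence to its
  -- closure.
  let K : Submodule ℝ E :=
    { carrier := {v | Tendsto (fun n => ⟪u n, v⟫) l (𝓝 ⟪u₀, v⟫)}
      zero_mem' := by simpa using tendsto_const_nhds
      add_mem' := fun {v w} hv hw => by
        simpa only [Set.mem_ofPred_eq, inner_add_right] using hv.add hw
      smul_mem' := fun c v hv => by
        simpa only [Set.mem_ofPred_eq, real_inner_smul_right] using hv.const_mul c }
  have hK : Kᗮ = ⊥ := by
    rw [Submodule.eq_bot_iff]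
    intro w hw
    refine hsep w fun i => ?_
    have hmem : (InnerProductSpace.toDual ℝ E).symm (e i) ∈ K := by
      change Tendsto _ _ _
      simp only [real_inner_comm ((InnerProductSpace.toDual ℝ E).symm (e i)),
        InnerProductSpace.toDual_symm_apply]
      exact he i
    have := (Submodule.mem_orthogonal K w).1 hw _ hmem
    rwa [InnerProductSpace.toDual_symm_apply] at this
  have hdense : v ∈ closure (K : Set E) := by
    rw [← Submodule.topologicalClosure_coe, (Submodule.topologicalClosure_eq_top_iff).2 hK]
    trivial
  rw [Metric.tendsto_nhds]
  intro ε hε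
  set R' := |R| + ‖u₀‖ + 1 with hR'
  have hR'pos : 0 < R' := by positivity
  obtain ⟨w, hw, hvw⟩ := Metric.mem_closure_iff.1 hdense (ε / (2 * R')) (by positivity)
  have hw' : Tendsto (fun n => ⟪u n, w⟫) l (𝓝 ⟪u₀, w⟫) := hw
  filter_upwards [Metric.tendsto_nhds.1 hw' (ε / 2) (by positivity)] with n hn
  rw [Real.dist_eq] at hn ⊢
  rw [dist_eq_norm] at hvw
  have key : ⟪u n, v⟫ - ⟪u₀, v⟫ = ⟪u n - u₀, v - w⟫ + (⟪u n, w⟫ - ⟪u₀, w⟫) := by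
    simp only [inner_sub_left, inner_sub_right]
    ring
  rw [key]
  have h1 : |⟪u n - u₀, v - w⟫| ≤ R' * (ε / (2 * R')) := by
    refine (abs_real_inner_le_norm _ _).trans ?_
    have : ‖u n - u₀‖ ≤ R' := by
      have h1 := norm_sub_le (u n) u₀
      have h2 := (hb n).trans (le_abs_self R)
      linarith
    gcongr
  have h2 : R' * (ε / (2 * R')) = ε / 2 := by field_simp
  have h3 := abs_add_le ⟪u n - u₀, v - w⟫ (⟪u n, w⟫ - ⟪u₀, w⟫)
  linarith

end Abstract

/-! ### Square summable functions on a discrete measure space -/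

section Discrete

/-- Every point has positive finite mass. -/
class PosFiniteAtoms {X : Type*} [MeasurableSpace X] (m : Measure X) : Prop where
  pos : ∀ x, 0 < m {x}
  lt_top : ∀ x, m {x} < ⊤

variable {X : Type*} [MeasurableSpace X] {m : Measure X} [PosFiniteAtoms m]

theorem mass_pos (m : Measure X) [PosFiniteAtoms m] (x : X) : 0 < m.real {x} :=
  ENNReal.toReal_pos (PosFiniteAtoms.pos x).ne' (PosFiniteAtoms.lt_top x).ne

theorem ofReal_mass (m : Measure X) [PosFiniteAtoms m] (x : X) :
    ENNReal.ofReal (m.real {x}) = m {x} :=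
  ENNReal.ofReal_toReal (PosFiniteAtoms.lt_top x).ne

/-- Points have positive mass, so only the empty set is null. This allows elements of `Lp` to be
treated as honest functions on `X`. -/
theorem forall_of_ae {p : X → Prop} (h : ∀ᵐ x ∂m, p x) (x : X) : p x := by
  by_contra hx
  have h0 : m {x} = 0 := measure_mono_null (by simpa using hx) (ae_iff.1 h)
  exact (PosFiniteAtoms.pos (m := m) x).ne' h0

theorem lp_ext {f g : Lp ℝ 2 m} (h : ∀ x, f x = g x) : f = g :=
  Lp.ext (Eventually.of_forall h)

theorem lp_add_apply (f g : Lp ℝ 2 m) (x : X) : (f + g : Lp ℝ 2 m) x = f x + g x :=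
  forall_of_ae (Lp.coeFn_add f g) x

theorem lp_sub_apply (f g : Lp ℝ 2 m) (x : X) : (f - g : Lp ℝ 2 m) x = f x - g x :=
  forall_of_ae (Lp.coeFn_sub f g) x

theorem lp_neg_apply (f : Lp ℝ 2 m) (x : X) : (-f : Lp ℝ 2 m) x = -f x :=
  forall_of_ae (Lp.coeFn_neg f) x

theorem lp_smul_apply (c : ℝ) (f : Lp ℝ 2 m) (x : X) : (c • f : Lp ℝ 2 m) x = c * f x :=
  forall_of_ae (Lp.coeFn_smul c f) x

theorem lp_zero_apply (x : X) : (0 : Lp ℝ 2 m) x = 0 :=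
  forall_of_ae (Lp.coeFn_zero ℝ 2 m) x

theorem lp_comp_apply {C : ℝ → ℝ} (hC : LipschitzWith 1 C) (h0 : C 0 = 0) (f : Lp ℝ 2 m) (x : X) :
    (hC.compLp h0 f) x = C (f x) :=
  forall_of_ae (hC.coeFn_compLp h0 f) x

variable [Countable X] [DiscreteMeasurableSpace X]

theorem ofReal_norm_sq (f : Lp ℝ 2 m) :
    ENNReal.ofReal (‖f‖ ^ 2) = ∑' x, ENNReal.ofReal (m.real {x} * f x ^ 2) := by
  rw [← real_inner_self_eq_norm_sq, L2.inner_def]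
  have hint : Integrable (fun x => ⟪f x, f x⟫) m := L2.integrable_inner f f
  rw [ofReal_integral_eq_lintegral_ofReal hint
    (Eventually.of_forall fun x => real_inner_self_nonneg), lintegral_countable']
  refine tsum_congr fun x => ?_
  rw [← ofReal_mass m x, ← ENNReal.ofReal_mul real_inner_self_nonneg,
    real_inner_self_eq_norm_sq, Real.norm_eq_abs, sq_abs, mul_comm]

theorem memLp_of_tsum {f : X → ℝ} (hf : ∑' x, ENNReal.ofReal (m.real {x} * f x ^ 2) < ⊤) :
    MemLp f 2 m := by
  refine ⟨(measurable_of_countable f).aestronglyMeasurable, ?_⟩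
  rw [eLpNorm_lt_top_iff_lintegral_rpow_enorm_lt_top (by simp) (by simp), lintegral_countable']
  convert hf using 3 with x
  rw [mul_comm, ENNReal.ofReal_mul measureReal_nonneg, ofReal_mass]
  congr 1
  rw [← sq_abs, ENNReal.ofReal_pow (abs_nonneg _), Real.enorm_eq_ofReal_abs]
  simp

/-- The element of `ℓ²(X,m)` given by a square summable function. -/
def lpMk (f : X → ℝ) (hf : ∑' x, ENNReal.ofReal (m.real {x} * f x ^ 2) < ⊤) : Lp ℝ 2 m :=
  (memLp_of_tsum hf).toLp f

theorem lpMk_apply (f : X → ℝ) (hf : ∑' x, ENNReal.ofReal (m.real {x} * f x ^ 2) < ⊤) (x : X) :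
    lpMk f hf x = f x :=
  forall_of_ae (memLp_of_tsum hf).coeFn_toLp x

theorem mass_mul_sq_le (f : Lp ℝ 2 m) (x : X) : m.real {x} * f x ^ 2 ≤ ‖f‖ ^ 2 := by
  rw [← ENNReal.ofReal_le_ofReal_iff (by positivity), ofReal_norm_sq]
  exact ENNReal.le_tsum x

/-- The evaluation at a point. -/
def lpEval (m : Measure X) [PosFiniteAtoms m] (x : X) : Lp ℝ 2 m →L[ℝ] ℝ :=
  LinearMap.mkContinuous
    { toFun := fun f => f x
      map_add' := fun f g => lp_add_apply f g x
      map_smul' := fun c f => lp_smul_apply c f x } (Real.sqrt (m.real {x}))⁻¹ fun f => by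
    have h := mass_mul_sq_le f x
    have hp := Real.sqrt_pos.2 (mass_pos m x)
    change |f x| ≤ _
    rw [inv_mul_eq_div, le_div_iff₀ hp]
    refine abs_le_of_sq_le_sq' ?_ (norm_nonneg _) |>.2
    rw [mul_pow, sq_abs, Real.sq_sqrt (mass_pos m x).le]
    linarith

theorem lp_tendsto_apply {α : Type*} {l : Filter α} {u : α → Lp ℝ 2 m} {f : Lp ℝ 2 m}
    (h : Tendsto u l (𝓝 f)) (x : X) : Tendsto (fun n => u n x) l (𝓝 (f x)) :=
  ((lpEval m x).continuous.tendsto f).comp h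

end Discrete

/-! ### The energy of a graph -/

namespace WGraph

variable {X : Type*} (G : WGraph X)

/-- The weights in the energy: `b/2` on pairs and `c` on points. -/
def weight : (X × X) ⊕ X → ℝ := Sum.elim (fun p => G.b p.1 p.2 / 2) G.c

/-- Differences over pairs and values at points. -/
def grad (f : X → ℝ) : (X × X) ⊕ X → ℝ := Sum.elim (fun p => f p.1 - f p.2) f

@[simp] theorem grad_inl (f : X → ℝ) (p : X × X) : grad f (Sum.inl p) = f p.1 - f p.2 := rfl
@[simp] theorem grad_inr (f : X → ℝ) (x : X) : grad f (Sum.inr x) = f x := rfl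

theorem weight_nonneg (y : (X × X) ⊕ X) : 0 ≤ G.weight y := by
  rcases y with p | x
  · exact div_nonneg (G.b_nonneg _ _) zero_le_two
  · exact G.c_nonneg x

/-- With edges and vertices in one index set, every comparison of energies becomes a pointwise
comparison of the squares of `grad`. -/
theorem energy_eq_tsum (f : X → ℝ) :
    G.energy f = ∑' y, ENNReal.ofReal (G.weight y * grad f y ^ 2) := by
  rw [ENNReal.summable.tsum_sum ENNReal.summable, energy]
  congr 1
  rw [← ENNReal.tsum_prod (f := fun x y => ENNReal.ofReal (G.b x y * (f x - f y) ^ 2)),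
    ← ENNReal.tsum_mul_left]
  refine tsum_congr fun p => ?_
  have h2 : (2 : ℝ≥0∞)⁻¹ = ENNReal.ofReal (2⁻¹) := by
    rw [ENNReal.ofReal_inv_of_pos two_pos]; simp
  rw [h2, ← ENNReal.ofReal_mul (by positivity)]
  congr 1
  simp only [weight, Sum.elim_inl, grad_inl]
  ring

/-- Energies of two families compare if their squared differences and values do. -/
theorem sum_energy_le {n k : ℕ} (f : Fin n → X → ℝ) (g : Fin k → X → ℝ)
    (h : ∀ y, G.weight y ≠ 0 → ∑ i, grad (f i) y ^ 2 ≤ ∑ j, grad (g j) y ^ 2) :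
    ∑ i, G.energy (f i) ≤ ∑ j, G.energy (g j) := by
  have key : ∀ {n : ℕ} (f : Fin n → X → ℝ), ∑ i, G.energy (f i) =
      ∑' y, ENNReal.ofReal (G.weight y * ∑ i, grad (f i) y ^ 2) := by
    intro n f
    simp only [energy_eq_tsum]
    rw [← Summable.tsum_finsetSum (fun i _ => ENNReal.summable)]
    refine tsum_congr fun y => ?_
    rw [Finset.mul_sum, ENNReal.ofReal_sum_of_nonneg]
    exact fun i _ => mul_nonneg (G.weight_nonneg y) (sq_nonneg _)
  rw [key, key]
  refine ENNReal.tsum_le_tsum fun y => ENNReal.ofReal_le_ofReal ?_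
  by_cases hy : G.weight y = 0
  · simp [hy]
  · exact mul_le_mul_of_nonneg_left (h y hy) (G.weight_nonneg y)

theorem energy_mono {f g : X → ℝ} (h : ∀ y, grad f y ^ 2 ≤ grad g y ^ 2) :
    G.energy f ≤ G.energy g := by
  simpa using G.sum_energy_le ![f] ![g] (fun y _ => by simpa using h y)

theorem energy_smul (a : ℝ) (f : X → ℝ) :
    G.energy (fun x => a * f x) = ENNReal.ofReal (a ^ 2) * G.energy f := by
  rw [energy_eq_tsum, energy_eq_tsum, ← ENNReal.tsum_mul_left]
  refine tsum_congr fun y => ?_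
  rw [← ENNReal.ofReal_mul (sq_nonneg a)]
  congr 1
  rcases y with p | x <;> simp <;> ring

theorem energy_parallelogram (f g : X → ℝ) :
    G.energy (fun x => f x + g x) + G.energy (fun x => f x - g x) =
      2 * G.energy f + 2 * G.energy g := by
  have h : ∀ y, grad (fun x => f x + g x) y ^ 2 + grad (fun x => f x - g x) y ^ 2 =
      grad f y ^ 2 + grad f y ^ 2 + grad g y ^ 2 + grad g y ^ 2 := by
    intro y
    rcases y with p | x <;> simp <;> ring
  apply le_antisymm
  · have := G.sum_energy_le ![fun x => f x + g x, fun x => f x - g x] ![f, f, g, g]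
      (fun y _ => by simpa [Fin.sum_univ_succ, add_assoc] using (h y).le)
    simpa [Fin.sum_univ_succ, two_mul, add_assoc] using this
  · have := G.sum_energy_le ![f, f, g, g] ![fun x => f x + g x, fun x => f x - g x]
      (fun y _ => by simpa [Fin.sum_univ_succ, add_assoc] using (h y).ge)
    simpa [Fin.sum_univ_succ, two_mul, add_assoc] using this

/-- The energy is the supremum of its finite partial sums. -/
theorem energy_le_iff {f : X → ℝ} {B : ℝ≥0∞} :
    G.energy f ≤ B ↔ ∀ A : Finset ((X × X) ⊕ X),
      ENNReal.ofReal (∑ y ∈ A, G.weight y * grad f y ^ 2) ≤ B := by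
  rw [energy_eq_tsum, ENNReal.tsum_eq_iSup_sum, iSup_le_iff]
  refine forall_congr' fun A => ?_
  rw [ENNReal.ofReal_sum_of_nonneg]
  exact fun i _ => mul_nonneg (G.weight_nonneg i) (sq_nonneg _)

theorem grad_tendsto {α : Type*} {l : Filter α} {u : α → X → ℝ} {f : X → ℝ}
    (h : ∀ x, Tendsto (fun n => u n x) l (𝓝 (f x))) (y : (X × X) ⊕ X) :
    Tendsto (fun n => grad (u n) y) l (𝓝 (grad f y)) := by
  rcases y with p | x
  · exact (h _).sub (h _)
  · exact h x

/-- Fatou's lemma; only finite partial sums are passed to the limit, so any nontrivial filter is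
allowed. -/
theorem energy_le_of_tendsto {α : Type*} {l : Filter α} [l.NeBot] {u : α → X → ℝ} {f : X → ℝ}
    (h : ∀ x, Tendsto (fun n => u n x) l (𝓝 (f x))) {B : ℝ≥0∞} (hB : ∀ᶠ n in l, G.energy (u n) ≤ B) :
    G.energy f ≤ B := by
  rw [energy_le_iff]
  intro A
  have ht : Tendsto (fun n => ENNReal.ofReal (∑ y ∈ A, G.weight y * grad (u n) y ^ 2)) l
      (𝓝 (ENNReal.ofReal (∑ y ∈ A, G.weight y * grad f y ^ 2))) :=
    ENNReal.tendsto_ofReal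
      (tendsto_finsetSum _ fun y _ => ((grad_tendsto h y).pow 2).const_mul _)
  exact le_of_tendsto ht (hB.mono fun n hn => (G.energy_le_iff.1 hn) A)

/-- The energy is controlled by pointwise bounds on values and differences. -/
theorem energy_lt_top_of_le {f u v : X → ℝ} {K : ℝ} (hu : G.energy u < ⊤) (hv : G.energy v < ⊤)
    (h : ∀ y, |grad f y| ≤ K * (|grad u y| + |grad v y|)) : G.energy f < ⊤ := by
  have h1 : G.energy f ≤ ∑ j : Fin 2, G.energy
      (![fun x => (2 * K) * u x, fun x => (2 * K) * v x] j) := by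
    have := G.sum_energy_le ![f] ![fun x => (2 * K) * u x, fun x => (2 * K) * v x] (fun y _ => ?_)
    · simpa using this
    · have e1 : grad (fun x => (2 * K) * u x) y = 2 * K * grad u y := by
        rcases y with p | x <;> simp; ring
      have e2 : grad (fun x => (2 * K) * v x) y = 2 * K * grad v y := by
        rcases y with p | x <;> simp; ring
      simp only [Finset.univ_unique, Finset.sum_singleton, Fin.sum_univ_two, Fin.isValue,
        Matrix.cons_val_zero, Matrix.cons_val_one, Matrix.cons_val_fin_one, e1, e2]
      have h2 := pow_le_pow_left₀ (abs_nonneg _) (h y) 2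
      rw [sq_abs] at h2
      have h3 : (|grad u y| + |grad v y|) ^ 2 ≤ 2 * (grad u y ^ 2 + grad v y ^ 2) := by
        nlinarith [sq_nonneg (|grad u y| - |grad v y|), sq_abs (grad u y), sq_abs (grad v y)]
      nlinarith [sq_nonneg K, mul_le_mul_of_nonneg_left h3 (sq_nonneg K), sq_nonneg (K * grad u y),
        sq_nonneg (K * grad v y)]
  refine h1.trans_lt ?_
  simp only [Fin.sum_univ_two, Fin.isValue, Matrix.cons_val_zero, Matrix.cons_val_one,
    energy_smul]
  exact ENNReal.add_lt_top.2 ⟨ENNReal.mul_lt_top (by simp) hu, ENNReal.mul_lt_top (by simp) hv⟩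

theorem energy_dirac_lt_top [DecidableEq X] (z : X) :
    G.energy (fun x => if x = z then 1 else 0) < ⊤ := by
  have hb : ∑' y, ENNReal.ofReal (G.b z y) < ⊤ := by
    rw [← ENNReal.ofReal_tsum_of_nonneg (G.b_nonneg z) (G.b_summable z)]
    exact ENNReal.ofReal_lt_top
  have h1 : ∑' x, ∑' y, (if x = z then ENNReal.ofReal (G.b z y) else 0) < ⊤ := by
    rw [tsum_eq_single z]
    · simpa using hb
    · intro x hx
      simp [hx]
  have h2 : ∑' x, ∑' y, (if y = z then ENNReal.ofReal (G.b z x) else 0) < ⊤ := by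
    convert hb using 3 with x
    rw [tsum_eq_single z]
    · simp
    · intro y hy
      simp [hy]
  have h3 : ∑' x, ∑' y, ENNReal.ofReal (G.b x y *
      ((if x = z then (1 : ℝ) else 0) - if y = z then 1 else 0) ^ 2) < ⊤ := by
    refine lt_of_le_of_lt ?_ (ENNReal.add_lt_top.2 ⟨h1, h2⟩)
    rw [← ENNReal.tsum_add]
    refine ENNReal.tsum_le_tsum fun x => ?_
    rw [← ENNReal.tsum_add]
    refine ENNReal.tsum_le_tsum fun y => ?_
    by_cases hx : x = z <;> by_cases hy : y = z
    · simp [hx, hy]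
    · simp [hx, hy]
    · simp [hx, hy, G.b_symm x z]
    · simp [hx, hy]
  refine ENNReal.add_lt_top.2 ⟨ENNReal.mul_lt_top (by simp) h3, ?_⟩
  rw [tsum_eq_single z]
  · simp
  · intro x hx
    simp [hx]

variable [MeasurableSpace X]

/-- The graph with `m` added to the killing term; its energy is the square of the form norm. -/
def addMass (m : Measure X) : WGraph X where
  b := G.b
  c := fun x => G.c x + m.real {x}
  b_nonneg := G.b_nonneg
  b_symm := G.b_symm
  b_diag := G.b_diag
  b_summable := G.b_summable
  c_nonneg := fun x => add_nonneg (G.c_nonneg x) measureReal_nonneg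

variable {m : Measure X}

theorem energy_addMass (f : X → ℝ) :
    (G.addMass m).energy f = G.energy f + ∑' x, ENNReal.ofReal (m.real {x} * f x ^ 2) := by
  simp only [energy, addMass]
  rw [add_assoc, ← ENNReal.tsum_add]
  congr 1
  refine tsum_congr fun x => ?_
  rw [add_mul, ENNReal.ofReal_add]
  · exact mul_nonneg (G.c_nonneg x) (sq_nonneg _)
  · positivity

variable [PosFiniteAtoms m] [Countable X] [DiscreteMeasurableSpace X]

theorem one_neumann (f : Lp ℝ 2 m) : one (G.neumann m) f = (G.addMass m).energy f := by
  rw [energy_addMass, one, ofReal_norm_sq, neumann]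

theorem neumann_add (f g : Lp ℝ 2 m) : G.neumann m (f + g) = G.energy (fun x => f x + g x) := by
  rw [neumann]
  congr 1
  exact funext fun x => lp_add_apply f g x

theorem neumann_sub (f g : Lp ℝ 2 m) : G.neumann m (f - g) = G.energy (fun x => f x - g x) := by
  rw [neumann]
  congr 1
  exact funext fun x => lp_sub_apply f g x

theorem isForm_neumann : IsForm (G.neumann m) := by
  refine IsForm.of_parallelogram ?_ (fun c f _ => ?_) (fun f g _ _ => ?_)
  · have h : ((0 : Lp ℝ 2 m) : X → ℝ) = fun x => 0 * (0 : ℝ) := by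
      funext x
      rw [lp_zero_apply, zero_mul]
    rw [neumann, h, energy_smul]
    simp
  · rw [neumann, neumann, ← energy_smul]
    congr 1
    exact funext fun x => lp_smul_apply c f x
  · rw [neumann_add, neumann_sub, energy_parallelogram]
    rfl

/-- A Cauchy sequence for the form norm converges in `ℓ²`, hence pointwise. Lower semicontinuity of
the energy with added mass, applied to `u n - u k` as `k` grows, turns this into convergence in the
form norm. -/
theorem isClosedForm_neumann : IsClosedForm (G.neumann m) := by
  refine ⟨G.isForm_neumann, fun u hu hc => ?_⟩
  have hcauchy : CauchySeq u := by
    rw [Metric.cauchySeq_iff]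
    intro ε hε
    obtain ⟨N, hN⟩ := hc (ENNReal.ofReal (ε ^ 2)) (by simpa using pow_pos hε 2)
    refine ⟨N, fun n hn k hk => ?_⟩
    rw [dist_eq_norm, ← FormSpace.ofReal_sq_lt_iff (norm_nonneg _) hε]
    exact le_add_self.trans_lt (hN n hn k hk)
  obtain ⟨f, hf⟩ := cauchySeq_tendsto_of_complete hcauchy
  have key : ∀ ε : ℝ≥0∞, 0 < ε → ∃ N, ∀ n ≥ N, one (G.neumann m) (u n - f) ≤ ε := by
    intro ε hε
    obtain ⟨N, hN⟩ := hc ε hε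
    refine ⟨N, fun n hn => ?_⟩
    rw [one_neumann]
    refine (G.addMass m).energy_le_of_tendsto (l := atTop) (u := fun k => (u n - u k : Lp ℝ 2 m))
      (fun x => ?_) ((eventually_ge_atTop N).mono fun k hk => ?_)
    · simp only [lp_sub_apply]
      exact (lp_tendsto_apply hf x).const_sub _
    · rw [← one_neumann]
      exact (hN n hn k hk).le
  refine ⟨f, ?_, ?_⟩
  · obtain ⟨N, hN⟩ := key 1 one_pos
    have h1 : G.neumann m (u N - f) < ⊤ :=
      (le_self_add.trans (hN N le_rfl)).trans_lt (by simp)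
    refine G.energy_lt_top_of_le (K := 1) (hu N) h1 fun y => ?_
    have : grad f y = grad (u N) y - grad (u N - f : Lp ℝ 2 m) y := by
      rcases y with p | x
      · simp only [grad_inl, lp_sub_apply]; ring
      · simp only [grad_inr, lp_sub_apply]; ring
    rw [this, one_mul]
    exact abs_sub _ _
  · refine ENNReal.tendsto_nhds_zero.2 fun ε hε => ?_
    obtain ⟨N, hN⟩ := key ε hε
    exact eventually_atTop.2 ⟨N, hN⟩

end WGraph

/-! ### The Hilbert space `D(Q^(N))` -/

section FormSpaceDiscrete

variable {X : Type*} [MeasurableSpace X] {m : Measure X} [PosFiniteAtoms m] [Countable X]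
  [DiscreteMeasurableSpace X]

namespace FormSpace

variable {S : SymmPosForm (Lp ℝ 2 m)}

/-- The function on `X` given by an element of the form space. -/
def fn (u : FormSpace S) : X → ℝ := (incl u : Lp ℝ 2 m)

instance : CoeFun (FormSpace S) (fun _ => X → ℝ) := ⟨fn⟩

theorem incl_fn (u : FormSpace S) (x : X) : (incl u : Lp ℝ 2 m) x = u x := rfl

@[simp] theorem fn_add (u v : FormSpace S) (x : X) : (u + v) x = u x + v x := by
  simp only [← incl_fn, map_add, lp_add_apply]

@[simp] theorem fn_sub (u v : FormSpace S) (x : X) : (u - v) x = u x - v x := by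
  simp only [← incl_fn, map_sub, lp_sub_apply]

@[simp] theorem fn_neg (u : FormSpace S) (x : X) : (-u) x = -u x := by
  simp only [← incl_fn, map_neg, lp_neg_apply]

@[simp] theorem fn_smul (c : ℝ) (u : FormSpace S) (x : X) : (c • u) x = c * u x := by
  simp only [← incl_fn, map_smul, lp_smul_apply]

@[simp] theorem fn_zero (x : X) : (0 : FormSpace S) x = 0 := by
  simp only [← incl_fn, map_zero, lp_zero_apply]

theorem ext_fn {u v : FormSpace S} (h : ∀ x, u x = v x) : u = v :=
  incl_injective (lp_ext h)

/-- The evaluation at a point. -/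
def eval (x : X) : FormSpace S →L[ℝ] ℝ := (lpEval m x).comp incl

@[simp] theorem eval_apply (x : X) (u : FormSpace S) : eval x u = u x := rfl

@[simp] theorem fn_sum {ι : Type*} (s : Finset ι) (u : ι → FormSpace S) (x : X) :
    (∑ i ∈ s, u i) x = ∑ i ∈ s, u i x := by
  simp only [← eval_apply, map_sum]

/-- Bounded pointwise convergent nets converge weakly. -/
theorem tendsto_inner [CompleteSpace (FormSpace S)] {α : Type*} {l : Filter α}
    {u : α → FormSpace S} {u₀ : FormSpace S} {R : ℝ} (hb : ∀ n, ‖u n‖ ≤ R)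
    (he : ∀ x, Tendsto (fun n => u n x) l (𝓝 (u₀ x))) (v : FormSpace S) :
    Tendsto (fun n => ⟪u n, v⟫) l (𝓝 ⟪u₀, v⟫) :=
  tendsto_inner_of_bounded eval
    (fun _ h => ext_fn fun x => by simpa using h x) hb he v

end FormSpace

end FormSpaceDiscrete

namespace WGraph

variable {X : Type*} [MeasurableSpace X] [Countable X] [DiscreteMeasurableSpace X]
  (G : WGraph X) (m : Measure X) [PosFiniteAtoms m]

/-- The bilinear form of `Q^(N)`. -/
def neumannForm : SymmPosForm (Lp ℝ 2 m) := (G.isForm_neumann (m := m)).choose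

theorem neumannForm_value : (G.neumannForm m).value = G.neumann m :=
  (G.isForm_neumann (m := m)).choose_spec.symm

/-- The Hilbert space `D(Q^(N))`. -/
abbrev Dom : Type _ := FormSpace (G.neumannForm m)

instance : CompleteSpace (G.Dom m) :=
  FormSpace.completeSpace (by rw [neumannForm_value]; exact G.isClosedForm_neumann)

variable {G m}

namespace Dom

theorem neumann_incl_lt_top (u : G.Dom m) : G.neumann m (FormSpace.incl u) < ⊤ := by
  rw [← neumannForm_value]
  exact FormSpace.value_incl_lt_top u

theorem one_neumann_incl (u : G.Dom m) :
    one (G.neumann m) (FormSpace.incl u) = ENNReal.ofReal (‖u‖ ^ 2) := by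
  rw [← neumannForm_value]
  exact FormSpace.one_value_incl u

theorem energy_eq (u : G.Dom m) : (G.addMass m).energy u = ENNReal.ofReal (‖u‖ ^ 2) := by
  rw [← one_neumann_incl, one_neumann]
  rfl

theorem energy_lt_top (u : G.Dom m) : (G.addMass m).energy u < ⊤ := by
  rw [energy_eq]
  exact ENNReal.ofReal_lt_top

/-- The element of `D(Q^(N))` given by an element of `ℓ²` of finite energy. -/
def ofLp (f : Lp ℝ 2 m) (hf : G.neumann m f < ⊤) : G.Dom m :=
  FormSpace.of f (by rwa [neumannForm_value])

@[simp] theorem incl_ofLp (f : Lp ℝ 2 m) (hf : G.neumann m f < ⊤) :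
    FormSpace.incl (ofLp f hf) = f := rfl

/-- The element of `D(Q^(N))` given by a function of finite energy. -/
def mk (f : X → ℝ) (hf : (G.addMass m).energy f < ⊤) : G.Dom m := by
  have h := G.energy_addMass (m := m) f
  have h1 : G.energy f < ⊤ := lt_of_le_of_lt (by rw [h]; exact le_self_add) hf
  have h2 : ∑' x, ENNReal.ofReal (m.real {x} * f x ^ 2) < ⊤ :=
    lt_of_le_of_lt (by rw [h]; exact le_add_self) hf
  exact ofLp (lpMk f h2) (by
    rw [neumann]
    convert h1
    exact funext fun x => lpMk_apply f h2 x)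

@[simp] theorem mk_apply (f : X → ℝ) (hf : (G.addMass m).energy f < ⊤) (x : X) :
    mk f hf x = f x :=
  lpMk_apply f (lt_of_le_of_lt (by rw [G.energy_addMass]; exact le_add_self) hf) x

theorem grad_add (u v : G.Dom m) (y) : grad (u + v) y = grad u y + grad v y := by
  rcases y with p | x
  · simp; ring
  · simp

theorem grad_sub (u v : G.Dom m) (y) : grad (u - v) y = grad u y - grad v y := by
  rcases y with p | x
  · simp; ring
  · simp

theorem grad_smul (c : ℝ) (u : G.Dom m) (y) : grad (c • u) y = c * grad u y := by
  rcases y with p | x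
  · simp; ring
  · simp

/-- Functions whose values and differences are controlled by elements of `D(Q^(N))`. -/
theorem exists_of_le (f : X → ℝ) (u v : G.Dom m) {K : ℝ}
    (h : ∀ y, |grad f y| ≤ K * (|grad u y| + |grad v y|)) : ∃ w : G.Dom m, ∀ x, w x = f x :=
  ⟨mk f ((G.addMass m).energy_lt_top_of_le (energy_lt_top u) (energy_lt_top v) h), mk_apply f _⟩

/-- Sums over families are compared, rather than single norms, so that inequalities between inner
products can be obtained by polarization. -/
theorem sum_norm_sq_le {n k : ℕ} (u : Fin n → G.Dom m) (v : Fin k → G.Dom m)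
    (h : ∀ y, ∑ i, grad (u i) y ^ 2 ≤ ∑ j, grad (v j) y ^ 2) :
    ∑ i, ‖u i‖ ^ 2 ≤ ∑ j, ‖v j‖ ^ 2 := by
  have := (G.addMass m).sum_energy_le (fun i => (u i : X → ℝ)) (fun j => (v j : X → ℝ))
    (fun y _ => h y)
  simp only [energy_eq] at this
  rwa [← ENNReal.ofReal_sum_of_nonneg (fun _ _ => sq_nonneg _),
    ← ENNReal.ofReal_sum_of_nonneg (fun _ _ => sq_nonneg _), ENNReal.ofReal_le_ofReal_iff] at this
  exact Finset.sum_nonneg fun _ _ => sq_nonneg _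

theorem norm_le {u v : G.Dom m} (h : ∀ y, |grad u y| ≤ |grad v y|) : ‖u‖ ≤ ‖v‖ := by
  have := sum_norm_sq_le ![u] ![v] (fun y => by simpa using sq_le_sq.2 (h y))
  exact le_of_sq_le_sq (by simpa using this) (norm_nonneg _)

theorem norm_sq_le {u v w : G.Dom m} {K : ℝ}
    (h : ∀ y, |grad u y| ≤ K * (|grad v y| + |grad w y|)) :
    ‖u‖ ^ 2 ≤ 2 * K ^ 2 * (‖v‖ ^ 2 + ‖w‖ ^ 2) := by
  have h3 := sum_norm_sq_le ![u] ![K • (v + w), K • (v - w)] fun y => by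
    have h4 := pow_le_pow_left₀ (abs_nonneg _) (h y) 2
    simp only [Finset.univ_unique, Finset.sum_singleton, Fin.sum_univ_two, Fin.isValue,
      Matrix.cons_val_zero, Matrix.cons_val_one, Matrix.cons_val_fin_one, grad_smul, grad_add,
      grad_sub]
    rw [sq_abs] at h4
    nlinarith [sq_abs (grad v y), sq_abs (grad w y),
      mul_nonneg (sq_nonneg K) (sq_nonneg (|grad v y| - |grad w y|))]
  simp only [Finset.univ_unique, Finset.sum_singleton, Fin.sum_univ_two, Fin.isValue,
    Matrix.cons_val_zero, Matrix.cons_val_one, Matrix.cons_val_fin_one, norm_smul, mul_pow,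
    Real.norm_eq_abs, sq_abs] at h3
  have h2 := parallelogram_law_with_norm ℝ v w
  calc ‖u‖ ^ 2 ≤ K ^ 2 * (‖v + w‖ ^ 2 + ‖v - w‖ ^ 2) := by linarith
    _ = _ := by
      rw [show ‖v + w‖ ^ 2 + ‖v - w‖ ^ 2 = 2 * (‖v‖ ^ 2 + ‖w‖ ^ 2) by simpa only [pow_two] using h2]
      ring

theorem inner_le_inner {u v u' v' : G.Dom m}
    (h : ∀ y, grad u y * grad v y ≤ grad u' y * grad v' y) : ⟪u, v⟫ ≤ ⟪u', v'⟫ := by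
  have h1 := sum_norm_sq_le ![u + v, u' - v'] ![u - v, u' + v'] fun y => by
    simp only [Fin.sum_univ_two, Fin.isValue, Matrix.cons_val_zero, Matrix.cons_val_one,
      grad_add, grad_sub]
    linarith [h y]
  simp only [Fin.sum_univ_two, Fin.isValue, Matrix.cons_val_zero, Matrix.cons_val_one,
    norm_add_sq_real, norm_sub_sq_real] at h1
  linarith

theorem hasSum_norm_sq (u : G.Dom m) :
    HasSum (fun y => (G.addMass m).weight y * grad u y ^ 2) (‖u‖ ^ 2) := by
  have h := energy_eq u
  rw [energy_eq_tsum] at h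
  have h1 := ENNReal.hasSum_toReal (h.trans_ne ENNReal.ofReal_ne_top)
  rw [← ENNReal.tsum_toReal_eq (fun _ => ENNReal.ofReal_ne_top), h,
    ENNReal.toReal_ofReal (sq_nonneg _)] at h1
  convert h1 using 2 with y
  rw [ENNReal.toReal_ofReal (mul_nonneg (weight_nonneg _ y) (sq_nonneg _))]

theorem hasSum_inner (u v : G.Dom m) :
    HasSum (fun y => (G.addMass m).weight y * grad u y * grad v y) ⟪u, v⟫ := by
  have h := ((hasSum_norm_sq (u + v)).sub (hasSum_norm_sq (u - v))).div_const 4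
  rw [norm_add_sq_real, norm_sub_sq_real] at h
  refine (congrArg₂ HasSum (funext fun y => ?_) ?_).mpr h
  · rw [grad_add, grad_sub]; ring
  · ring

/-! ### Contractions, products and finitely supported functions in `D(Q^(N))` -/

/-- Composition with a normal contraction. -/
theorem exists_comp (u : G.Dom m) {C : ℝ → ℝ} (hC : LipschitzWith 1 C) (h0 : C 0 = 0) :
    ∃ w : G.Dom m, ∀ x, w x = C (u x) :=
  exists_of_le _ u 0 (K := 1) fun y => by
    have h : ∀ s t, |C s - C t| ≤ |s - t| := fun s t => by simpa [Real.dist_eq] using hC.dist_le_mul s t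
    rcases y with p | x
    · simpa using h _ _
    · simpa [h0] using h (u x) 0

/-- Composition with a normal contraction. -/
def comp {C : ℝ → ℝ} (hC : LipschitzWith 1 C) (h0 : C 0 = 0) (u : G.Dom m) : G.Dom m :=
  (exists_comp u hC h0).choose

@[simp] theorem comp_apply {C : ℝ → ℝ} (hC : LipschitzWith 1 C) (h0 : C 0 = 0) (u : G.Dom m)
    (x : X) : comp hC h0 u x = C (u x) := (exists_comp u hC h0).choose_spec x

theorem abs_grad_comp_le {C : ℝ → ℝ} (hC : LipschitzWith 1 C) (h0 : C 0 = 0) (u : G.Dom m) (y) :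
    |grad (comp hC h0 u) y| ≤ |grad u y| := by
  have h : ∀ s t, |C s - C t| ≤ |s - t| := fun s t => by
    simpa [Real.dist_eq] using hC.dist_le_mul s t
  rcases y with p | x
  · simpa using h _ _
  · simpa [h0] using h (u x) 0

theorem norm_comp_le {C : ℝ → ℝ} (hC : LipschitzWith 1 C) (h0 : C 0 = 0) (u : G.Dom m) :
    ‖comp hC h0 u‖ ≤ ‖u‖ :=
  norm_le (abs_grad_comp_le hC h0 u)

theorem incl_comp {C : ℝ → ℝ} (hC : LipschitzWith 1 C) (h0 : C 0 = 0) (u : G.Dom m) :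
    FormSpace.incl (comp hC h0 u) = hC.compLp h0 (FormSpace.incl u) :=
  lp_ext fun x => by
    rw [lp_comp_apply]
    exact comp_apply hC h0 u x

/-- Products of bounded functions. -/
theorem exists_mul (u v : G.Dom m) {M : ℝ} (hu : ∀ x, |u x| ≤ M) (hv : ∀ x, |v x| ≤ M) :
    ∃ w : G.Dom m, ∀ x, w x = u x * v x :=
  exists_of_le _ u v (K := M) fun y => by
    rcases y with p | x
    · simp only [grad_inl]
      have : u p.1 * v p.1 - u p.2 * v p.2 = (u p.1 - u p.2) * v p.1 + u p.2 * (v p.1 - v p.2) := by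
        ring
      rw [this]
      refine (abs_add_le _ _).trans ?_
      rw [abs_mul, abs_mul]
      nlinarith [mul_le_mul_of_nonneg_left (hv p.1) (abs_nonneg (u p.1 - u p.2)),
        mul_le_mul_of_nonneg_right (hu p.2) (abs_nonneg (v p.1 - v p.2))]
    · simp only [grad_inr, abs_mul]
      have hM : 0 ≤ M := (abs_nonneg _).trans (hu x)
      nlinarith [mul_le_mul_of_nonneg_left (hv x) (abs_nonneg (u x)), mul_nonneg hM (abs_nonneg (v x))]

open Classical in
/-- The characteristic function of a point. -/
def dirac (z : X) : G.Dom m :=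
  mk (fun x => if x = z then 1 else 0) ((G.addMass m).energy_dirac_lt_top z)

open Classical in
@[simp] theorem dirac_apply (z x : X) : (dirac z : G.Dom m) x = if x = z then 1 else 0 :=
  mk_apply _ _ x

theorem eq_sum_dirac {u : G.Dom m} {s : Finset X} (h : ∀ x ∉ s, u x = 0) :
    u = ∑ z ∈ s, u z • dirac z := by
  classical
  refine FormSpace.ext_fn fun x => ?_
  simp only [FormSpace.fn_sum, FormSpace.fn_smul, dirac_apply, mul_ite, mul_one, mul_zero,
    Finset.sum_ite_eq]
  split_ifs with hx
  · rfl
  · exact h x hx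

/-- Restriction to a finite set. -/
def restrict (s : Finset X) (u : X → ℝ) : G.Dom m := ∑ z ∈ s, u z • dirac z

open Classical in
@[simp] theorem restrict_apply (s : Finset X) (u : X → ℝ) (x : X) :
    (restrict s u : G.Dom m) x = if x ∈ s then u x else 0 := by
  simp [restrict]

/-- Finite energy and summable weights suffice, because `|t| ≤ t²/2 + 1`. -/
theorem summable_b_mul (u : G.Dom m) (x : X) : Summable fun y => G.b x y * (u x - u y) := by
  have h := (hasSum_norm_sq u).summable
  have h1 : Summable fun y => G.b x y / 2 * (u x - u y) ^ 2 :=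
    h.comp_injective (i := fun y => Sum.inl (x, y)) (fun y y' hy => by simpa using hy)
  refine Summable.of_norm_bounded (h1.add ((G.b_summable x))) fun y => ?_
  rw [Real.norm_eq_abs, abs_mul, abs_of_nonneg (G.b_nonneg x y)]
  have hb := G.b_nonneg x y
  nlinarith [mul_nonneg hb (sq_nonneg (|u x - u y| - 1)), sq_abs (u x - u y)]

theorem summable_b_abs (u : G.Dom m) (x : X) : Summable fun y => G.b x y * |u y| := by
  have h := (summable_b_mul u x).abs.add ((G.b_summable x).mul_right |u x|)
  refine Summable.of_nonneg_of_le (fun y => mul_nonneg (G.b_nonneg x y) (abs_nonneg _))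
    (fun y => ?_) h
  rw [abs_mul, abs_of_nonneg (G.b_nonneg x y), ← mul_add]
  refine mul_le_mul_of_nonneg_left ?_ (G.b_nonneg x y)
  have := abs_sub_abs_le_abs_sub (u y) (u x)
  rw [abs_sub_comm] at this
  linarith

/-- Green's formula: the right-hand side is `m(z)` times `(𝓛 + 1) u` at `z`, which turns harmonicity
into orthogonality. -/
theorem inner_dirac (u : G.Dom m) (z : X) :
    ⟪u, dirac z⟫ = ∑' y, G.b z y * (u z - u y) + (G.c z + m.real {z}) * u z := by
  classical
  refine (hasSum_inner u (dirac z)).unique ?_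
  set A : X → ℝ := fun y => G.b z y / 2 * (u z - u y) with hA
  have hAs : HasSum A ((∑' y, G.b z y * (u z - u y)) / 2) := by
    refine (congrArg₂ HasSum (funext fun y => ?_) rfl).mpr
      ((summable_b_mul u z).hasSum.div_const 2)
    simp only [hA]; ring
  -- A neighbour `y` of `z` occurs in the two ordered pairs `(z,y)` and `(y,z)`, each with half of
  -- the weight.
  have h1 : HasSum (fun p : X × X => if p.1 = z then A p.2 else 0)
      ((∑' y, G.b z y * (u z - u y)) / 2) := by
    refine (Function.Injective.hasSum_iff (g := fun y : X => (z, y))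
      (fun y y' hy => by simpa using hy) ?_).1 (by simpa [Function.comp_def] using hAs)
    rintro ⟨x, y⟩ hxy
    rw [if_neg]
    rintro rfl
    exact hxy ⟨y, rfl⟩
  have h2 : HasSum (fun p : X × X => if p.2 = z then A p.1 else 0)
      ((∑' y, G.b z y * (u z - u y)) / 2) := by
    refine (Function.Injective.hasSum_iff (g := fun y : X => (y, z))
      (fun y y' hy => by simpa using hy) ?_).1 (by simpa [Function.comp_def] using hAs)
    rintro ⟨x, y⟩ hxy
    rw [if_neg]
    rintro rfl
    exact hxy ⟨x, rfl⟩
  have h3 : HasSum (fun x : X => if x = z then (G.c z + m.real {z}) * u z else 0)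
      ((G.c z + m.real {z}) * u z) := by
    convert hasSum_ite_eq z ((G.c z + m.real {z}) * u z)
  rw [← add_halves (∑' y, G.b z y * (u z - u y))]
  refine HasSum.sum (f := fun y => (G.addMass m).weight y * grad u y * grad (dirac z) y) ?_ ?_
  · convert h1.add h2 using 2 with p
    obtain ⟨x, y⟩ := p
    simp only [Function.comp, weight, addMass, Sum.elim_inl, grad_inl, dirac_apply, hA]
    by_cases hx : x = z <;> by_cases hy : y = z
    · simp [hx, hy]
    · simp [hx, hy]
    · simp [hx, hy, G.b_symm z x]; ring
    · simp [hx, hy]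
  · convert h3 using 2 with x
    simp only [Function.comp, weight, addMass, Sum.elim_inr, grad_inr, dirac_apply]
    by_cases hx : x = z
    · simp [hx]
    · simp [hx]

end Dom

end WGraph

/-! ### Contractions -/

theorem abs_sub_le_of_lipschitz {C : ℝ → ℝ} (hC : LipschitzWith 1 C) (s t : ℝ) :
    |C s - C t| ≤ |s - t| := by
  simpa [Real.dist_eq] using hC.dist_le_mul s t

theorem abs_le_of_lipschitz {C : ℝ → ℝ} (hC : LipschitzWith 1 C) (h0 : C 0 = 0) (t : ℝ) :
    |C t| ≤ |t| := by
  simpa [h0] using abs_sub_le_of_lipschitz hC t 0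

/-- The part of `t` between `s` and `s + 1`. -/
def slice (s t : ℝ) : ℝ := max 0 (min 1 (t - s))

theorem lipschitz_slice (s : ℝ) : LipschitzWith 1 (slice s) := by
  have h : LipschitzWith 1 fun t : ℝ => t - s := LipschitzWith.of_dist_le_mul fun a b => by simp
  exact (h.const_min 1).const_max 0

theorem slice_zero {s : ℝ} (hs : 0 ≤ s) : slice s 0 = 0 := by
  simp only [slice, zero_sub, max_eq_left_iff]
  exact (min_le_right _ _).trans (by linarith)

theorem slice_nonneg (s t : ℝ) : 0 ≤ slice s t := le_max_left _ _

theorem slice_le_one (s t : ℝ) : slice s t ≤ 1 := max_le zero_le_one (min_le_left _ _)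

theorem slice_eq_zero_iff {s t : ℝ} : slice s t = 0 ↔ t ≤ s := by
  simp [slice]

theorem slice_mono (s : ℝ) : Monotone (slice s) := fun a b h =>
  max_le_max le_rfl (min_le_min le_rfl (by linarith))

/-- Truncation at height `n`. -/
def clamp (n t : ℝ) : ℝ := max (-n) (min n t)

theorem lipschitz_clamp (n : ℝ) : LipschitzWith 1 (clamp n) :=
  (LipschitzWith.id.const_min n).const_max (-n)

theorem clamp_zero {n : ℝ} (hn : 0 ≤ n) : clamp n 0 = 0 := by
  simp [clamp, hn]

theorem abs_clamp_le {n : ℝ} (hn : 0 ≤ n) (t : ℝ) : |clamp n t| ≤ n :=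
  abs_le.2 ⟨le_max_left _ _, max_le (by linarith) (min_le_left _ _)⟩

theorem clamp_eq_self {n t : ℝ} (h : |t| ≤ n) : clamp n t = t := by
  obtain ⟨h1, h2⟩ := abs_le.1 h
  rw [clamp, min_eq_right h2, max_eq_right h1]

theorem tendsto_clamp (t : ℝ) : Tendsto (fun n : ℕ => clamp n t) atTop (𝓝 t) := by
  obtain ⟨N, hN⟩ := exists_nat_ge |t|
  refine tendsto_const_nhds.congr' ((eventually_ge_atTop N).mono fun n hn => ?_)
  exact (clamp_eq_self (hN.trans (by exact_mod_cast hn))).symm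

theorem lipschitz_abs : LipschitzWith 1 (fun t : ℝ => |t|) :=
  LipschitzWith.of_dist_le_mul fun a b => by
    simpa [Real.dist_eq] using abs_abs_sub_abs_le_abs_sub a b

/-! ### The domain of the Dirichlet form -/

namespace WGraph

variable {X : Type*} [MeasurableSpace X] [Countable X] [DiscreteMeasurableSpace X]
  (G : WGraph X) (m : Measure X) [PosFiniteAtoms m]

/-- `D(Q^(D))` as a closed subspace of `D(Q^(N))`. -/
def dirDom : Submodule ℝ (G.Dom m) :=
  (Submodule.span ℝ (Set.range (Dom.dirac : X → G.Dom m))).topologicalClosure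

theorem isClosed_dirDom : IsClosed (G.dirDom m : Set (G.Dom m)) :=
  Submodule.isClosed_topologicalClosure _

instance : CompleteSpace (G.dirDom m) := (G.isClosed_dirDom m).completeSpace_coe

variable {G m}

theorem dirac_mem_dirDom (x : X) : (Dom.dirac x : G.Dom m) ∈ G.dirDom m :=
  Submodule.le_topologicalClosure _ (Submodule.subset_span ⟨x, rfl⟩)

theorem restrict_mem_dirDom (s : Finset X) (f : X → ℝ) :
    (Dom.restrict s f : G.Dom m) ∈ G.dirDom m :=
  Submodule.sum_mem _ fun x _ => Submodule.smul_mem _ _ (dirac_mem_dirDom x)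

theorem mem_dirDom_of_support {u : G.Dom m} (h : (Function.support u).Finite) :
    u ∈ G.dirDom m := by
  rw [Dom.eq_sum_dirac (s := h.toFinset) (u := u) (fun x hx => by simpa using hx)]
  exact restrict_mem_dirDom _ _

theorem finite_support_of_mem_span {u : G.Dom m}
    (hu : u ∈ Submodule.span ℝ (Set.range (Dom.dirac : X → G.Dom m))) :
    (Function.support u).Finite := by
  classical
  induction hu using Submodule.span_induction with
  | mem u hu =>
    obtain ⟨x, rfl⟩ := hu
    refine (Set.finite_singleton x).subset fun y hy => ?_
    by_contra h
    exact hy (by simpa using h)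
  | zero =>
    convert Set.finite_empty
    ext x
    simp
  | add u v _ _ hu hv =>
    refine (hu.union hv).subset fun x hx => ?_
    by_contra h
    simp only [Set.mem_union, Function.mem_support, not_or, not_not] at h
    exact hx (by simp [h.1, h.2])
  | smul c u _ hu =>
    refine hu.subset fun x hx => ?_
    intro h
    exact hx (by simp [h])

/-- Elements of `D(Q^(D))` are limits of finitely supported functions. -/
theorem exists_seq_of_mem_dirDom {u : G.Dom m} (hu : u ∈ G.dirDom m) :
    ∃ v : ℕ → G.Dom m, (∀ n, (Function.support (v n)).Finite) ∧ Tendsto v atTop (𝓝 u) := by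
  obtain ⟨v, hv, hlim⟩ := mem_closure_iff_seq_limit.1 hu
  exact ⟨v, fun n => finite_support_of_mem_span (hv n), hlim⟩

theorem inDirichletDomain_iff (u : G.Dom m) :
    G.InDirichletDomain m (FormSpace.incl u) ↔ u ∈ G.dirDom m := by
  constructor
  · rintro ⟨-, h⟩
    change u ∈ closure _
    rw [Metric.mem_closure_iff]
    intro ε hε
    obtain ⟨g, hg, hlt⟩ := h (ENNReal.ofReal (ε ^ 2)) (by simpa using pow_pos hε 2)
    set v : G.Dom m := Dom.restrict hg.toFinset g
    have hv : FormSpace.incl v = g := lp_ext fun x => by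
      classical
      rw [FormSpace.incl_fn, Dom.restrict_apply]
      split_ifs with hx
      · rfl
      · simpa using (not_congr hg.mem_toFinset).1 hx |> fun h => (not_not.1 h).symm
    refine ⟨v, ?_, ?_⟩
    · exact Submodule.sum_mem _ fun x _ =>
        Submodule.smul_mem _ _ (Submodule.subset_span ⟨x, rfl⟩)
    · rw [← hv, ← map_sub, Dom.one_neumann_incl,
        FormSpace.ofReal_sq_lt_iff (norm_nonneg _) hε] at hlt
      rwa [dist_eq_norm]
  · intro h
    refine ⟨Dom.neumann_incl_lt_top u, fun ε hε => ?_⟩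
    obtain ⟨v, hv, hlim⟩ := exists_seq_of_mem_dirDom h
    have h1 : Tendsto (fun n => ENNReal.ofReal (‖u - v n‖ ^ 2)) atTop (𝓝 0) := by
      have h2 : Tendsto (fun n => ‖u - v n‖ ^ 2) atTop (𝓝 0) := by
        have h3 := ((tendsto_const_nhds (x := u)).sub hlim).norm.pow 2
        simpa using h3
      simpa using ENNReal.tendsto_ofReal h2
    obtain ⟨n, hn⟩ := (h1.eventually (gt_mem_nhds hε)).exists
    refine ⟨FormSpace.incl (v n), hv n, ?_⟩
    rwa [← map_sub, Dom.one_neumann_incl]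

theorem dirichlet_incl_of_mem {u : G.Dom m} (h : u ∈ G.dirDom m) :
    G.dirichlet m (FormSpace.incl u) = G.neumann m (FormSpace.incl u) := by
  rw [dirichlet, if_pos ((inDirichletDomain_iff u).2 h)]

theorem dirichlet_incl_lt_top_iff (u : G.Dom m) :
    G.dirichlet m (FormSpace.incl u) < ⊤ ↔ u ∈ G.dirDom m := by
  constructor
  · intro h
    by_contra hu
    rw [dirichlet, if_neg (mt (inDirichletDomain_iff u).1 hu)] at h
    exact lt_irrefl _ h
  · intro h
    rw [dirichlet_incl_of_mem h]
    exact Dom.neumann_incl_lt_top u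

theorem neumann_le_dirichlet : G.neumann m ≤ G.dirichlet m := fun f => by
  rw [dirichlet]
  split_ifs
  · exact le_rfl
  · exact le_top

/-- `D(Q^(D))` is closed under bounded pointwise convergence. -/
theorem mem_dirDom_of_tendsto {α : Type*} {l : Filter α} [l.NeBot] {u : α → G.Dom m}
    {u₀ : G.Dom m} {R : ℝ} (hu : ∀ n, u n ∈ G.dirDom m) (hb : ∀ n, ‖u n‖ ≤ R)
    (he : ∀ x, Tendsto (fun n => u n x) l (𝓝 (u₀ x))) : u₀ ∈ G.dirDom m := by
  -- Bounded pointwise convergence is weak convergence, and a closed subspace, being its own double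
  -- orthogonal complement, is weakly closed.
  rw [← Submodule.orthogonal_orthogonal (G.dirDom m), Submodule.mem_orthogonal']
  intro w hw
  have h := FormSpace.tendsto_inner hb he w
  have h0 : ∀ n, ⟪u n, w⟫ = 0 := fun n => (Submodule.mem_orthogonal _ _).1 hw _ (hu n)
  simp only [h0] at h
  exact (tendsto_nhds_unique h tendsto_const_nhds)

/-- `D(Q^(D))` is an order ideal of `D(Q^(N))`. -/
theorem mem_dirDom_of_abs_le {u w : G.Dom m} (hw : w ∈ G.dirDom m) (h : ∀ x, |u x| ≤ |w x|) :
    u ∈ G.dirDom m := by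
  obtain ⟨v, hv, hlim⟩ := exists_seq_of_mem_dirDom hw
  -- `u` is truncated at height `|v n|`, where the `v n` are finitely supported and tend to `w`. The
  -- truncations are finitely supported, bounded in norm by this estimate, and tend pointwise to `u`
  -- because `|u| ≤ |w|`.
  have hcl : ∀ (v : G.Dom m) (y), |grad (fun x => clamp |v x| (u x)) y| ≤
      1 * (|grad u y| + |grad v y|) := by
    intro v y
    have aux : ∀ a b s t : ℝ, |clamp |a| s - clamp |b| t| ≤ |s - t| + |a - b| := by
      intro a b s t
      have h1 := abs_sub_le_of_lipschitz (lipschitz_clamp |a|) s t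
      have h2 : |clamp |a| t - clamp |b| t| ≤ |a - b| := by
        refine le_trans ?_ (abs_abs_sub_abs_le_abs_sub a b)
        have := abs_max_sub_max_le_max (-|a|) (min |a| t) (-|b|) (min |b| t)
        refine this.trans (max_le ?_ ?_)
        · rw [← abs_neg]
          refine le_of_eq ?_
          congr 1
          ring
        · have := abs_min_sub_min_le_max |a| t |b| t
          simpa using this
      calc |clamp |a| s - clamp |b| t|
          = |(clamp |a| s - clamp |a| t) + (clamp |a| t - clamp |b| t)| := by congr 1; ring
        _ ≤ _ := (abs_add_le _ _).trans (add_le_add h1 h2)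
    rw [one_mul]
    rcases y with p | x
    · exact aux _ _ _ _
    · have := aux (v x) 0 (u x) 0
      simpa [clamp] using this
  choose c hc using fun n => Dom.exists_of_le _ u (v n) (hcl (v n))
  have hfin : ∀ n, (Function.support (c n)).Finite := fun n =>
    (hv n).subset fun x hx hvx => hx (by rw [hc, hvx]; simp [clamp])
  obtain ⟨R, hR⟩ : ∃ R, ∀ n, ‖v n‖ ≤ R := by
    obtain ⟨R, hR⟩ := hlim.norm.bddAbove_range
    exact ⟨R, fun n => hR ⟨n, rfl⟩⟩
  refine mem_dirDom_of_tendsto (l := atTop) (R := Real.sqrt (2 * (‖u‖ ^ 2 + R ^ 2)))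
    (fun n => mem_dirDom_of_support (hfin n)) (fun n => ?_) (fun x => ?_)
  · refine Real.le_sqrt_of_sq_le ?_
    have h1 := Dom.norm_sq_le (u := c n) (v := u) (w := v n) (K := 1) (fun y => by
      rw [show (c n : X → ℝ) = _ from funext (hc n)]
      exact hcl (v n) y)
    have h2 := pow_le_pow_left₀ (norm_nonneg _) (hR n) 2
    linarith
  · simp only [hc]
    have hx : Tendsto (fun n => v n x) atTop (𝓝 (w x)) :=
      ((FormSpace.eval x).continuous.tendsto w).comp hlim
    have : Tendsto (fun n => clamp |v n x| (u x)) atTop (𝓝 (clamp |w x| (u x))) := by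
      unfold clamp
      exact hx.abs.neg.max (hx.abs.min tendsto_const_nhds)
    rwa [clamp_eq_self (h x)] at this

theorem comp_mem_dirDom {C : ℝ → ℝ} (hC : LipschitzWith 1 C) (h0 : C 0 = 0) {u : G.Dom m}
    (hu : u ∈ G.dirDom m) : Dom.comp hC h0 u ∈ G.dirDom m :=
  mem_dirDom_of_abs_le hu fun x => by
    rw [Dom.comp_apply]
    exact abs_le_of_lipschitz hC h0 _

/-! ### The Royden decomposition -/

theorem dirDom_orthogonal_iff (u : G.Dom m) :
    u ∈ (G.dirDom m)ᗮ ↔ ∀ x, ⟪u, Dom.dirac x⟫ = 0 := by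
  constructor
  · exact fun h x => (Submodule.mem_orthogonal' _ _).1 h _ (dirac_mem_dirDom x)
  · intro h
    rw [dirDom, Submodule.orthogonal_closure, Submodule.mem_orthogonal']
    intro v hv
    induction hv using Submodule.span_induction with
    | mem v hv => obtain ⟨x, rfl⟩ := hv; exact h x
    | zero => simp
    | add v w _ _ hv hw => rw [inner_add_right, hv, hw, add_zero]
    | smul c v _ hv => rw [real_inner_smul_right, hv, mul_zero]

/-- The `1`-harmonic functions are the orthogonal complement of `D(Q^(D))`. -/
theorem isOneHarmonic_iff (u : G.Dom m) :
    G.IsOneHarmonic m u ↔ u ∈ (G.dirDom m)ᗮ := by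
  rw [dirDom_orthogonal_iff]
  have key : ∀ x, G.laplacian m u x + u x = 0 ↔ ⟪u, Dom.dirac x⟫ = 0 := fun x => by
    rw [Dom.inner_dirac, laplacian]
    have hm := mass_pos m x
    set T := ∑' y, G.b x y * (u x - u y)
    have : 1 / m.real {x} * T + G.c x / m.real {x} * u x + u x =
        (T + (G.c x + m.real {x}) * u x) / m.real {x} := by
      field_simp
      ring
    rw [this, div_eq_zero_iff]
    simp [hm.ne']
  constructor
  · exact fun h x => (key x).1 (h.2 x)
  · exact fun h => ⟨Dom.summable_b_abs u, fun x => (key x).2 (h x)⟩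

/-- The `1`-harmonic part in the Royden decomposition. -/
def harm : G.Dom m →L[ℝ] G.Dom m :=
  ContinuousLinearMap.id ℝ _ - (G.dirDom m).starProjection

theorem sub_harm_mem (u : G.Dom m) : u - harm u ∈ G.dirDom m := by
  have : u - harm u = (G.dirDom m).starProjection u := by simp [harm]
  rw [this]
  exact Submodule.starProjection_apply_mem _ _

theorem harm_mem (u : G.Dom m) : harm u ∈ (G.dirDom m)ᗮ :=
  Submodule.sub_starProjection_mem_orthogonal u

theorem eq_zero_of_mem_of_mem {u : G.Dom m} (h : u ∈ G.dirDom m) (h' : u ∈ (G.dirDom m)ᗮ) :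
    u = 0 :=
  inner_self_eq_zero.1 ((Submodule.mem_orthogonal _ _).1 h' _ h)

theorem harm_eq_of_sub_mem {u h : G.Dom m} (h1 : u - h ∈ G.dirDom m)
    (h2 : h ∈ (G.dirDom m)ᗮ) : harm u = h := by
  refine sub_eq_zero.1 (eq_zero_of_mem_of_mem ?_ (Submodule.sub_mem _ (harm_mem u) h2))
  have := Submodule.sub_mem _ h1 (sub_harm_mem u)
  simpa using this

theorem harm_eq_zero_iff {u : G.Dom m} : harm u = 0 ↔ u ∈ G.dirDom m := by
  constructor
  · intro h
    simpa [h] using sub_harm_mem u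
  · intro h
    exact harm_eq_of_sub_mem (by simpa using h) (Submodule.zero_mem _)

theorem harm_eq_self {u : G.Dom m} (h : u ∈ (G.dirDom m)ᗮ) : harm u = u :=
  harm_eq_of_sub_mem (by simp) h

theorem inner_harm (u v : G.Dom m) : ⟪harm u, v⟫ = ⟪u, harm v⟫ := by
  have h1 : ⟪harm u, v - harm v⟫ = 0 :=
    (Submodule.mem_orthogonal' _ _).1 (harm_mem u) _ (sub_harm_mem v)
  have h2 : ⟪u - harm u, harm v⟫ = 0 :=
    (Submodule.mem_orthogonal _ _).1 (harm_mem v) _ (sub_harm_mem u)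
  rw [inner_sub_right] at h1
  rw [inner_sub_left] at h2
  linarith

theorem norm_sq_eq_add (u : G.Dom m) : ‖u‖ ^ 2 = ‖u - harm u‖ ^ 2 + ‖harm u‖ ^ 2 := by
  have h2 : ⟪u - harm u, harm u⟫ = 0 :=
    (Submodule.mem_orthogonal _ _).1 (harm_mem u) _ (sub_harm_mem u)
  have := norm_add_sq_real (u - harm u) (harm u)
  rw [h2, sub_add_cancel] at this
  linarith

/-! ### The maximum principle -/

/-- `h` is orthogonal to `w = slice s h`, while `⟪w, w⟫ ≤ ⟪h, w⟫` since `slice s` is a monotone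
contraction. Hence `w = 0`. Cutting off at height one, instead of using the positive part of `h -
s`, keeps the test function bounded, as the boundary version below requires. -/
theorem le_of_slice_mem {h w : G.Dom m} (hh : h ∈ (G.dirDom m)ᗮ) {s : ℝ} (hs : 0 ≤ s)
    (hw : w ∈ G.dirDom m) (hwh : ∀ x, w x = slice s (h x)) (x : X) : h x ≤ s := by
  have h0 : ⟪h, w⟫ = 0 := (Submodule.mem_orthogonal' _ _).1 hh _ hw
  have h1 : ⟪w, w⟫ ≤ ⟪h, w⟫ := by
    refine Dom.inner_le_inner fun y => ?_
    have aux : ∀ a b : ℝ, (slice s a - slice s b) * (slice s a - slice s b) ≤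
        (a - b) * (slice s a - slice s b) := by
      intro a b
      have hl := abs_sub_le_of_lipschitz (lipschitz_slice s) a b
      rcases le_total a b with hab | hab
      · have := slice_mono s hab
        rw [abs_of_nonpos (by linarith), abs_of_nonpos (by linarith)] at hl
        nlinarith
      · have := slice_mono s hab
        rw [abs_of_nonneg (by linarith), abs_of_nonneg (by linarith)] at hl
        nlinarith
    rcases y with p | x
    · simpa [hwh] using aux _ _
    · simpa [hwh, slice_zero hs] using aux (h x) 0
  have h2 : w = 0 := by
    rw [h0] at h1
    exact inner_self_eq_zero.1 (le_antisymm h1 real_inner_self_nonneg)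
  have h3 := hwh x
  rw [h2, FormSpace.fn_zero] at h3
  exact slice_eq_zero_iff.1 h3.symm

/-- The maximum principle: if `u ≤ s` up to `D(Q^(D))`, then its harmonic part is at most `s`. -/
theorem harm_le_of_slice_mem {u v : G.Dom m} {s : ℝ} (hs : 0 ≤ s) (hv : v ∈ G.dirDom m)
    (hvu : ∀ x, v x = slice s (u x)) (x : X) : harm u x ≤ s := by
  set w := Dom.comp (lipschitz_slice s) (slice_zero hs) (harm u)
  set d := u - harm u with hd
  have ha := comp_mem_dirDom lipschitz_abs abs_zero (sub_harm_mem u)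
  refine le_of_slice_mem (w := w) (harm_mem u) hs ?_ (fun x => by simp [w]) x
  -- `slice s` is a contraction, so `slice s (harm u) ≤ slice s u + |u - harm u|`, and the
  -- right-hand side lies in the ideal `D(Q^(D))`.
  refine mem_dirDom_of_abs_le (Submodule.add_mem _ hv ha) fun x => ?_
  simp only [w, Dom.comp_apply, FormSpace.fn_add, FormSpace.fn_sub, hvu]
  rw [abs_of_nonneg (slice_nonneg _ _),
    abs_of_nonneg (add_nonneg (slice_nonneg _ _) (abs_nonneg _))]
  have h1 := abs_sub_le_of_lipschitz (lipschitz_slice s) (harm u x) (u x)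
  rw [abs_sub_comm (harm u x)] at h1
  linarith [le_abs_self (slice s (harm u x) - slice s (u x))]

theorem harm_le {u : G.Dom m} {s : ℝ} (hs : 0 ≤ s) (h : ∀ x, u x ≤ s) (x : X) : harm u x ≤ s :=
  harm_le_of_slice_mem hs (Submodule.zero_mem _)
    (fun x => by rw [slice_eq_zero_iff.2 (h x), FormSpace.fn_zero]) x

theorem harm_nonneg {u : G.Dom m} (h : ∀ x, 0 ≤ u x) (x : X) : 0 ≤ harm u x := by
  have := harm_le (u := -u) le_rfl (fun x => by simpa using h x) x
  simpa using this

theorem harm_mono {u v : G.Dom m} (h : ∀ x, u x ≤ v x) (x : X) : harm u x ≤ harm v x := by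
  have := harm_nonneg (u := v - u) (fun x => by simpa using h x) x
  simpa using this

/-- A nonnegative harmonic function with a zero vanishes. -/
theorem eq_zero_of_nonneg_of_zero (hG : G.Connected) {h : G.Dom m} (hh : h ∈ (G.dirDom m)ᗮ)
    (hpos : ∀ x, 0 ≤ h x) {o : X} (ho : h o = 0) : h = 0 := by
  -- At a zero of `h` the harmonic equation reads `∑ b(x,y) h(y) = 0` with nonnegative terms, so
  -- zeros propagate along edges.
  have step : ∀ x y, h x = 0 → 0 < G.b x y → h y = 0 := by
    intro x y hx hb
    have h1 := (dirDom_orthogonal_iff h).1 hh x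
    rw [Dom.inner_dirac, hx, mul_zero, add_zero] at h1
    have h2 : Summable fun y => G.b x y * h y := by
      simpa only [abs_of_nonneg (hpos _)] using Dom.summable_b_abs h x
    have h3 : ∑' y, G.b x y * h y = 0 := by
      have : (fun y => G.b x y * (0 - h y)) = fun y => -(G.b x y * h y) := by
        funext y; ring
      rw [this, tsum_neg] at h1
      linarith
    have h4 := (hasSum_zero_iff_of_nonneg
      (fun y => mul_nonneg (G.b_nonneg x y) (hpos y))).1 (h3 ▸ h2.hasSum)
    have h5 := congrFun h4 y
    exact (mul_eq_zero.1 h5).resolve_left hb.ne'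
  refine FormSpace.ext_fn fun x => ?_
  rw [FormSpace.fn_zero]
  induction hG o x with
  | refl => exact ho
  | tail _ hb ih => exact step _ _ ih hb

end WGraph

/-- `arctan` is a bounded injective normal contraction. So `arctan ∘ u` is a bounded element of
`D(Q^(N))`, and its extension to the compactification encodes infinite limits of `u` as `±π/2`. -/
theorem lipschitz_arctan : LipschitzWith 1 Real.arctan := by
  refine lipschitzWith_of_nnnorm_deriv_le Real.differentiable_arctan fun x => ?_
  rw [← NNReal.coe_le_coe, coe_nnnorm, Real.deriv_arctan, Real.norm_eq_abs,
    abs_of_nonneg (by positivity), NNReal.coe_one, div_le_one (by positivity)]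
  linarith [sq_nonneg x]

namespace WGraph

variable {X : Type*} [MeasurableSpace X] [Countable X] [DiscreteMeasurableSpace X]
  {G : WGraph X} {m : Measure X} [PosFiniteAtoms m]

/-! ### The compactification -/

instance : T2Space (G.Compactification m) :=
  inferInstanceAs (T2Space {z : G.BddDomain m → ℝ // z ∈ closure (Set.range (G.evalMap m))})

instance : CompactSpace (G.Compactification m) := by
  refine isCompact_iff_compactSpace.1 ?_
  choose M hM using fun f : G.BddDomain m => f.2.2
  refine IsCompact.of_isClosed_subset
    (isCompact_univ_pi fun f => isCompact_Icc (a := -M f) (b := M f)) isClosed_closure ?_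
  refine closure_minimal ?_ (isClosed_set_pi fun f _ => isClosed_Icc)
  rintro _ ⟨x, rfl⟩ f -
  exact abs_le.1 (hM f x)

theorem continuous_coord (f : G.BddDomain m) :
    Continuous fun z : G.Compactification m => z.1 f :=
  (continuous_apply f).comp continuous_subtype_val

theorem denseRange_embed : DenseRange (G.embed m) := by
  intro z
  refine closure_subtype.2 (closure_mono ?_ z.2)
  rintro _ ⟨x, rfl⟩
  exact ⟨G.embed m x, ⟨x, rfl⟩, rfl⟩

/-- The trace on `X` of the neighbourhoods of a point of the compactification. -/
def nhdsX (z : G.Compactification m) : Filter X := comap (G.embed m) (𝓝 z)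

instance (z : G.Compactification m) : (nhdsX z).NeBot :=
  comap_neBot_iff.2 fun _ ht => by
    obtain ⟨_, h1, x, rfl⟩ := mem_closure_iff_nhds.1 (denseRange_embed z) _ ht
    exact ⟨x, h1⟩

theorem tendsto_coord (f : G.BddDomain m) (z : G.Compactification m) :
    Tendsto (fun x => f.1 x) (nhdsX z) (𝓝 (z.1 f)) :=
  ((continuous_coord f).tendsto z).comp tendsto_comap

theorem coord_eq_of_tendsto {f : G.BddDomain m} {z : G.Compactification m} {a : ℝ}
    (h : Tendsto (fun x => f.1 x) (nhdsX z) (𝓝 a)) : z.1 f = a :=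
  tendsto_nhds_unique (tendsto_coord f z) h

/-- Bounded elements of `D(Q^(N))`. -/
def toBdd (u : G.Dom m) (hu : ∃ M : ℝ, ∀ x, |u x| ≤ M) : G.BddDomain m :=
  ⟨FormSpace.incl u, Dom.neumann_incl_lt_top u, hu⟩

/-- The element of `D(Q^(N))` given by a bounded one. -/
def ofBdd (f : G.BddDomain m) : G.Dom m := Dom.ofLp f.1 f.2.1

theorem ofBdd_apply (f : G.BddDomain m) (x : X) : ofBdd f x = f.1 x := rfl

theorem toBdd_apply (u : G.Dom m) (hu : ∃ M : ℝ, ∀ x, |u x| ≤ M) (x : X) :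
    (toBdd u hu).1 x = u x := rfl

theorem ofBdd_bounded (f : G.BddDomain m) : ∃ M : ℝ, ∀ x, |ofBdd f x| ≤ M := f.2.2

theorem abs_dirac_le (z x : X) : |(Dom.dirac z : G.Dom m) x| ≤ 1 := by
  classical
  rw [Dom.dirac_apply]
  split_ifs <;> simp

/-- Near such a point the characteristic function of `x` exceeds `1/2`, so the only vertex nearby is
`x`. It follows that the points of `X` are open in the compactification. -/
theorem eq_embed_of_coord_dirac {z : G.Compactification m} {x : X}
    (h : 1 / 2 < z.1 (toBdd (Dom.dirac x) ⟨1, abs_dirac_le x⟩)) : z = G.embed m x := by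
  classical
  have h1 : ∀ᶠ x' in nhdsX z, x' = x := by
    filter_upwards [(tendsto_coord _ z).eventually (lt_mem_nhds h)] with x' hx'
    rw [toBdd_apply, Dom.dirac_apply] at hx'
    by_contra hne
    rw [if_neg hne] at hx'
    norm_num at hx'
  refine Subtype.ext (funext fun f => ?_)
  exact coord_eq_of_tendsto (tendsto_const_nhds.congr' (h1.mono fun x' hx' => by rw [hx']; rfl))

theorem coord_embed_dirac (x : X) :
    (G.embed m x).1 (toBdd (Dom.dirac x) ⟨1, abs_dirac_le x⟩) = 1 := by
  classical
  change (Dom.dirac x : G.Dom m) x = 1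
  simp

theorem isOpen_range_embed : IsOpen (Set.range (G.embed m)) := by
  rw [isOpen_iff_mem_nhds]
  rintro _ ⟨x, rfl⟩
  have h : ∀ᶠ z in 𝓝 (G.embed m x), 1 / 2 < z.1 (toBdd (Dom.dirac x) ⟨1, abs_dirac_le x⟩) :=
    ((continuous_coord _).tendsto _).eventually (lt_mem_nhds (by
      rw [coord_embed_dirac]; norm_num))
  filter_upwards [h] with z hz
  exact ⟨x, (eq_embed_of_coord_dirac hz).symm⟩

instance : T2Space (G.Boundary m) :=
  inferInstanceAs (T2Space {z : G.Compactification m // z ∉ Set.range (G.embed m) ∧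
    ∀ f : G.BddDomain m, G.dirichlet m f.1 < ⊤ → z.1 f = 0})

instance : CompactSpace (G.Boundary m) := by
  refine isCompact_iff_compactSpace.1 (IsClosed.isCompact ?_)
  refine IsClosed.and (p₁ := fun z => z ∉ Set.range (G.embed m))
    isOpen_range_embed.isClosed_compl ?_
  simp only [Set.ofPred_forall]
  exact isClosed_iInter fun f => isClosed_iInter fun _ =>
    isClosed_eq (continuous_coord f) continuous_const

theorem continuous_preTrace (f : G.BddDomain m) : Continuous (G.preTrace m f) :=
  (continuous_coord f).comp continuous_subtype_val

/-! ### Functions vanishing on the boundary -/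

theorem exists_coord_ne_zero {z : G.Compactification m}
    (h : ∀ ζ : G.Boundary m, ζ.1 ≠ z) :
    ∃ f : G.BddDomain m, ofBdd f ∈ G.dirDom m ∧ z.1 f ≠ 0 := by
  by_cases hz : z ∈ Set.range (G.embed m)
  · obtain ⟨x, rfl⟩ := hz
    refine ⟨toBdd (Dom.dirac x) ⟨1, abs_dirac_le x⟩, dirac_mem_dirDom x, ?_⟩
    rw [coord_embed_dirac]
    exact one_ne_zero
  · by_contra! hcon
    exact h ⟨z, hz, fun f hf => hcon f ((dirichlet_incl_lt_top_iff (ofBdd f)).1 hf)⟩ rfl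

/-- Each point of `K` has a neighbourhood on which a function from `D(Q^(D))` stays away from zero.
By compactness, finitely many rescaled absolute values of such functions add up to `w`. -/
theorem exists_dominating {K : Set (G.Compactification m)} (hK : IsCompact K)
    (h : ∀ ζ : G.Boundary m, ζ.1 ∉ K) :
    ∃ w ∈ G.dirDom m, (∀ x, 0 ≤ w x) ∧ ∀ x, G.embed m x ∈ K → 1 ≤ w x := by
  refine hK.induction_on (p := fun s => ∃ w ∈ G.dirDom m, (∀ x, 0 ≤ w x) ∧
    ∀ x, G.embed m x ∈ s → 1 ≤ w x) ?_ ?_ ?_ ?_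
  · exact ⟨0, Submodule.zero_mem _, by simp, fun x hx => hx.elim⟩
  · rintro s t hst ⟨w, hw, h0, h1⟩
    exact ⟨w, hw, h0, fun x hx => h1 x (hst hx)⟩
  · rintro s t ⟨w, hw, h0, h1⟩ ⟨w', hw', h0', h1'⟩
    refine ⟨w + w', Submodule.add_mem _ hw hw', fun x => ?_, fun x hx => ?_⟩
    · rw [FormSpace.fn_add]
      exact add_nonneg (h0 x) (h0' x)
    · rw [FormSpace.fn_add]
      rcases hx with hx | hx
      · linarith [h1 x hx, h0' x]
      · linarith [h1' x hx, h0 x]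
  · intro z hz
    obtain ⟨f, hf, hne⟩ := exists_coord_ne_zero (z := z) (fun ζ hζ => h ζ (hζ ▸ hz))
    have hpos : 0 < |z.1 f| / 2 := by positivity
    refine ⟨{z' | |z.1 f| / 2 < |z'.1 f|}, mem_nhdsWithin_of_mem_nhds ?_,
      (|z.1 f| / 2)⁻¹ • Dom.comp lipschitz_abs abs_zero (ofBdd f),
      Submodule.smul_mem _ _ (comp_mem_dirDom _ _ hf), fun x => ?_, fun x hx => ?_⟩
    · exact ((continuous_coord f).abs.tendsto z).eventually (lt_mem_nhds (by linarith))
    · rw [FormSpace.fn_smul, Dom.comp_apply]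
      positivity
    · rw [FormSpace.fn_smul, Dom.comp_apply, inv_mul_eq_div, one_le_div hpos]
      exact hx.le

/-- Bounded functions in `D(Q^(N))` that vanish on the boundary lie in `D(Q^(D))`. -/
theorem mem_dirDom_of_boundary_zero (v : G.Dom m) (hv : ∃ M : ℝ, ∀ x, |v x| ≤ M)
    (h : ∀ ζ : G.Boundary m, ζ.1.1 (toBdd v hv) = 0) : v ∈ G.dirDom m := by
  obtain ⟨M, hM⟩ := hv
  set ε : ℕ → ℝ := fun n => 1 / ((n : ℝ) + 1)
  have hε : ∀ n, 0 < ε n := fun n => by positivity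
  have hε0 : Tendsto ε atTop (𝓝 0) := tendsto_one_div_add_atTop_nhds_zero_nat
  -- `u n` vanishes where `|v| ≤ ε n`, and the compact set `|v| ≥ ε n` misses the boundary. Hence a
  -- multiple of a function from `exists_dominating` dominates `u n`, which puts `u n` into
  -- `D(Q^(D))`.
  set u : ℕ → G.Dom m := fun n => v - Dom.comp (lipschitz_clamp (ε n)) (clamp_zero (hε n).le) v
  refine mem_dirDom_of_tendsto (l := atTop) (u := u) (R := ‖v‖ + ‖v‖) (fun n => ?_)
    (fun n => (norm_sub_le _ _).trans (by gcongr; exact Dom.norm_comp_le _ _ v)) (fun x => ?_)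
  · obtain ⟨w, hw, hw0, hw1⟩ := exists_dominating
      (K := {z : G.Compactification m | ε n ≤ |z.1 (toBdd v ⟨M, hM⟩)|})
      (isClosed_le continuous_const (continuous_coord _).abs).isCompact
      (fun ζ hζ => by
        have hζ' : ε n ≤ |ζ.1.1 (toBdd v ⟨M, hM⟩)| := hζ
        rw [h, abs_zero] at hζ'
        exact absurd hζ' (not_le.2 (hε n)))
    refine mem_dirDom_of_abs_le (w := (M + ε n) • w) (Submodule.smul_mem _ _ hw) fun x => ?_
    have hM0 : 0 ≤ M := (abs_nonneg _).trans (hM x)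
    simp only [u, FormSpace.fn_sub, Dom.comp_apply, FormSpace.fn_smul]
    rw [abs_of_nonneg (mul_nonneg (add_nonneg hM0 (hε n).le) (hw0 x))]
    rcases le_total |v x| (ε n) with hx | hx
    · rw [clamp_eq_self hx, sub_self, abs_zero]
      exact mul_nonneg (add_nonneg hM0 (hε n).le) (hw0 x)
    · have h1 := hw1 x hx
      have h2 := abs_sub (v x) (clamp (ε n) (v x))
      have h3 := abs_clamp_le (hε n).le (v x)
      have h4 := hM x
      nlinarith [hε n]
  · simp only [u, FormSpace.fn_sub, Dom.comp_apply]
    have : Tendsto (fun n => clamp (ε n) (v x)) atTop (𝓝 0) :=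
      squeeze_zero_norm (fun n => abs_clamp_le (hε n).le (v x)) hε0
    simpa using this.const_sub (v x)

theorem preTrace_eq_zero_of_mem {f : G.BddDomain m} (h : ofBdd f ∈ G.dirDom m)
    (ζ : G.Boundary m) : G.preTrace m f ζ = 0 :=
  ζ.2.2 f ((dirichlet_incl_lt_top_iff (ofBdd f)).2 h)

/-- The maximum principle with boundary values. -/
theorem harm_le_of_boundary {u : G.Dom m} {s : ℝ} (hs : 0 ≤ s)
    (h : ∀ ζ : G.Boundary m, ∃ a ≤ s, Tendsto u (nhdsX ζ.1) (𝓝 a)) (x : X) : harm u x ≤ s := by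
  -- This function is bounded even if `u` is not, and it vanishes on the boundary because the limits
  -- of `u` there are at most `s`.
  set v := Dom.comp (lipschitz_slice s) (slice_zero hs) u
  have hv : ∃ M : ℝ, ∀ x, |v x| ≤ M := ⟨1, fun x => by
    rw [Dom.comp_apply, abs_of_nonneg (slice_nonneg _ _)]
    exact slice_le_one _ _⟩
  refine harm_le_of_slice_mem (v := v) hs (mem_dirDom_of_boundary_zero v hv fun ζ => ?_)
    (fun x => Dom.comp_apply _ _ _ _) x
  obtain ⟨a, ha, hlim⟩ := h ζ
  refine (coord_eq_of_tendsto (a := slice s a) ?_).trans (slice_eq_zero_iff.2 ha)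
  refine (((lipschitz_slice s).continuous.tendsto a).comp hlim).congr fun x => ?_
  rw [toBdd_apply, Dom.comp_apply, Function.comp]

/-! ### Boundary values -/

theorem arctan_bounded (u : G.Dom m) :
    ∃ M : ℝ, ∀ x, |Dom.comp lipschitz_arctan Real.arctan_zero u x| ≤ M :=
  ⟨Real.pi / 2, fun x => by
    rw [Dom.comp_apply]
    exact abs_le.2 ⟨(Real.neg_pi_div_two_lt_arctan _).le, (Real.arctan_lt_pi_div_two _).le⟩⟩

/-- The bounded function `arctan ∘ u`. -/
def arcBdd (u : G.Dom m) : G.BddDomain m :=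
  toBdd (Dom.comp lipschitz_arctan Real.arctan_zero u) (arctan_bounded u)

theorem tendsto_arctan (u : G.Dom m) (z : G.Compactification m) :
    Tendsto (fun x => Real.arctan (u x)) (nhdsX z) (𝓝 (z.1 (arcBdd u))) :=
  (tendsto_coord (arcBdd u) z).congr fun x => Dom.comp_apply _ _ u x

/-- The bounded function `arctan ∘ u` has a limit in `[-π/2, π/2]`; the two endpoints correspond to
infinite limits of `u`. In particular `boundaryValue` is an actual limit. -/
theorem tendsto_trichotomy (u : G.Dom m) (z : G.Compactification m) :
    Tendsto u (nhdsX z) (𝓝 (Real.tan (z.1 (arcBdd u)))) ∨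
      Tendsto u (nhdsX z) atTop ∨ Tendsto u (nhdsX z) atBot := by
  have h := tendsto_arctan u z
  set a := z.1 (arcBdd u)
  have ha1 : a ≤ Real.pi / 2 :=
    le_of_tendsto h (Eventually.of_forall fun x => (Real.arctan_lt_pi_div_two _).le)
  have ha2 : -(Real.pi / 2) ≤ a :=
    ge_of_tendsto h (Eventually.of_forall fun x => (Real.neg_pi_div_two_lt_arctan _).le)
  rcases ha1.eq_or_lt with h1 | h1
  · right; left
    refine tendsto_atTop.2 fun r => ?_
    rw [h1] at h
    filter_upwards [h.eventually (lt_mem_nhds (Real.arctan_lt_pi_div_two r))] with x hx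
    exact (Real.arctan_strictMono.lt_iff_lt.1 hx).le
  rcases ha2.eq_or_lt with h2 | h2
  · right; right
    refine tendsto_atBot.2 fun r => ?_
    rw [← h2] at h
    filter_upwards [h.eventually (gt_mem_nhds (Real.neg_pi_div_two_lt_arctan r))] with x hx
    exact (Real.arctan_strictMono.lt_iff_lt.1 hx).le
  · left
    have hc : ContinuousAt Real.tan a :=
      Real.continuousAt_tan.2 (Real.cos_pos_of_mem_Ioo ⟨h2, h1⟩).ne'
    exact (hc.tendsto.comp h).congr fun x => Real.tan_arctan _

theorem tendsto_boundaryValue (u : G.Dom m) (ζ : G.Boundary m) :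
    Tendsto (fun x => (u x : EReal)) (nhdsX ζ.1) (𝓝 (G.boundaryValue m u ζ)) := by
  have hex : ∃ L : EReal, Tendsto (fun x => (u x : EReal)) (nhdsX ζ.1) (𝓝 L) := by
    rcases tendsto_trichotomy u ζ.1 with h | h | h
    · exact ⟨_, (continuous_coe_real_ereal.tendsto _).comp h⟩
    · exact ⟨⊤, EReal.tendsto_coe_nhds_top_iff.2 h⟩
    · exact ⟨⊥, EReal.tendsto_coe_nhds_bot_iff.2 h⟩
  exact tendsto_nhds_limUnder hex

theorem boundaryValue_eq_coe_iff {u : G.Dom m} {ζ : G.Boundary m} {r : ℝ} :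
    G.boundaryValue m u ζ = (r : EReal) ↔ Tendsto u (nhdsX ζ.1) (𝓝 r) := by
  have h := tendsto_boundaryValue u ζ
  constructor
  · intro hr
    rw [hr] at h
    exact EReal.tendsto_coe.1 h
  · exact fun hr => tendsto_nhds_unique h ((continuous_coe_real_ereal.tendsto _).comp hr)

end WGraph

/-! ### Existence of the harmonic measure -/

section Representation

open CompactlySupported

variable {Y : Type*} [TopologicalSpace Y] [T2Space Y] [CompactSpace Y]

theorem norm_sup_zero_add_le (φ ψ : C(Y, ℝ)) : ‖(φ + ψ) ⊔ 0‖ ≤ ‖φ ⊔ 0‖ + ‖ψ ⊔ 0‖ := by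
  rw [ContinuousMap.norm_le _ (add_nonneg (norm_nonneg _) (norm_nonneg _))]
  intro y
  have h1 := (φ ⊔ 0).norm_coe_le_norm y
  have h2 := (ψ ⊔ 0).norm_coe_le_norm y
  simp only [ContinuousMap.sup_apply, ContinuousMap.add_apply, ContinuousMap.zero_apply,
    Real.norm_eq_abs] at h1 h2 ⊢
  rw [abs_of_nonneg (le_max_right _ _)] at h1 h2 ⊢
  exact max_le (by linarith [le_max_left (φ y) 0, le_max_left (ψ y) 0])
    (add_nonneg (norm_nonneg _) (norm_nonneg _))

theorem norm_sup_zero_smul {c : ℝ} (hc : 0 < c) (φ : C(Y, ℝ)) :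
    ‖(c • φ) ⊔ 0‖ = c * ‖φ ⊔ 0‖ := by
  have : (c • φ) ⊔ 0 = c • (φ ⊔ 0) := by
    ext y
    simp only [ContinuousMap.sup_apply, ContinuousMap.smul_apply, ContinuousMap.zero_apply,
      smul_eq_mul]
    rw [mul_max_of_nonneg _ _ hc.le, mul_zero]
  rw [this, norm_smul, Real.norm_of_nonneg hc.le]

/-- A linear functional that is bounded by the supremum of the positive part is given by a measure
of mass at most one. -/
theorem exists_measure_of_le_sup [MeasurableSpace Y] [BorelSpace Y] {V : Type*} [AddCommGroup V]
    [Module ℝ V] (r : V →ₗ[ℝ] C(Y, ℝ)) (ℓ : V →ₗ[ℝ] ℝ) (h : ∀ v, ℓ v ≤ ‖r v ⊔ 0‖) :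
    ∃ μ : Measure Y, μ.Regular ∧ μ Set.univ ≤ 1 ∧ ∀ v, ∫ y, r v y ∂μ = ℓ v := by
  -- The bound applied to `v` and `-v` shows that `ℓ` vanishes on the kernel of `r`. So `ℓ` factors
  -- through the range of `r`, by means of any linear section `σ`.
  obtain ⟨σ, hσ⟩ := r.rangeRestrict.exists_rightInverse_of_surjective r.range_rangeRestrict
  have hker : ∀ v, r v = 0 → ℓ v = 0 := by
    intro v hv
    have h1 := h v
    have h2 := h (-v)
    rw [map_neg, map_neg, hv] at h2
    rw [hv] at h1
    simp only [neg_zero, sup_idem, norm_zero] at h1 h2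
    linarith
  have hfac : ∀ v, ℓ (σ (r.rangeRestrict v)) = ℓ v := by
    intro v
    rw [← sub_eq_zero, ← map_sub]
    refine hker _ ?_
    have := LinearMap.congr_fun hσ (r.rangeRestrict v)
    have h2 := congrArg Subtype.val this
    rw [map_sub, sub_eq_zero]
    exact h2
  -- Hahn–Banach is used with the norm of the positive part instead of the norm. For `φ ≥ 0` the
  -- positive part of `-φ` is zero, so the extension is automatically positive, and the bound at `1`
  -- gives the mass.
  obtain ⟨Φ, hΦ, hΦN⟩ := exists_extension_of_le_sublinear
    (⟨LinearMap.range r, ℓ ∘ₗ σ⟩ : C(Y, ℝ) →ₗ.[ℝ] ℝ) (fun φ => ‖φ ⊔ 0‖)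
    (fun c hc φ => norm_sup_zero_smul hc φ) norm_sup_zero_add_le (by
      rintro ⟨_, v, rfl⟩
      exact (hfac v).trans_le (h v))
  have hΦr : ∀ v, Φ (r v) = ℓ v := fun v => (hΦ (r.rangeRestrict v)).trans (hfac v)
  have hpos : ∀ φ : C(Y, ℝ), 0 ≤ φ → 0 ≤ Φ φ := by
    intro φ hφ
    have h1 := hΦN (-φ)
    have h2 : (-φ) ⊔ 0 = 0 := sup_eq_right.2 (by simpa using hφ)
    rw [h2, norm_zero, map_neg] at h1
    linarith
  let Λ : C_c(Y, ℝ) →ₚ[ℝ] ℝ :=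
    { toFun := fun g => Φ g.toContinuousMap
      map_add' := fun g g' => Φ.map_add g.toContinuousMap g'.toContinuousMap
      map_smul' := fun c g => Φ.map_smul c g.toContinuousMap
      monotone' := fun g g' hg => by
        have := hpos (g'.toContinuousMap - g.toContinuousMap) (sub_nonneg.2 hg)
        rw [map_sub] at this
        exact sub_nonneg.1 this }
  have hint : ∀ φ : C(Y, ℝ), ∫ y, φ y ∂(RealRMK.rieszMeasure Λ) = Φ φ := fun φ =>
    RealRMK.integral_rieszMeasure Λ ⟨φ, HasCompactSupport.of_compactSpace _⟩
  refine ⟨RealRMK.rieszMeasure Λ, inferInstance, ?_, fun v => (hint (r v)).trans (hΦr v)⟩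
  have h1 := hint 1
  have h2 : Φ 1 ≤ 1 := by
    refine (hΦN 1).trans ((ContinuousMap.norm_le _ zero_le_one).2 fun y => ?_)
    simp
  simp only [ContinuousMap.one_apply, integral_const, smul_eq_mul, mul_one] at h1
  rw [← h1, measureReal_def] at h2
  rw [← ENNReal.ofReal_toReal (measure_ne_top (RealRMK.rieszMeasure Λ) Set.univ)]
  exact ENNReal.ofReal_le_one.2 h2

end Representation

namespace WGraph

variable {X : Type*} [MeasurableSpace X] [Countable X] [DiscreteMeasurableSpace X]
  {G : WGraph X} {m : Measure X} [PosFiniteAtoms m]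

variable (G m) in
/-- The bounded functions in `D(Q^(N))`. -/
def bddDom : Submodule ℝ (G.Dom m) where
  carrier := {u | ∃ M : ℝ, ∀ x, |u x| ≤ M}
  zero_mem' := ⟨0, fun x => by simp⟩
  add_mem' := fun {u v} ⟨M, hM⟩ ⟨M', hM'⟩ => ⟨M + M', fun x => by
    rw [FormSpace.fn_add]
    exact (abs_add_le _ _).trans (add_le_add (hM x) (hM' x))⟩
  smul_mem' := fun c u ⟨M, hM⟩ => ⟨|c| * M, fun x => by
    rw [FormSpace.fn_smul, abs_mul]
    exact mul_le_mul_of_nonneg_left (hM x) (abs_nonneg c)⟩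

/-- Restriction of bounded functions to the boundary. -/
def boundaryRestrict : G.bddDom m →ₗ[ℝ] C(G.Boundary m, ℝ) where
  toFun u := ⟨G.preTrace m (toBdd u.1 u.2), continuous_preTrace _⟩
  map_add' u v := by
    ext ζ
    refine coord_eq_of_tendsto (((tendsto_coord (toBdd u.1 u.2) ζ.1).add
      (tendsto_coord (toBdd v.1 v.2) ζ.1)).congr fun x => ?_)
    exact (FormSpace.fn_add u.1 v.1 x).symm
  map_smul' c u := by
    ext ζ
    refine coord_eq_of_tendsto (((tendsto_coord (toBdd u.1 u.2) ζ.1).const_mul c).congr fun x => ?_)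
    exact (FormSpace.fn_smul c u.1 x).symm

theorem tendsto_ofBdd (f : G.BddDomain m) (ζ : G.Boundary m) :
    Tendsto (ofBdd f) (nhdsX ζ.1) (𝓝 (G.preTrace m f ζ)) :=
  tendsto_coord f ζ.1

theorem harm_eq_zero_of_tendsto {u : G.Dom m}
    (h : ∀ ζ : G.Boundary m, Tendsto u (nhdsX ζ.1) (𝓝 0)) : harm u = 0 := by
  refine FormSpace.ext_fn fun x => ?_
  have h1 := harm_le_of_boundary (u := u) le_rfl (fun ζ => ⟨0, le_rfl, h ζ⟩) x
  have h2 := harm_le_of_boundary (u := -u) le_rfl (fun ζ => ⟨0, le_rfl, by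
    have := (h ζ).neg
    rw [neg_zero] at this
    exact this.congr fun x => (FormSpace.fn_neg u x).symm⟩) x
  rw [map_neg, FormSpace.fn_neg] at h2
  rw [FormSpace.fn_zero]
  linarith

/-- The functional is `u ↦ harm u o` on bounded functions, and the sublinear bound it needs is the
maximum principle with boundary values. -/
theorem exists_isHarmonicMeasure (o : X) : ∃ μ, G.IsHarmonicMeasure m o μ := by
  obtain ⟨μ, hreg, hmass, hint⟩ := exists_measure_of_le_sup (boundaryRestrict (G := G) (m := m))
    ((FormSpace.eval o).toLinearMap ∘ₗ harm.toLinearMap ∘ₗ (G.bddDom m).subtype) (fun u => by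
      refine harm_le_of_boundary (u := u.1) (norm_nonneg _) (fun ζ =>
        ⟨_, ?_, tendsto_coord (toBdd u.1 u.2) ζ.1⟩) o
      have h1 := (boundaryRestrict u ⊔ 0).norm_coe_le_norm ζ
      exact (le_max_left _ _).trans ((le_abs_self _).trans h1))
  have hfin : IsFiniteMeasure μ := ⟨hmass.trans_lt ENNReal.one_lt_top⟩
  -- On `Z` all traces vanish, so restricting the measure to the complement changes no integral of a
  -- trace and removes the forbidden mass.
  set Z : Set (G.Boundary m) := {ζ | ∀ f : G.BddDomain m, G.preTrace m f ζ = 0} with hZ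
  have hZm : MeasurableSet Z := by
    refine IsClosed.measurableSet ?_
    simp only [hZ, Set.ofPred_forall]
    exact isClosed_iInter fun f => isClosed_eq (continuous_preTrace f) continuous_const
  refine ⟨μ.restrict Zᶜ, ?_, ?_, ?_, ?_⟩
  · exact Measure.Regular.restrict_of_measure_ne_top (measure_ne_top _ _)
  · exact (Measure.restrict_apply_le _ _).trans hmass
  · intro f h hN hH hbv
    set u : G.Dom m := Dom.ofLp h hN
    have hu : harm u = u := harm_eq_self ((isOneHarmonic_iff u).1 hH)
    have hsub : harm (u - ofBdd f) = 0 := harm_eq_zero_of_tendsto fun ζ => by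
      have h1 := (boundaryValue_eq_coe_iff (u := u)).1 (hbv ζ)
      have h2 := h1.sub (tendsto_ofBdd f ζ)
      rw [sub_self] at h2
      exact h2.congr fun x => (FormSpace.fn_sub _ _ x).symm
    rw [map_sub, hu, sub_eq_zero] at hsub
    have h3 := hint ⟨ofBdd f, ofBdd_bounded f⟩
    have h4 : ∫ ζ in Zᶜ, G.preTrace m f ζ ∂μ = ∫ ζ, G.preTrace m f ζ ∂μ :=
      setIntegral_eq_integral_of_forall_compl_eq_zero fun ζ hζ => (not_not.1 hζ) f
    rw [h4]
    refine Eq.trans ?_ h3.symm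
    change u o = harm (ofBdd f) o
    rw [hsub]
  · intro z hz
    rw [Measure.restrict_apply (measurableSet_singleton z)]
    convert measure_empty (μ := μ)
    ext ζ
    simp only [Set.mem_inter_iff, Set.mem_singleton_iff, Set.mem_compl_iff, Set.mem_empty_iff_false,
      iff_false, not_and, not_not]
    rintro rfl
    exact hz

theorem isHarmonicMeasure (o : X) : G.IsHarmonicMeasure m o (G.harmonicMeasure m o) := by
  rw [harmonicMeasure, dif_pos (exists_isHarmonicMeasure o)]
  exact (exists_isHarmonicMeasure o).choose_spec

instance (o : X) : IsFiniteMeasure (G.harmonicMeasure m o) :=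
  ⟨(isHarmonicMeasure o).mass_le.trans_lt ENNReal.one_lt_top⟩

/-- The integral of boundary values with respect to the harmonic measure. -/
theorem integral_preTrace (o : X) (f : G.BddDomain m) :
    ∫ ζ, G.preTrace m f ζ ∂(G.harmonicMeasure m o) = harm (ofBdd f) o := by
  refine ((isHarmonicMeasure o).integral_eq f (FormSpace.incl (harm (ofBdd f)))
    (Dom.neumann_incl_lt_top _) ((isOneHarmonic_iff _).2 (harm_mem _)) fun ζ => ?_).symm
  refine (boundaryValue_eq_coe_iff (u := harm (ofBdd f))).2 ?_
  obtain ⟨M, hM⟩ := ofBdd_bounded f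
  -- The maximum principle makes the difference bounded. As a bounded element of `D(Q^(D))` it
  -- vanishes on the boundary, so `f` and its harmonic part have the same boundary values.
  have hb : ∃ M : ℝ, ∀ x, |(ofBdd f - harm (ofBdd f)) x| ≤ M := by
    refine ⟨2 * |M|, fun x => ?_⟩
    have h1 := harm_le (u := ofBdd f) (abs_nonneg M)
      (fun x => (le_abs_self _).trans ((hM x).trans (le_abs_self _))) x
    have h2 := harm_le (u := -ofBdd f) (abs_nonneg M)
      (fun x => by
        rw [FormSpace.fn_neg]
        exact (neg_le_abs _).trans ((hM x).trans (le_abs_self _))) x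
    rw [map_neg, FormSpace.fn_neg] at h2
    rw [FormSpace.fn_sub]
    refine (abs_sub _ _).trans ?_
    have h3 := (hM x).trans (le_abs_self M)
    have h4 : |harm (ofBdd f) x| ≤ |M| := abs_le.2 ⟨by linarith, h1⟩
    linarith
  have h0 := preTrace_eq_zero_of_mem (f := toBdd _ hb) (sub_harm_mem (ofBdd f)) ζ
  have h1 := tendsto_coord (toBdd _ hb) ζ.1
  have h2 := (tendsto_ofBdd f ζ).sub h1
  rw [show ζ.1.1 (toBdd _ hb) = 0 from h0, sub_zero] at h2
  refine h2.congr fun x => ?_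
  rw [toBdd_apply, FormSpace.fn_sub, sub_sub_cancel]

end WGraph

/-! ### The trace map -/

theorem ofReal_lp_norm_sq {Ω : Type*} [MeasurableSpace Ω] {μ : Measure Ω} (f : Lp ℝ 2 μ) :
    ENNReal.ofReal (‖f‖ ^ 2) = ∫⁻ ω, ENNReal.ofReal (f ω ^ 2) ∂μ := by
  rw [← real_inner_self_eq_norm_sq, L2.inner_def,
    ofReal_integral_eq_lintegral_ofReal (L2.integrable_inner f f)
      (Eventually.of_forall fun x => real_inner_self_nonneg)]
  simp only [real_inner_self_eq_norm_sq, Real.norm_eq_abs, sq_abs]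

namespace WGraph

variable {X : Type*} [MeasurableSpace X] [Countable X] [DiscreteMeasurableSpace X]
  {G : WGraph X} {m : Measure X} [PosFiniteAtoms m]

/-! ### The Green function and the `L²` bound for traces -/

variable (G m) in
/-- The function representing the evaluation at `o`. -/
def green (o : X) : G.Dom m := (InnerProductSpace.toDual ℝ (G.Dom m)).symm (FormSpace.eval o)

theorem inner_green (o : X) (u : G.Dom m) : ⟪G.green m o, u⟫ = u o := by
  rw [green, InnerProductSpace.toDual_symm_apply, FormSpace.eval_apply]

theorem green_self_nonneg (o : X) : 0 ≤ G.green m o o := by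
  rw [← inner_green]
  exact real_inner_self_nonneg

/-- Let `c` be `g` truncated to `[0, g(o)]`. Then `‖c‖ ≤ ‖g‖` and `⟪g, c⟫ = c(o) = g(o) = ‖g‖²`,
which forces `c = g`. -/
theorem green_mem_Icc (o x : X) : 0 ≤ G.green m o x ∧ G.green m o x ≤ G.green m o o := by
  set g := G.green m o with hg
  have h0 : 0 ≤ g o := green_self_nonneg o
  have hC : LipschitzWith 1 fun t : ℝ => max 0 (min (g o) t) :=
    (LipschitzWith.id.const_min (g o)).const_max 0
  set c := Dom.comp hC (by simp [h0]) g with hc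
  have h1 : ⟪g, c⟫ = g o := by
    rw [inner_green, hc, Dom.comp_apply]
    simp [h0]
  have h2 : ‖g‖ ^ 2 = g o := by rw [← real_inner_self_eq_norm_sq, inner_green]
  have h3 := pow_le_pow_left₀ (norm_nonneg _) (Dom.norm_comp_le hC (by simp [h0]) g) 2
  have h4 := norm_sub_sq_real g c
  have h5 : ‖g - c‖ ^ 2 ≤ 0 := by linarith
  have h6 : g - c = 0 := by
    have : ‖g - c‖ = 0 := by nlinarith [norm_nonneg (g - c)]
    exact norm_eq_zero.1 this
  have h7 : g x = max 0 (min (g o) (g x)) := by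
    rw [← Dom.comp_apply hC (by simp [h0]) g x, ← hc, ← sub_eq_zero, ← FormSpace.fn_sub, h6,
      FormSpace.fn_zero]
  rw [h7]
  exact ⟨le_max_left _ _, max_le h0 (min_le_left _ _)⟩

theorem inner_harm_green (o : X) (u : G.Dom m) : ⟪harm (G.green m o), u⟫ = harm u o := by
  rw [inner_harm, inner_green]

/-- A Lipschitz bound for `(s, a) ↦ s² / (a + 1)`; it ensures that the test function in `harm_sq_le`
belongs to `D(Q^(N))`. -/
theorem abs_div_sub_div_le {M s t a b : ℝ} (hs : |s| ≤ M) (ht : |t| ≤ M) (ha : 0 ≤ a)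
    (hb : 0 ≤ b) :
    |s ^ 2 / (a + 1) - t ^ 2 / (b + 1)| ≤ (2 * M + M ^ 2) * (|s - t| + |a - b|) := by
  have hM : 0 ≤ M := (abs_nonneg _).trans hs
  have e : s ^ 2 / (a + 1) - t ^ 2 / (b + 1) =
      (s - t) * ((s + t) / (a + 1)) + (a - b) * -(t ^ 2 / ((a + 1) * (b + 1))) := by
    field_simp
    ring
  have h1 : |(s + t) / (a + 1)| ≤ 2 * M := by
    rw [abs_div, abs_of_pos (by linarith : 0 < a + 1), div_le_iff₀ (by linarith)]
    have := abs_add_le s t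
    nlinarith
  have h2 : |-(t ^ 2 / ((a + 1) * (b + 1)))| ≤ M ^ 2 := by
    rw [abs_neg, abs_of_nonneg (by positivity), div_le_iff₀ (by positivity)]
    have h3 : t ^ 2 ≤ M ^ 2 := sq_le_sq.2 (by rwa [abs_of_nonneg hM])
    have h4 : 1 ≤ (a + 1) * (b + 1) := by nlinarith
    nlinarith [sq_nonneg M]
  rw [e]
  refine (abs_add_le _ _).trans ?_
  rw [abs_mul, abs_mul]
  have h5 := mul_le_mul_of_nonneg_left h1 (abs_nonneg (s - t))
  have h6 := mul_le_mul_of_nonneg_left h2 (abs_nonneg (a - b))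
  nlinarith [abs_nonneg (s - t), abs_nonneg (a - b), sq_nonneg M,
    mul_nonneg (sq_nonneg M) (abs_nonneg (s - t)), mul_nonneg hM (abs_nonneg (a - b))]

/-- Picone's inequality: the difference of the two sides is a square divided by `(a + 1)(b + 1)`. -/
theorem picone {a b s t : ℝ} (ha : 0 ≤ a) (hb : 0 ≤ b) :
    (a - b) * (s ^ 2 / (a + 1) - t ^ 2 / (b + 1)) ≤ (s - t) * (s - t) := by
  have h1 : 0 < a + 1 := by linarith
  have h2 : 0 < b + 1 := by linarith
  have e : (s - t) * (s - t) - (a - b) * (s ^ 2 / (a + 1) - t ^ 2 / (b + 1)) =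
      (s * (b + 1) - t * (a + 1)) ^ 2 / ((a + 1) * (b + 1)) := by
    field_simp
    ring
  have : 0 ≤ (s * (b + 1) - t * (a + 1)) ^ 2 / ((a + 1) * (b + 1)) := by positivity
  linarith

/-- The harmonic part of the square of a bounded function is controlled by the form norm. -/
theorem harm_sq_le (o : X) {v w : G.Dom m} {M : ℝ} (hv : ∀ x, |v x| ≤ M)
    (hw : ∀ x, w x = v x ^ 2) : harm w o ≤ (G.green m o o + 1) * ‖v‖ ^ 2 := by
  set g := harm (G.green m o) with hg
  have hg0 : ∀ x, 0 ≤ g x := harm_nonneg fun x => (green_mem_Icc o x).1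
  have hg1 : ∀ x, g x ≤ G.green m o o :=
    harm_le (green_self_nonneg o) fun x => (green_mem_Icc o x).2
  -- `harm w' o` is the pairing of `w' = v² / (g + 1)` with `g`, and Picone's inequality on each
  -- edge bounds it by `‖v‖²`. The upper bound for `g` gives `v² ≤ (green(o) + 1) w'`. The shift by
  -- one avoids dividing by small values of `g`.
  obtain ⟨w', hw'⟩ := Dom.exists_of_le (fun x => v x ^ 2 / (g x + 1)) v g (K := 2 * M + M ^ 2)
    (fun y => by
      rcases y with p | x
      · exact abs_div_sub_div_le (hv _) (hv _) (hg0 _) (hg0 _)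
      · have := abs_div_sub_div_le (s := v x) (t := 0) (b := 0) (hv x)
          (by rw [abs_zero]; exact (abs_nonneg _).trans (hv x)) (hg0 x) le_rfl
        simpa using this)
  have h1 : harm w' o ≤ ‖v‖ ^ 2 := by
    rw [← inner_harm_green, ← real_inner_self_eq_norm_sq]
    refine Dom.inner_le_inner fun y => ?_
    rcases y with p | x
    · simpa only [grad_inl, hw'] using picone (hg0 _) (hg0 _)
    · have := picone (s := v x) (t := 0) (hg0 x) le_rfl
      simpa only [grad_inr, hw', sub_zero, ne_eq, OfNat.ofNat_ne_zero, not_false_eq_true, zero_pow,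
        zero_div] using this
  have h2 : harm w o ≤ harm ((G.green m o o + 1) • w') o := harm_mono (fun x => by
    have hpos : 0 < g x + 1 := by linarith [hg0 x]
    rw [FormSpace.fn_smul, hw, hw', mul_div_assoc', le_div_iff₀ hpos, mul_comm]
    exact mul_le_mul_of_nonneg_right (by linarith [hg1 x]) (sq_nonneg _)) o
  rw [map_smul, FormSpace.fn_smul] at h2
  exact h2.trans (mul_le_mul_of_nonneg_left h1 (by linarith [green_self_nonneg (G := G) (m := m) o]))

theorem exists_sq (f : G.BddDomain m) :
    ∃ w : G.BddDomain m, (∀ x, w.1 x = f.1 x ^ 2) ∧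
      ∀ ζ, G.preTrace m w ζ = G.preTrace m f ζ ^ 2 := by
  obtain ⟨M, hM⟩ := ofBdd_bounded f
  obtain ⟨w, hw⟩ := Dom.exists_mul (ofBdd f) (ofBdd f) hM hM
  refine ⟨toBdd w ⟨M * M, fun x => ?_⟩, fun x => ?_, fun ζ => ?_⟩
  · rw [hw, abs_mul]
    exact mul_le_mul (hM x) (hM x) (abs_nonneg _) ((abs_nonneg _).trans (hM x))
  · rw [toBdd_apply, hw, sq, ofBdd_apply]
  · refine coord_eq_of_tendsto (((tendsto_coord f ζ.1).pow 2).congr fun x => ?_)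
    rw [toBdd_apply, hw, sq, ofBdd_apply]

theorem integral_preTrace_sq (o : X) (f w : G.BddDomain m)
    (hw : ∀ ζ, G.preTrace m w ζ = G.preTrace m f ζ ^ 2) :
    ∫⁻ ζ, ENNReal.ofReal (G.preTrace m f ζ ^ 2) ∂(G.harmonicMeasure m o) =
      ENNReal.ofReal (harm (ofBdd w) o) := by
  rw [← integral_preTrace]
  simp only [hw]
  refine (ofReal_integral_eq_lintegral_ofReal ?_ (Eventually.of_forall fun ζ => sq_nonneg _)).symm
  have hc : Continuous fun ζ => G.preTrace m f ζ ^ 2 := (continuous_preTrace f).pow 2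
  exact hc.integrable_of_hasCompactSupport (HasCompactSupport.of_compactSpace _)

/-- The integral of the squared trace is the value at `o` of the harmonic part of `f²`. The constant
does not depend on the bound of `f`, so truncation extends the estimate to unbounded functions. -/
theorem lintegral_preTrace_sq_le (o : X) (f : G.BddDomain m) :
    ∫⁻ ζ, ENNReal.ofReal (G.preTrace m f ζ ^ 2) ∂(G.harmonicMeasure m o) ≤
      ENNReal.ofReal ((G.green m o o + 1) * ‖ofBdd f‖ ^ 2) := by
  obtain ⟨w, hw, hw'⟩ := exists_sq f
  obtain ⟨M, hM⟩ := ofBdd_bounded f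
  rw [integral_preTrace_sq o f w hw']
  exact ENNReal.ofReal_le_ofReal (harm_sq_le o hM hw)

/-! ### Traces of unbounded functions and the kernel of the trace -/

/-- The truncations of `u`. -/
def clampBdd (n : ℕ) (u : G.Dom m) : G.BddDomain m :=
  toBdd (Dom.comp (lipschitz_clamp n) (clamp_zero n.cast_nonneg) u) ⟨n, fun x => by
    rw [Dom.comp_apply]
    exact abs_clamp_le n.cast_nonneg _⟩

theorem clampBdd_apply (n : ℕ) (u : G.Dom m) (x : X) : (clampBdd n u).1 x = clamp n (u x) :=
  Dom.comp_apply _ _ u x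

theorem norm_clampBdd_le (n : ℕ) (u : G.Dom m) : ‖ofBdd (clampBdd n u)‖ ≤ ‖u‖ :=
  Dom.norm_comp_le (lipschitz_clamp n) (clamp_zero n.cast_nonneg) u

theorem preTrace_clampBdd {n : ℕ} {u : G.Dom m} {ζ : G.Boundary m} {a : ℝ}
    (h : Tendsto u (nhdsX ζ.1) (𝓝 a)) : G.preTrace m (clampBdd n u) ζ = clamp n a :=
  coord_eq_of_tendsto ((((lipschitz_clamp n).continuous.tendsto a).comp h).congr fun x =>
    (clampBdd_apply n u x).symm)

theorem preTrace_clampBdd_sq_of_infinite {n : ℕ} {u : G.Dom m} {ζ : G.Boundary m}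
    (h : Tendsto u (nhdsX ζ.1) atTop ∨ Tendsto u (nhdsX ζ.1) atBot) :
    G.preTrace m (clampBdd n u) ζ ^ 2 = (n : ℝ) ^ 2 := by
  rcases h with h | h
  · have : G.preTrace m (clampBdd n u) ζ = n := by
      refine coord_eq_of_tendsto (tendsto_const_nhds.congr' ?_)
      filter_upwards [h.eventually_ge_atTop (n : ℝ)] with x hx
      rw [clampBdd_apply, clamp, min_eq_left hx, max_eq_right]
      linarith [(n.cast_nonneg : (0 : ℝ) ≤ n)]
    rw [this]
  · have : G.preTrace m (clampBdd n u) ζ = -n := by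
      refine coord_eq_of_tendsto (tendsto_const_nhds.congr' ?_)
      filter_upwards [h.eventually_le_atBot (-n : ℝ)] with x hx
      rw [clampBdd_apply, clamp, max_eq_left]
      exact (min_le_right _ _).trans hx
    rw [this, neg_sq]

/-- The boundary function of `u`, with value zero where `u` has an infinite limit. -/
def boundaryFn (u : G.Dom m) (ζ : G.Boundary m) : ℝ := Real.tan (ζ.1.1 (arcBdd u))

theorem measurable_boundaryFn (u : G.Dom m) : Measurable (boundaryFn u) := by
  have h : Measurable (G.preTrace m (arcBdd u)) := (continuous_preTrace _).measurable
  have : boundaryFn u = fun ζ => Real.sin (G.preTrace m (arcBdd u) ζ) /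
      Real.cos (G.preTrace m (arcBdd u) ζ) := by
    funext ζ
    exact Real.tan_eq_sin_div_cos _
  rw [this]
  exact (Real.measurable_sin.comp h).div (Real.measurable_cos.comp h)

/-- Fatou's lemma for the squared traces of the truncations, whose integrals are bounded by the form
norm of `u`. -/
theorem boundaryFn_spec (o : X) (u : G.Dom m) :
    (∀ᵐ ζ ∂(G.harmonicMeasure m o), Tendsto u (nhdsX ζ.1) (𝓝 (boundaryFn u ζ))) ∧
      ∫⁻ ζ, ENNReal.ofReal (boundaryFn u ζ ^ 2) ∂(G.harmonicMeasure m o) ≤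
        ENNReal.ofReal ((G.green m o o + 1) * ‖u‖ ^ 2) := by
  set B := ENNReal.ofReal ((G.green m o o + 1) * ‖u‖ ^ 2)
  set F : ℕ → G.Boundary m → ℝ≥0∞ :=
    fun n ζ => ENNReal.ofReal (G.preTrace m (clampBdd n u) ζ ^ 2) with hF
  have hFm : ∀ n, Measurable (F n) := fun n =>
    (((continuous_preTrace (clampBdd n u)).measurable).pow_const 2).ennreal_ofReal
  have hFB : ∀ n, ∫⁻ ζ, F n ζ ∂(G.harmonicMeasure m o) ≤ B := fun n =>
    (lintegral_preTrace_sq_le o _).trans (ENNReal.ofReal_le_ofReal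
      (mul_le_mul_of_nonneg_left (pow_le_pow_left₀ (norm_nonneg _) (norm_clampBdd_le n u) 2)
        (by linarith [green_self_nonneg (G := G) (m := m) o])))
  have hfatou : ∫⁻ ζ, liminf (fun n => F n ζ) atTop ∂(G.harmonicMeasure m o) ≤ B :=
    (lintegral_liminf_le hFm).trans (liminf_le_of_le (by isBoundedDefault) fun b hb => by
      obtain ⟨n, hn⟩ := hb.exists
      exact hn.trans (hFB n))
  have hfin := ae_lt_top (Measurable.liminf hFm) (hfatou.trans_lt ENNReal.ofReal_lt_top).ne
  have h1 : ∀ᵐ ζ ∂(G.harmonicMeasure m o), Tendsto u (nhdsX ζ.1) (𝓝 (boundaryFn u ζ)) := by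
    filter_upwards [hfin] with ζ hζ
    refine (tendsto_trichotomy u ζ.1).resolve_right fun hinf => ?_
    -- Where `u` has an infinite limit, the squared truncations are `n²`. Their lower limit is
    -- infinite there, which happens only on a null set.
    have : Tendsto (fun n => F n ζ) atTop (𝓝 ⊤) := by
      simp only [hF, preTrace_clampBdd_sq_of_infinite hinf]
      refine ENNReal.tendsto_ofReal_nhds_top.2 ?_
      exact (tendsto_pow_atTop two_ne_zero).comp tendsto_natCast_atTop_atTop
    rw [this.liminf_eq] at hζ
    exact lt_irrefl _ hζ
  refine ⟨h1, le_trans (le_of_eq (lintegral_congr_ae ?_)) hfatou⟩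
  filter_upwards [h1] with ζ hζ
  have : Tendsto (fun n => F n ζ) atTop (𝓝 (ENNReal.ofReal (boundaryFn u ζ ^ 2))) := by
    simp only [hF, preTrace_clampBdd hζ]
    exact ENNReal.tendsto_ofReal ((tendsto_clamp _).pow 2)
  exact this.liminf_eq.symm

theorem memLp_boundaryFn (o : X) (u : G.Dom m) :
    MemLp (boundaryFn u) 2 (G.harmonicMeasure m o) := by
  refine ⟨(measurable_boundaryFn u).aestronglyMeasurable, ?_⟩
  rw [eLpNorm_lt_top_iff_lintegral_rpow_enorm_lt_top (by simp) (by simp)]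
  refine lt_of_le_of_lt (le_of_eq (lintegral_congr fun ζ => ?_))
    ((boundaryFn_spec o u).2.trans_lt ENNReal.ofReal_lt_top)
  rw [← sq_abs, ENNReal.ofReal_pow (abs_nonneg _), Real.enorm_eq_ofReal_abs]
  simp

/-- On `D(Q^(N))` the default value in the definition of `trace` is never taken. -/
theorem trace_spec (o : X) (u : G.Dom m) : ∀ᵐ ζ ∂(G.harmonicMeasure m o),
    Tendsto u (nhdsX ζ.1) (𝓝 (G.trace m o (FormSpace.incl u) ζ)) := by
  have hex : ∃ φ : G.L2Boundary m o, ∀ᵐ ζ ∂(G.harmonicMeasure m o),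
      G.boundaryValue m (FormSpace.incl u : Lp ℝ 2 m) ζ = (φ ζ : EReal) := by
    refine ⟨(memLp_boundaryFn o u).toLp _, ?_⟩
    filter_upwards [(memLp_boundaryFn o u).coeFn_toLp, (boundaryFn_spec o u).1] with ζ h1 h2
    rw [h1]
    exact boundaryValue_eq_coe_iff.2 h2
  rw [trace, dif_pos hex]
  filter_upwards [hex.choose_spec] with ζ hζ
  exact boundaryValue_eq_coe_iff.1 hζ

theorem trace_eq_of_tendsto (o : X) (u : G.Dom m) (φ : G.L2Boundary m o)
    (h : ∀ᵐ ζ ∂(G.harmonicMeasure m o), Tendsto u (nhdsX ζ.1) (𝓝 (φ ζ))) :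
    G.trace m o (FormSpace.incl u) = φ := by
  refine Lp.ext ?_
  filter_upwards [trace_spec o u, h] with ζ h1 h2
  exact tendsto_nhds_unique h1 h2

variable (G m) in
/-- The trace map on `D(Q^(N))`. -/
def traceL (o : X) : G.Dom m →ₗ[ℝ] G.L2Boundary m o where
  toFun u := G.trace m o (FormSpace.incl u)
  map_add' u v := by
    refine trace_eq_of_tendsto o _ _ ?_
    filter_upwards [trace_spec o u, trace_spec o v, Lp.coeFn_add (G.trace m o (FormSpace.incl u))
      (G.trace m o (FormSpace.incl v))] with ζ h1 h2 h3
    rw [h3]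
    exact (h1.add h2).congr fun x => (FormSpace.fn_add u v x).symm
  map_smul' c u := by
    refine trace_eq_of_tendsto o _ _ ?_
    filter_upwards [trace_spec o u, Lp.coeFn_smul c (G.trace m o (FormSpace.incl u))] with ζ h1 h3
    rw [RingHom.id_apply, h3]
    exact (h1.const_mul c).congr fun x => (FormSpace.fn_smul c u x).symm

theorem traceL_apply (o : X) (u : G.Dom m) : G.traceL m o u = G.trace m o (FormSpace.incl u) := rfl

theorem traceL_ofLp (o : X) (f : Lp ℝ 2 m) (hf : G.neumann m f < ⊤) :
    G.traceL m o (Dom.ofLp f hf) = G.trace m o f := rfl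

theorem norm_traceL_sq_le (o : X) (u : G.Dom m) :
    ‖G.traceL m o u‖ ^ 2 ≤ (G.green m o o + 1) * ‖u‖ ^ 2 := by
  rw [← ENNReal.ofReal_le_ofReal_iff (mul_nonneg
    (by linarith [green_self_nonneg (G := G) (m := m) o]) (sq_nonneg _)), ofReal_lp_norm_sq]
  refine (le_of_eq (lintegral_congr_ae ?_)).trans (boundaryFn_spec o u).2
  filter_upwards [(boundaryFn_spec o u).1, trace_spec o u] with ζ h1 h2
  rw [traceL_apply, tendsto_nhds_unique h1 h2]

theorem traceL_comp (o : X) {C : ℝ → ℝ} (hC : LipschitzWith 1 C) (h0 : C 0 = 0) (u : G.Dom m) :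
    G.traceL m o (Dom.comp hC h0 u) = hC.compLp h0 (G.traceL m o u) := by
  refine trace_eq_of_tendsto o _ _ ?_
  filter_upwards [trace_spec o u, hC.coeFn_compLp h0 (G.traceL m o u)] with ζ h1 h2
  rw [h2]
  exact ((hC.continuous.tendsto _).comp h1).congr fun x => (Dom.comp_apply hC h0 u x).symm

theorem traceL_eq_zero_of_mem (o : X) {u : G.Dom m} (hu : u ∈ G.dirDom m) :
    G.traceL m o u = 0 := by
  refine trace_eq_of_tendsto o _ _ ?_
  filter_upwards [Lp.coeFn_zero ℝ 2 (G.harmonicMeasure m o)] with ζ hζ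
  have h1 : ζ.1.1 (arcBdd u) = 0 :=
    preTrace_eq_zero_of_mem (f := arcBdd u) (comp_mem_dirDom lipschitz_arctan Real.arctan_zero hu) ζ
  have h2 := tendsto_arctan u ζ.1
  rw [h1] at h2
  have hc : ContinuousAt Real.tan 0 := Real.continuousAt_tan.2 (by simp)
  have h3 := (hc.tendsto.comp h2).congr fun x => Real.tan_arctan (u x)
  rw [Real.tan_zero] at h3
  rwa [hζ]

/-- The kernel of the trace map is `D(Q^(D))`. -/
theorem traceL_eq_zero_iff (hG : G.Connected) (o : X) {u : G.Dom m} :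
    G.traceL m o u = 0 ↔ u ∈ G.dirDom m := by
  refine ⟨fun h => ?_, traceL_eq_zero_of_mem o⟩
  refine mem_dirDom_of_tendsto (l := atTop) (u := fun n : ℕ => ofBdd (clampBdd n u)) (R := ‖u‖)
    (fun n => ?_) (fun n => norm_clampBdd_le n u) (fun x => ?_)
  -- Since `γu = 0`, the harmonic part of `f²` vanishes at `o`. It is nonnegative, so it vanishes
  -- identically and `f² ∈ D(Q^(D))`. Thus `f` is zero at every boundary point, not just almost
  -- everywhere, and lies in `D(Q^(D))`.
  · set f := clampBdd n u
    obtain ⟨w, hw, hw'⟩ := exists_sq f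
    have h1 : harm (ofBdd w) o = 0 := by
      rw [← integral_preTrace]
      refine integral_eq_zero_of_ae ?_
      filter_upwards [trace_spec o u, Lp.coeFn_zero ℝ 2 (G.harmonicMeasure m o)] with ζ h1 h2
      rw [← traceL_apply, h, h2] at h1
      rw [hw', preTrace_clampBdd h1]
      simp [clamp]
    have h2 : ∀ x, 0 ≤ harm (ofBdd w) x := harm_nonneg fun x => by
      rw [ofBdd_apply, hw]
      exact sq_nonneg _
    have h3 := harm_eq_zero_iff.1 (eq_zero_of_nonneg_of_zero hG (harm_mem _) h2 h1)
    refine mem_dirDom_of_boundary_zero (ofBdd f) (ofBdd_bounded f) fun ζ => ?_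
    have h4 := hw' ζ
    rw [preTrace_eq_zero_of_mem h3] at h4
    exact pow_eq_zero_iff two_ne_zero |>.1 h4.symm
  · simp only [ofBdd_apply, clampBdd_apply]
    exact tendsto_clamp _

theorem traceL_harm (o : X) (u : G.Dom m) : G.traceL m o (harm u) = G.traceL m o u := by
  have := traceL_eq_zero_of_mem o (sub_harm_mem u)
  rw [map_sub, sub_eq_zero] at this
  exact this.symm

theorem traceL_eq_iff (hG : G.Connected) (o : X) {u v : G.Dom m} :
    G.traceL m o u = G.traceL m o v ↔ u - v ∈ G.dirDom m := by
  rw [← traceL_eq_zero_iff hG o, map_sub, sub_eq_zero]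

/-- The harmonic extension of a trace is the harmonic part. -/
theorem harmonicExtension_traceL (hG : G.Connected) (o : X) (u : G.Dom m) :
    G.harmonicExtension m o (G.traceL m o u) = FormSpace.incl (harm u) := by
  have hex : ∃ v : Lp ℝ 2 m, G.neumann m v < ⊤ ∧ G.IsOneHarmonic m v ∧
      G.trace m o v = G.traceL m o u :=
    ⟨FormSpace.incl (harm u), Dom.neumann_incl_lt_top _, (isOneHarmonic_iff _).2 (harm_mem u),
      traceL_harm o u⟩
  rw [harmonicExtension, dif_pos hex]
  obtain ⟨h1, h2, h3⟩ := hex.choose_spec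
  set v : G.Dom m := Dom.ofLp hex.choose h1
  -- Functions with the same trace differ by an element of `D(Q^(D))`, so any harmonic function
  -- picked by the choice is `harm u`.
  have h4 : u - v ∈ G.dirDom m := (traceL_eq_iff hG o).1 h3.symm
  rw [harm_eq_of_sub_mem h4 ((isOneHarmonic_iff v).1 h2)]
  rfl

end WGraph

/-! ### Bilinear forms on form spaces and resolvents -/

namespace FormSpace

section General

variable {H : Type*} [NormedAddCommGroup H] [InnerProductSpace ℝ H] {S : SymmPosForm H}

/-- The bilinear form on the form space. -/
def bil : FormSpace S →ₗ[ℝ] FormSpace S →ₗ[ℝ] ℝ :=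
  S.form.compl₁₂ (toDomain S).toLinearMap (toDomain S).toLinearMap

theorem bil_comm (u v : FormSpace S) : bil u v = bil v u := S.symm _ _

theorem bil_nonneg (u : FormSpace S) : 0 ≤ bil u u := S.nonneg _

theorem value_incl_eq (u : FormSpace S) : S.value (incl u) = ENNReal.ofReal (bil u u) :=
  value_incl u

theorem inner_eq_bil (u v : FormSpace S) : ⟪u, v⟫ = bil u v + ⟪incl u, incl v⟫ := inner_eq u v

theorem norm_sq_eq_bil (u : FormSpace S) : ‖u‖ ^ 2 = bil u u + ‖incl u‖ ^ 2 := norm_sq_eq u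

theorem bil_add_self (u v : FormSpace S) :
    bil (u + v) (u + v) = bil u u + 2 * bil u v + bil v v := by
  simp only [map_add, LinearMap.add_apply, bil_comm v u]
  ring

theorem bil_sub_self (u v : FormSpace S) :
    bil (u - v) (u - v) = bil u u - 2 * bil u v + bil v v := by
  simp only [map_sub, LinearMap.sub_apply, bil_comm v u]
  ring

theorem two_mul_bil_le (u v : FormSpace S) : 2 * bil u v ≤ bil u u + bil v v := by
  have := bil_nonneg (u - v)
  rw [bil_sub_self] at this
  linarith

theorem bil_le_of_value_le {S' : SymmPosForm H} {u : FormSpace S} {v : FormSpace S'}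
    (h : S.value (incl u) ≤ S'.value (incl v)) : bil u u ≤ bil v v := by
  rwa [value_incl_eq, value_incl_eq, ENNReal.ofReal_le_ofReal_iff (bil_nonneg v)] at h

/-- If `S' ≤ S`, with equality at `d`, then the bilinear forms agree at `(v,d)` for all `v`. -/
theorem bil_eq_of_value_eq {S' : SymmPosForm H} (hle : S'.value ≤ S.value)
    (j : FormSpace S →ₗ[ℝ] FormSpace S') (hj : ∀ u, incl (j u) = incl u) {d : FormSpace S}
    (hd : S.value (incl d) = S'.value (incl d)) (v : FormSpace S) :
    bil v d = bil (j v) (j d) := by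
  have hb : ∀ u, bil (j u) (j u) ≤ bil u u := fun u =>
    bil_le_of_value_le (by rw [hj]; exact hle _)
  have hd' : bil d d = bil (j d) (j d) :=
    le_antisymm (bil_le_of_value_le (by rw [hj, hd])) (hb d)
  -- The difference of the two forms is nonnegative and vanishes at `d`. Along `v + t d` it is an
  -- affine function of `t` that is bounded below, so its slope is zero.
  have key : ∀ t : ℝ, 0 ≤ (bil v v - bil (j v) (j v)) + 2 * t * (bil v d - bil (j v) (j d)) := by
    intro t
    have h := hb (v + t • d)
    rw [map_add, map_smul, bil_add_self, bil_add_self] at h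
    simp only [map_smul, LinearMap.smul_apply, smul_eq_mul] at h
    rw [hd'] at h
    linarith
  by_contra hne
  have hne' : bil v d - bil (j v) (j d) ≠ 0 := sub_ne_zero.2 hne
  have h := key (-(bil v v - bil (j v) (j v) + 1) / (2 * (bil v d - bil (j v) (j d))))
  have e : 2 * (-(bil v v - bil (j v) (j v) + 1) / (2 * (bil v d - bil (j v) (j d)))) *
      (bil v d - bil (j v) (j d)) = -(bil v v - bil (j v) (j v) + 1) := by
    field_simp
  linarith

variable [CompleteSpace H] [CompleteSpace (FormSpace S)]

/-- The resolvent of the form `t S`. -/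
theorem exists_resolvent {t : ℝ} (ht : 0 < t) : ∃ R : H →L[ℝ] FormSpace S,
    ∀ f v, t * bil (R f) v + ⟪incl (R f), incl v⟫ = ⟪f, incl v⟫ := by
  -- This is `t S(u,v) + ⟪u,v⟫`, written with the form inner product so that continuity is evident.
  -- Lax–Milgram then gives the resolvent.
  let B : FormSpace S →L[ℝ] FormSpace S →L[ℝ] ℝ :=
    t • innerSL ℝ + (1 - t) • (innerSL ℝ (E := H)).bilinearComp incl incl
  have hB : ∀ u v, B u v = t * bil u v + ⟪incl u, incl v⟫ := by
    intro u v
    have : B u v = t * ⟪u, v⟫ + (1 - t) * ⟪incl u, incl v⟫ := rfl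
    rw [this, inner_eq_bil]
    ring
  have hco : IsCoercive B := by
    refine ⟨min t 1, lt_min ht one_pos, fun u => ?_⟩
    rw [hB, real_inner_self_eq_norm_sq, mul_assoc, ← sq, norm_sq_eq_bil, mul_add]
    exact add_le_add (mul_le_mul_of_nonneg_right (min_le_left _ _) (bil_nonneg u))
      (mul_le_of_le_one_left (sq_nonneg _) (min_le_right _ _))
  refine ⟨hco.continuousLinearEquivOfBilin.symm.toContinuousLinearMap.comp
    (ContinuousLinearMap.adjoint incl), fun f v => ?_⟩
  rw [← hB, ← hco.continuousLinearEquivOfBilin_apply]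
  simp only [ContinuousLinearMap.comp_apply, ContinuousLinearEquiv.coe_coe,
    ContinuousLinearEquiv.apply_symm_apply]
  exact ContinuousLinearMap.adjoint_inner_left incl v f

variable {t : ℝ} {R : H →L[ℝ] FormSpace S}

theorem resolvent_symm (hR : ∀ f v, t * bil (R f) v + ⟪incl (R f), incl v⟫ = ⟪f, incl v⟫)
    (f g : H) : ⟪incl (R f), g⟫ = ⟪f, incl (R g)⟫ := by
  rw [← hR, real_inner_comm, ← hR, bil_comm, real_inner_comm]

/-- Resolvents approximate the identity. -/
theorem resolvent_bounds (ht : 0 < t)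
    (hR : ∀ f v, t * bil (R f) v + ⟪incl (R f), incl v⟫ = ⟪f, incl v⟫) (u : FormSpace S) :
    bil (u - R (incl u)) (u - R (incl u)) ≤ bil u u ∧
      ‖incl (u - R (incl u))‖ ^ 2 ≤ t * bil u u := by
  set r := R (incl u)
  -- The resolvent equation tested with `u - r`.
  have h1 : t * bil r (u - r) = ‖incl (u - r)‖ ^ 2 := by
    rw [← real_inner_self_eq_norm_sq]
    have := hR (incl u) (u - r)
    rw [map_sub incl u r, inner_sub_left, ← map_sub]
    linarith
  have h2 : 0 ≤ bil r (u - r) := by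
    by_contra h
    have := mul_neg_of_pos_of_neg ht (not_le.1 h)
    linarith [sq_nonneg ‖incl (u - r)‖]
  rw [map_sub] at h2
  have h3 := two_mul_bil_le r u
  have h4 := bil_nonneg r
  constructor
  · rw [bil_sub_self, bil_comm u r]
    linarith
  · rw [← h1, map_sub]
    exact mul_le_mul_of_nonneg_left (by linarith) ht.le

end General

section Discrete

variable {X : Type*} [MeasurableSpace X] {m : Measure X} [PosFiniteAtoms m] [Countable X]
  [DiscreteMeasurableSpace X] {S : SymmPosForm (Lp ℝ 2 m)}

/-- Composition with a normal contraction in the domain of a Markovian form. -/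
def cmp (hM : IsMarkovian S.value) {C : ℝ → ℝ} (hC : LipschitzWith 1 C) (h0 : C 0 = 0)
    (u : FormSpace S) : FormSpace S :=
  of (hC.compLp h0 (incl u)) ((hM C hC h0 _).trans_lt (value_incl_lt_top u))

theorem cmp_apply (hM : IsMarkovian S.value) {C : ℝ → ℝ} (hC : LipschitzWith 1 C) (h0 : C 0 = 0)
    (u : FormSpace S) (x : X) : cmp hM hC h0 u x = C (u x) := lp_comp_apply hC h0 (incl u) x

theorem bil_cmp_le (hM : IsMarkovian S.value) {C : ℝ → ℝ} (hC : LipschitzWith 1 C) (h0 : C 0 = 0)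
    (u : FormSpace S) : bil (cmp hM hC h0 u) (cmp hM hC h0 u) ≤ bil u u :=
  bil_le_of_value_le (hM C hC h0 _)

theorem norm_cmp_le (hM : IsMarkovian S.value) {C : ℝ → ℝ} (hC : LipschitzWith 1 C) (h0 : C 0 = 0)
    (u : FormSpace S) : ‖cmp hM hC h0 u‖ ≤ ‖u‖ := by
  refine le_of_sq_le_sq ?_ (norm_nonneg _)
  rw [norm_sq_eq_bil, norm_sq_eq_bil]
  have h1 := hC.norm_compLp_le h0 (incl u)
  simp only [NNReal.coe_one, one_mul] at h1
  exact add_le_add (bil_cmp_le hM hC h0 u) (pow_le_pow_left₀ (norm_nonneg _) h1 2)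

/-- Resolvents of Markovian forms preserve the functions fixed by a normal contraction. -/
theorem comp_resolvent (hM : IsMarkovian S.value) {t : ℝ} (ht : 0 < t) {R : Lp ℝ 2 m →L[ℝ] FormSpace S}
    (hR : ∀ f v, t * bil (R f) v + ⟪incl (R f), incl v⟫ = ⟪f, incl v⟫)
    {C : ℝ → ℝ} (hC : LipschitzWith 1 C) (h0 : C 0 = 0) {f : Lp ℝ 2 m}
    (hf : ∀ x, C (f x) = f x) (x : X) : C (R f x) = R f x := by
  -- `R f` is the unique minimizer of `t S(v) + ‖v - f‖²`. As `C` fixes `f`, passing to `C ∘ u`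
  -- increases neither term, so `C ∘ u = u`. The Euler equation `h3` makes this quantitative.
  set u := R f
  set c := cmp hM hC h0 u
  have h1 : bil c c ≤ bil u u := bil_cmp_le hM hC h0 u
  have hCf : hC.compLp h0 f = f := lp_ext fun x => by rw [lp_comp_apply, hf]
  have h2 : ‖incl c - f‖ ≤ ‖incl u - f‖ := by
    have := hC.norm_compLp_sub_le h0 (incl u) f
    rw [hCf, NNReal.coe_one, one_mul] at this
    exact this
  have h3 := hR f (c - u)
  have h4 : ‖incl c - f‖ ^ 2 = ‖incl (c - u)‖ ^ 2 + 2 * ⟪incl u - f, incl (c - u)⟫ +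
      ‖incl u - f‖ ^ 2 := by
    have : incl c - f = incl (c - u) + (incl u - f) := by rw [map_sub]; abel
    rw [this, norm_add_sq_real, real_inner_comm]
  have h5 : bil c c = bil (c - u) (c - u) + 2 * bil u (c - u) + bil u u := by
    have := bil_add_self (c - u) u
    rw [sub_add_cancel, bil_comm (c - u) u] at this
    exact this
  rw [inner_sub_left] at h4
  have h6 := pow_le_pow_left₀ (norm_nonneg _) h2 2
  have h7 := mul_le_mul_of_nonneg_left h1 ht.le
  have h8 := mul_nonneg ht.le (bil_nonneg (c - u))
  have h9 : ‖incl (c - u)‖ ^ 2 ≤ 0 := by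
    rw [h5] at h7
    nlinarith
  have h10 : incl (c - u) = 0 := by
    have : ‖incl (c - u)‖ = 0 := by nlinarith [norm_nonneg (incl (c - u))]
    exact norm_eq_zero.1 this
  have h11 : c - u = 0 := incl_injective (by rw [h10, map_zero])
  rw [← cmp_apply hM hC h0 u x]
  exact congrArg (fun w : FormSpace S => w x) (sub_eq_zero.1 h11)

variable [CompleteSpace (FormSpace S)]

/-- Weak convergence for the bilinear form. -/
theorem tendsto_bil {α : Type*} {l : Filter α}
    {u : α → FormSpace S} {u₀ : FormSpace S} {B : ℝ} (hb : ∀ n, ‖u n‖ ≤ B)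
    (he : ∀ x, Tendsto (fun n => u n x) l (𝓝 (u₀ x))) (v : FormSpace S) :
    Tendsto (fun n => bil (u n) v) l (𝓝 (bil u₀ v)) := by
  have h1 := tendsto_inner hb he v
  have h2 := tendsto_inner_of_bounded (lpEval m) (fun f h => lp_ext fun x => by
    rw [lp_zero_apply]; exact h x) (u := fun n => incl (u n)) (u₀ := incl u₀) (R := B)
    (fun n => by
      refine (le_of_sq_le_sq ?_ (norm_nonneg _)).trans (hb n)
      rw [norm_sq_eq_bil]
      linarith [bil_nonneg (u n)]) he (incl v)
  refine (congrArg₂ (fun a b => Tendsto a l (𝓝 b)) (funext fun n => ?_) ?_).mp (h1.sub h2)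
  · rw [inner_eq_bil, add_sub_cancel_right]
  · rw [inner_eq_bil, add_sub_cancel_right]

/-- The form is the limit of the approximating forms given by its resolvents. -/
theorem tendsto_approx {R : ℕ → Lp ℝ 2 m →L[ℝ] FormSpace S}
    (hR : ∀ (n : ℕ) f v, (1 / ((n : ℝ) + 1)) * bil (R n f) v + ⟪incl (R n f), incl v⟫ = ⟪f, incl v⟫)
    (u v : FormSpace S) :
    Tendsto (fun n : ℕ => ((n : ℝ) + 1) * ⟪incl u - incl (R n (incl u)), incl v⟫) atTop
      (𝓝 (bil u v)) := by
  have hpos : ∀ n : ℕ, 0 < 1 / ((n : ℝ) + 1) := fun n => by positivity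
  have hle : ∀ n : ℕ, 1 / ((n : ℝ) + 1) ≤ 1 := fun n => by
    rw [div_le_one (by positivity)]
    linarith [(n.cast_nonneg : (0 : ℝ) ≤ n)]
  have hb : ∀ n, ‖R n (incl u)‖ ≤ Real.sqrt (2 * bil u u) + ‖u‖ := by
    intro n
    have h := resolvent_bounds (hpos n) (hR n) u
    have h1 : ‖u - R n (incl u)‖ ≤ Real.sqrt (2 * bil u u) := by
      refine Real.le_sqrt_of_sq_le ?_
      rw [norm_sq_eq_bil]
      have := mul_le_mul_of_nonneg_right (hle n) (bil_nonneg u)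
      linarith [h.1, h.2]
    have h2 := norm_sub_norm_le (R n (incl u)) u
    rw [norm_sub_rev] at h2
    linarith
  have hlim : Tendsto (fun n => incl (R n (incl u))) atTop (𝓝 (incl u)) := by
    rw [tendsto_iff_norm_sub_tendsto_zero]
    have h1 : Tendsto (fun n : ℕ => Real.sqrt (1 / ((n : ℝ) + 1) * bil u u)) atTop (𝓝 0) := by
      have := (tendsto_one_div_add_atTop_nhds_zero_nat (𝕜 := ℝ)).mul_const (bil u u)
      rw [zero_mul] at this
      simpa using this.sqrt
    refine squeeze_zero (fun n => norm_nonneg _) (fun n => ?_) h1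
    refine Real.le_sqrt_of_sq_le ?_
    have := (resolvent_bounds (hpos n) (hR n) u).2
    rwa [map_sub, norm_sub_rev] at this
  -- By the resolvent equation the approximating form at `(u,v)` is `bil (R n (incl u)) v`, and `R n
  -- (incl u)` tends to `u` weakly in the form space.
  refine (tendsto_bil hb (fun x => lp_tendsto_apply hlim x) v).congr fun n => ?_
  rw [inner_sub_left, ← hR n (incl u) v, add_sub_cancel_right, ← mul_assoc,
    mul_one_div_cancel (by positivity), one_mul]

end Discrete

end FormSpace

/-! ### The difference of a Dirichlet form and the Neumann form -/

/-- Contractions reduce finite quadratic forms with nonnegative weights. -/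
theorem finite_form_mono {X : Type*} (F F' : Finset X) (k : X → X → ℝ) (μ : X → ℝ)
    (hsymm : ∀ x y, k x y = k y x) (hk : ∀ x y, 0 ≤ k x y)
    (hrow : ∀ x, ∑ y ∈ F', k x y + ∑ y ∈ F, k x y ≤ μ x) {a b : X → ℝ}
    (h1 : ∀ x, |b x| ≤ |a x|) (h2 : ∀ x y, |b x - b y| ≤ |a x - a y|) :
    ∑ x ∈ F', μ x * b x ^ 2 - ∑ x ∈ F', ∑ y ∈ F', k x y * (b x * b y) -
        ∑ x ∈ F', ∑ y ∈ F, k x y * b x ^ 2 ≤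
      ∑ x ∈ F', μ x * a x ^ 2 - ∑ x ∈ F', ∑ y ∈ F', k x y * (a x * a y) -
        ∑ x ∈ F', ∑ y ∈ F, k x y * a x ^ 2 := by
  -- Both sides become a killing term, with nonnegative weights by `hrow`, plus squared differences.
  -- The contraction decreases each of these terms.
  have key : ∀ a : X → ℝ, ∑ x ∈ F', μ x * a x ^ 2 - ∑ x ∈ F', ∑ y ∈ F', k x y * (a x * a y) -
        ∑ x ∈ F', ∑ y ∈ F, k x y * a x ^ 2 =
      ∑ x ∈ F', (μ x - (∑ y ∈ F', k x y + ∑ y ∈ F, k x y)) * a x ^ 2 +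
        ∑ x ∈ F', ∑ y ∈ F', k x y / 2 * (a x - a y) ^ 2 := by
    intro a
    have e1 : ∑ x ∈ F', ∑ y ∈ F', k x y * a y ^ 2 = ∑ x ∈ F', ∑ y ∈ F', k x y * a x ^ 2 := by
      rw [Finset.sum_comm]
      refine Finset.sum_congr rfl fun x _ => Finset.sum_congr rfl fun y _ => ?_
      rw [hsymm]
    have e2 : ∑ x ∈ F', ∑ y ∈ F', k x y / 2 * (a x - a y) ^ 2 =
        (∑ x ∈ F', ∑ y ∈ F', k x y * a x ^ 2 + ∑ x ∈ F', ∑ y ∈ F', k x y * a y ^ 2) / 2 -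
          ∑ x ∈ F', ∑ y ∈ F', k x y * (a x * a y) := by
      rw [← Finset.sum_add_distrib, Finset.sum_div, ← Finset.sum_sub_distrib]
      refine Finset.sum_congr rfl fun x _ => ?_
      rw [← Finset.sum_add_distrib, Finset.sum_div, ← Finset.sum_sub_distrib]
      refine Finset.sum_congr rfl fun y _ => ?_
      ring
    rw [e2, e1]
    simp only [sub_mul, add_mul, Finset.sum_sub_distrib, Finset.sum_add_distrib, Finset.sum_mul]
    ring
  rw [key, key]
  refine add_le_add (Finset.sum_le_sum fun x _ => ?_)
    (Finset.sum_le_sum fun x _ => Finset.sum_le_sum fun y _ => ?_)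
  · exact mul_le_mul_of_nonneg_left (sq_le_sq.2 (h1 x)) (sub_nonneg.2 (hrow x))
  · exact mul_le_mul_of_nonneg_left (sq_le_sq.2 (h2 x y)) (div_nonneg (hk x y) zero_le_two)

namespace WGraph

open FormSpace

variable {X : Type*} [MeasurableSpace X] [Countable X] [DiscreteMeasurableSpace X]
  (G : WGraph X) {m : Measure X} [PosFiniteAtoms m]

variable (m) in
/-- The characteristic function of a point in `ℓ²`. -/
def lpDirac (x : X) : Lp ℝ 2 m := incl (Dom.dirac x : G.Dom m)

variable (m) in
/-- Restriction to a finite set in `ℓ²`. -/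
def lpRestrict (s : Finset X) (f : X → ℝ) : Lp ℝ 2 m := incl (Dom.restrict s f : G.Dom m)

theorem lpRestrict_eq_sum (s : Finset X) (f : X → ℝ) :
    G.lpRestrict m s f = ∑ x ∈ s, f x • G.lpDirac m x := by
  simp [lpRestrict, lpDirac, Dom.restrict]

open Classical in
theorem lpDirac_apply (x y : X) : G.lpDirac m x y = if y = x then 1 else 0 :=
  Dom.dirac_apply x y

open Classical in
theorem lpRestrict_apply (s : Finset X) (f : X → ℝ) (x : X) :
    G.lpRestrict m s f x = if x ∈ s then f x else 0 :=
  Dom.restrict_apply s f x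

theorem inner_lpDirac (f : Lp ℝ 2 m) (x : X) : ⟪f, G.lpDirac m x⟫ = m.real {x} * f x := by
  classical
  rw [L2.inner_def]
  have : (fun y => ⟪f y, G.lpDirac m x y⟫) = Set.indicator {x} (fun y => f y) := by
    funext y
    rw [lpDirac_apply]
    by_cases h : y = x <;> simp [h]
  rw [this, integral_indicator (measurableSet_singleton x), integral_singleton, smul_eq_mul]

theorem tendsto_lpRestrict (f : Lp ℝ 2 m) :
    Tendsto (fun s : Finset X => G.lpRestrict m s f) atTop (𝓝 f) := by
  classical
  rw [tendsto_iff_norm_sub_tendsto_zero]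
  have hfin : ∑' x, ENNReal.ofReal (m.real {x} * f x ^ 2) ≠ ⊤ := by
    rw [← ofReal_norm_sq]
    exact ENNReal.ofReal_ne_top
  have h1 := ENNReal.tendsto_tsum_compl_atTop_zero hfin
  have h2 : ∀ s : Finset X, ENNReal.ofReal (‖G.lpRestrict m s f - f‖ ^ 2) =
      ∑' x : {x // x ∉ s}, ENNReal.ofReal (m.real {(x : X)} * f x ^ 2) := by
    intro s
    rw [ofReal_norm_sq]
    refine Eq.trans (tsum_congr fun x => ?_)
      (tsum_subtype (s : Set X)ᶜ (fun x => ENNReal.ofReal (m.real {x} * f x ^ 2))).symm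
    rw [lp_sub_apply, lpRestrict_apply, Set.indicator_apply]
    by_cases hx : x ∈ s <;> simp [hx]
  simp only [← h2] at h1
  have h3 := ((ENNReal.tendsto_toReal ENNReal.zero_ne_top).comp h1).sqrt
  simpa [Function.comp_def, ENNReal.toReal_ofReal, Real.sqrt_sq] using h3

variable {S : SymmPosForm (Lp ℝ 2 m)} [CompleteSpace (FormSpace S)]

/-- The approximating forms have the contraction property after removing the killing that comes
from jumps into a finite set. -/
theorem approx_contraction_finite (hM : IsMarkovian S.value) {t : ℝ} (ht : 0 < t)
    {R : Lp ℝ 2 m →L[ℝ] FormSpace S}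
    (hR : ∀ f v, t * bil (R f) v + ⟪incl (R f), incl v⟫ = ⟪f, incl v⟫)
    {F F' : Finset X} (hF : Disjoint F F') {a b : X → ℝ}
    (h1 : ∀ x, |b x| ≤ |a x|) (h2 : ∀ x y, |b x - b y| ≤ |a x - a y|) :
    ⟪G.lpRestrict m F' b - incl (R (G.lpRestrict m F' b)), G.lpRestrict m F' b⟫ +
        ⟪G.lpRestrict m F 1 - incl (R (G.lpRestrict m F 1)), G.lpRestrict m F' (fun x => b x ^ 2)⟫ ≤
      ⟪G.lpRestrict m F' a - incl (R (G.lpRestrict m F' a)), G.lpRestrict m F' a⟫ +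
        ⟪G.lpRestrict m F 1 - incl (R (G.lpRestrict m F 1)),
          G.lpRestrict m F' (fun x => a x ^ 2)⟫ := by
  classical
  -- The jump kernel of the approximating form. It is symmetric because `R` is, and it is
  -- nonnegative with row sums at most `m` because `R` maps characteristic functions to functions
  -- with values in `[0,1]`.
  set k : X → X → ℝ := fun x y => ⟪incl (R (G.lpDirac m x)), G.lpDirac m y⟫ with hkdef
  have hC : LipschitzWith 1 fun t : ℝ => max 0 (min 1 t) :=
    (LipschitzWith.id.const_min 1).const_max 0
  have hC0 : max 0 (min 1 (0 : ℝ)) = 0 := by simp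
  have hRC : ∀ f : Lp ℝ 2 m, (∀ x, f x = 0 ∨ f x = 1) → ∀ x, 0 ≤ R f x ∧ R f x ≤ 1 := by
    intro f hf x
    rw [← comp_resolvent hM ht hR hC hC0 (f := f)
      (fun x => by rcases hf x with h | h <;> simp [h]) x]
    exact ⟨le_max_left _ _, max_le zero_le_one (min_le_left _ _)⟩
  have hksymm : ∀ x y, k x y = k y x := fun x y => by
    simp only [hkdef]
    rw [resolvent_symm hR, real_inner_comm]
  have hk0 : ∀ x y, 0 ≤ k x y := fun x y => by
    simp only [hkdef]
    rw [inner_lpDirac]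
    exact mul_nonneg (mass_pos m y).le (hRC _ (fun z => by
      rw [lpDirac_apply]; split_ifs <;> simp) y).1
  have hrow : ∀ x, ∑ y ∈ F', k x y + ∑ y ∈ F, k x y ≤ m.real {x} := fun x => by
    rw [add_comm, ← Finset.sum_union hF]
    have e : ∑ y ∈ F ∪ F', k x y = ⟪incl (R (G.lpRestrict m (F ∪ F') 1)), G.lpDirac m x⟫ := by
      rw [real_inner_comm, ← resolvent_symm hR, lpRestrict_eq_sum, inner_sum]
      simp [hkdef]
    rw [e, inner_lpDirac]
    refine mul_le_of_le_one_right (mass_pos m x).le (hRC _ (fun z => ?_) x).2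
    rw [lpRestrict_apply]
    split_ifs <;> simp
  have hA : ∀ x y, ⟪G.lpDirac m x - incl (R (G.lpDirac m x)), G.lpDirac m y⟫ =
      (if x = y then m.real {y} else 0) - k x y := fun x y => by
    rw [inner_sub_left, inner_lpDirac, lpDirac_apply]
    by_cases h : x = y
    · simp [h, hkdef]
    · simp [h, Ne.symm h, hkdef]
  have hA' : ∀ (s s' : Finset X) (a b : X → ℝ),
      ⟪G.lpRestrict m s a - incl (R (G.lpRestrict m s a)), G.lpRestrict m s' b⟫ =
      ∑ x ∈ s, ∑ y ∈ s', ((if x = y then m.real {y} else 0) - k x y) * (a x * b y) := by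
    intro s s' a b
    have e : G.lpRestrict m s a - incl (R (G.lpRestrict m s a)) =
        ∑ x ∈ s, a x • (G.lpDirac m x - incl (R (G.lpDirac m x))) := by
      simp only [lpRestrict_eq_sum, map_sum, map_smul, smul_sub, Finset.sum_sub_distrib]
    rw [e, lpRestrict_eq_sum, sum_inner]
    refine Finset.sum_congr rfl fun x _ => ?_
    rw [inner_sum]
    refine Finset.sum_congr rfl fun y _ => ?_
    rw [real_inner_smul_left, real_inner_smul_right, hA]
    ring
  -- As `F` and `F'` are disjoint, the second inner product is minus the sum of `k x y * a x ^ 2`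
  -- over `x ∈ F'`, `y ∈ F`. It removes the killing due to jumps into `F`.
  have key : ∀ a : X → ℝ,
      ⟪G.lpRestrict m F' a - incl (R (G.lpRestrict m F' a)), G.lpRestrict m F' a⟫ +
        ⟪G.lpRestrict m F 1 - incl (R (G.lpRestrict m F 1)),
          G.lpRestrict m F' (fun x => a x ^ 2)⟫ =
      ∑ x ∈ F', m.real {x} * a x ^ 2 - ∑ x ∈ F', ∑ y ∈ F', k x y * (a x * a y) -
        ∑ x ∈ F', ∑ y ∈ F, k x y * a x ^ 2 := by
    intro a
    rw [hA', hA']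
    have e1 : ∑ x ∈ F', ∑ y ∈ F', ((if x = y then m.real {y} else 0) - k x y) * (a x * a y) =
        ∑ x ∈ F', m.real {x} * a x ^ 2 - ∑ x ∈ F', ∑ y ∈ F', k x y * (a x * a y) := by
      rw [← Finset.sum_sub_distrib]
      refine Finset.sum_congr rfl fun x hx => ?_
      simp only [sub_mul, Finset.sum_sub_distrib, ite_mul, zero_mul, Finset.sum_ite_eq, hx,
        if_true, sq]
    have e2 : ∑ x ∈ F, ∑ y ∈ F', ((if x = y then m.real {y} else 0) - k x y) *
        ((1 : X → ℝ) x * a y ^ 2) = -∑ x ∈ F', ∑ y ∈ F, k x y * a x ^ 2 := by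
      rw [Finset.sum_comm, ← Finset.sum_neg_distrib]
      refine Finset.sum_congr rfl fun x hx => ?_
      rw [← Finset.sum_neg_distrib]
      refine Finset.sum_congr rfl fun y hy => ?_
      have : y ≠ x := fun h => Finset.disjoint_left.1 hF hy (h ▸ hx)
      rw [if_neg this, hksymm]
      simp
    rw [e1, e2]
    ring
  rw [key, key]
  exact finite_form_mono F F' k _ hksymm hk0 hrow h1 h2

/-- The finite sets `s \ F` exhaust the complement of `F`, outside of which the functions vanish,
and the resolvent is continuous on `ℓ²`. -/
theorem approx_contraction (hM : IsMarkovian S.value) {t : ℝ} (ht : 0 < t)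
    {R : Lp ℝ 2 m →L[ℝ] FormSpace S}
    (hR : ∀ f v, t * bil (R f) v + ⟪incl (R f), incl v⟫ = ⟪f, incl v⟫)
    {F : Finset X} {g g₂ c c₂ : Lp ℝ 2 m} (hg0 : ∀ x ∈ F, g x = 0) (hg₂ : ∀ x, g₂ x = g x ^ 2)
    (hc₂ : ∀ x, c₂ x = c x ^ 2)
    (h1 : ∀ x, |c x| ≤ |g x|) (h2 : ∀ x y, |c x - c y| ≤ |g x - g y|) :
    ⟪c - incl (R c), c⟫ + ⟪G.lpRestrict m F 1 - incl (R (G.lpRestrict m F 1)), c₂⟫ ≤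
      ⟪g - incl (R g), g⟫ + ⟪G.lpRestrict m F 1 - incl (R (G.lpRestrict m F 1)), g₂⟫ := by
  classical
  have hlim : ∀ f : Lp ℝ 2 m, (∀ x ∈ F, f x = 0) →
      Tendsto (fun s : Finset X => G.lpRestrict m (s \ F) f) atTop (𝓝 f) := by
    intro f hf
    refine (G.tendsto_lpRestrict f).congr fun s => lp_ext fun x => ?_
    rw [lpRestrict_apply, lpRestrict_apply]
    by_cases hx : x ∈ F
    · simp [hx, hf x hx]
    · simp [hx]
  have hc0 : ∀ x ∈ F, c x = 0 := fun x hx => by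
    have := h1 x
    rw [hg0 x hx, abs_zero] at this
    exact abs_eq_zero.1 (le_antisymm this (abs_nonneg _))
  have hcont : ∀ f f₂ : Lp ℝ 2 m, (∀ x ∈ F, f x = 0) → (∀ x, f₂ x = f x ^ 2) →
      Tendsto (fun s : Finset X =>
        ⟪G.lpRestrict m (s \ F) f - incl (R (G.lpRestrict m (s \ F) f)), G.lpRestrict m (s \ F) f⟫ +
        ⟪G.lpRestrict m F 1 - incl (R (G.lpRestrict m F 1)),
          G.lpRestrict m (s \ F) (fun x => f x ^ 2)⟫) atTop
        (𝓝 (⟪f - incl (R f), f⟫ +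
          ⟪G.lpRestrict m F 1 - incl (R (G.lpRestrict m F 1)), f₂⟫)) := by
    intro f f₂ hf hf₂
    have l1 := hlim f hf
    have l2 := hlim f₂ (fun x hx => by rw [hf₂, hf x hx]; simp)
    rw [show (f₂ : X → ℝ) = fun x => f x ^ 2 from funext hf₂] at l2
    have l3 : Tendsto (fun s : Finset X => incl (R (G.lpRestrict m (s \ F) f))) atTop
        (𝓝 (incl (R f))) := ((incl.comp R).continuous.tendsto f).comp l1
    exact ((l1.sub l3).inner l1).add (tendsto_const_nhds.inner l2)
  refine le_of_tendsto_of_tendsto' (hcont c c₂ hc0 hc₂) (hcont g g₂ hg0 hg₂) fun s => ?_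
  exact G.approx_contraction_finite hM ht hR Finset.disjoint_sdiff h1 h2

/-- The contraction property of a Markovian form after removing the killing that comes from jumps
into a finite set. -/
theorem bil_contraction (hM : IsMarkovian S.value) {F : Finset X}
    {e g g₂ c c₂ : FormSpace S} (he : incl e = G.lpRestrict m F 1) (hg0 : ∀ x ∈ F, g x = 0)
    (hg₂ : ∀ x, g₂ x = g x ^ 2) (hc₂ : ∀ x, c₂ x = c x ^ 2)
    (h1 : ∀ x, |c x| ≤ |g x|) (h2 : ∀ x y, |c x - c y| ≤ |g x - g y|) :
    bil c c + bil e c₂ ≤ bil g g + bil e g₂ := by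
  have hpos : ∀ n : ℕ, 0 < 1 / ((n : ℝ) + 1) := fun n => by positivity
  choose R hR using fun n : ℕ => exists_resolvent (S := S) (hpos n)
  refine le_of_tendsto_of_tendsto' ((tendsto_approx hR c c).add (tendsto_approx hR e c₂))
    ((tendsto_approx hR g g).add (tendsto_approx hR e g₂)) fun n => ?_
  rw [← mul_add, ← mul_add, he]
  exact mul_le_mul_of_nonneg_left
    (G.approx_contraction hM (hpos n) (hR n) hg0 hg₂ hc₂ h1 h2) (by positivity)

end WGraph

namespace WGraph

open FormSpace

variable {X : Type*} [MeasurableSpace X] [Countable X] [DiscreteMeasurableSpace X]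
  {G : WGraph X} {m : Measure X} [PosFiniteAtoms m]

theorem Dom.hasSum_bil_self (u : G.Dom m) :
    HasSum (fun y => G.weight y * grad u y ^ 2) (bil u u) := by
  have h : G.energy u = ENNReal.ofReal (bil u u) := by
    rw [← value_incl_eq, neumannForm_value]
    rfl
  rw [energy_eq_tsum] at h
  have h1 := ENNReal.hasSum_toReal (h.trans_ne ENNReal.ofReal_ne_top)
  rw [← ENNReal.tsum_toReal_eq (fun _ => ENNReal.ofReal_ne_top), h,
    ENNReal.toReal_ofReal (bil_nonneg _)] at h1
  convert h1 using 2 with y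
  rw [ENNReal.toReal_ofReal (mul_nonneg (weight_nonneg _ y) (sq_nonneg _))]

theorem Dom.hasSum_bil (u v : G.Dom m) :
    HasSum (fun y => G.weight y * (grad u y * grad v y)) (bil u v) := by
  have h := ((Dom.hasSum_bil_self (u + v)).sub (Dom.hasSum_bil_self (u - v))).div_const 4
  rw [bil_add_self, bil_sub_self] at h
  refine (congrArg₂ HasSum (funext fun y => ?_) ?_).mpr h
  · rw [Dom.grad_add, Dom.grad_sub]; ring
  · ring

/-! ### Forms between `Q^(N)` and `Q^(D)` -/

variable {S : SymmPosForm (Lp ℝ 2 m)}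

/-- The inclusion of the domain of a form above `Q^(N)` into `D(Q^(N))`. -/
def toDom (hN : G.neumann m ≤ S.value) : FormSpace S →ₗ[ℝ] G.Dom m where
  toFun u := Dom.ofLp (incl u) ((hN _).trans_lt (value_incl_lt_top u))
  map_add' u v := incl_injective (by simp)
  map_smul' c u := incl_injective (by simp)

theorem incl_toDom (hN : G.neumann m ≤ S.value) (u : FormSpace S) :
    incl (toDom hN u) = incl u := rfl

theorem toDom_apply (hN : G.neumann m ≤ S.value) (u : FormSpace S) (x : X) :
    toDom hN u x = u x := rfl

theorem toDom_coe (hN : G.neumann m ≤ S.value) (u : FormSpace S) :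
    (toDom hN u : X → ℝ) = u := rfl

/-- The inclusion of `D(Q^(D))` into the domain of a form below `Q^(D)`. -/
def ofDir (hD : S.value ≤ G.dirichlet m) (d : G.Dom m) (hd : d ∈ G.dirDom m) : FormSpace S :=
  of (incl d) ((hD _).trans_lt ((dirichlet_incl_lt_top_iff d).2 hd))

theorem incl_ofDir (hD : S.value ≤ G.dirichlet m) (d : G.Dom m) (hd : d ∈ G.dirDom m) :
    incl (ofDir hD d hd) = incl d := rfl

/-- On `D(Q^(D))` the form is squeezed between two equal values, so it agrees there with `Q^(N)`,
and `bil_eq_of_value_eq` extends this to mixed terms. -/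
theorem bil_eq_bil_toDom (hN : G.neumann m ≤ S.value) (hD : S.value ≤ G.dirichlet m)
    {d : FormSpace S} (hd : toDom hN d ∈ G.dirDom m) (v : FormSpace S) :
    bil v d = bil (toDom hN v) (toDom hN d) := by
  refine bil_eq_of_value_eq (by rw [neumannForm_value]; exact hN) (toDom hN) (incl_toDom hN) ?_ v
  rw [neumannForm_value]
  refine le_antisymm ((hD _).trans_eq ?_) (hN _)
  rw [← incl_toDom hN d]
  exact dirichlet_incl_of_mem hd

/-- The difference to `Q^(N)` only depends on the class modulo `D(Q^(D))`. -/
theorem bil_sub_bil_toDom (hN : G.neumann m ≤ S.value) (hD : S.value ≤ G.dirichlet m)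
    {d : FormSpace S} (hd : toDom hN d ∈ G.dirDom m) (v : FormSpace S) :
    bil (v + d) (v + d) - bil (toDom hN (v + d)) (toDom hN (v + d)) =
      bil v v - bil (toDom hN v) (toDom hN v) := by
  rw [map_add (toDom hN), bil_add_self, bil_add_self, bil_eq_bil_toDom hN hD hd,
    bil_eq_bil_toDom hN hD hd]
  ring

/-- After truncation at `M`, squaring is `2M`-Lipschitz, so it is a multiple of a normal
contraction. -/
theorem exists_sq_of_markovian (hM : IsMarkovian S.value) (u : FormSpace S) {M : ℝ} (hM0 : 0 < M)
    (hu : ∀ x, |u x| ≤ M) : ∃ w : FormSpace S, ∀ x, w x = u x ^ 2 := by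
  have hC : LipschitzWith 1 fun t : ℝ => clamp M t ^ 2 / (2 * M) := by
    refine LipschitzWith.of_dist_le_mul fun s t => ?_
    rw [Real.dist_eq, Real.dist_eq, NNReal.coe_one, one_mul, ← sub_div, abs_div,
      abs_of_pos (by positivity : 0 < 2 * M), div_le_iff₀ (by positivity), sq_sub_sq, abs_mul,
      mul_comm]
    refine mul_le_mul (abs_sub_le_of_lipschitz (lipschitz_clamp M) s t) ?_ (abs_nonneg _)
      (abs_nonneg _)
    refine (abs_add_le _ _).trans ?_
    linarith [abs_clamp_le hM0.le s, abs_clamp_le hM0.le t]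
  have h0 : clamp M 0 ^ 2 / (2 * M) = 0 := by simp [clamp_zero hM0.le]
  refine ⟨(2 * M) • cmp hM hC h0 u, fun x => ?_⟩
  rw [fn_smul, cmp_apply, clamp_eq_self (hu x)]
  field_simp

/-- For a Markovian form between `Q^(N)` and `Q^(D)`, contractions also decrease the form after
removing finitely many terms of the energy. -/
theorem bil_cmp_add_sum_le_of_bounded (hN : G.neumann m ≤ S.value)
    (hD : S.value ≤ G.dirichlet m) (hM : IsMarkovian S.value) [CompleteSpace (FormSpace S)]
    {C : ℝ → ℝ} (hC : LipschitzWith 1 C) (h0 : C 0 = 0) (f : FormSpace S) {M : ℝ}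
    (hf : ∀ x, |f x| ≤ M) (A : Finset ((X × X) ⊕ X)) :
    bil (cmp hM hC h0 f) (cmp hM hC h0 f) + ∑ y ∈ A, G.weight y * grad f y ^ 2 ≤
      bil f f + ∑ y ∈ A, G.weight y * grad (cmp hM hC h0 f) y ^ 2 := by
  classical
  -- `F` collects the vertices that occur in `A`. Replacing `f` and `C ∘ f` by functions `g` and `c`
  -- that vanish on `F` changes them by finitely supported functions, so only the `Q^(N)` parts of
  -- their forms change. `bil_contraction` applies to `g` and `c`.
  set F : Finset X := A.biUnion (Sum.elim (fun p => {p.1, p.2}) fun x => {x}) with hF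
  have hFl : ∀ p, Sum.inl p ∈ A → p.1 ∈ F ∧ p.2 ∈ F := fun p hp => by
    constructor <;> exact Finset.mem_biUnion.2 ⟨_, hp, by simp⟩
  have hFr : ∀ x, Sum.inr x ∈ A → x ∈ F := fun x hx => Finset.mem_biUnion.2 ⟨_, hx, by simp⟩
  set k := cmp hM hC h0 f with hk
  set r : FormSpace S := ofDir hD (Dom.restrict F f) (restrict_mem_dirDom _ _) with hr
  set rk : FormSpace S := ofDir hD (Dom.restrict F k) (restrict_mem_dirDom _ _) with hrk
  set e : FormSpace S := ofDir hD (Dom.restrict F 1) (restrict_mem_dirDom _ _) with he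
  set g := f - r with hg
  set c := k - rk with hc
  have hrx : ∀ x, r x = if x ∈ F then f x else 0 := fun x => Dom.restrict_apply F f x
  have hrkx : ∀ x, rk x = if x ∈ F then k x else 0 := fun x => Dom.restrict_apply F k x
  have hex : ∀ x, e x = if x ∈ F then 1 else 0 := fun x => Dom.restrict_apply F 1 x
  have hgx : ∀ x, g x = if x ∈ F then 0 else f x := fun x => by
    rw [hg, fn_sub, hrx]; split_ifs <;> simp
  have hkx : ∀ x, k x = C (f x) := fun x => cmp_apply hM hC h0 f x
  have hcx : ∀ x, c x = C (g x) := fun x => by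
    rw [hc, fn_sub, hrkx, hgx]; split_ifs <;> simp [h0, hkx]
  have hgM : ∀ x, |g x| ≤ max M 1 := fun x => by
    rw [hgx]
    split_ifs
    · simp
    · exact (hf x).trans (le_max_left _ _)
  have hM0 : 0 < max M 1 := lt_max_of_lt_right one_pos
  have h1 : ∀ x, |c x| ≤ |g x| := fun x => by rw [hcx]; exact abs_le_of_lipschitz hC h0 _
  obtain ⟨g₂, hg₂⟩ := exists_sq_of_markovian hM g hM0 hgM
  obtain ⟨c₂, hc₂⟩ := exists_sq_of_markovian hM c hM0 fun x => (h1 x).trans (hgM x)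
  have hmain := G.bil_contraction hM (F := F) (e := e) (g := g) (c := c) rfl
    (fun x hx => by rw [hgx, if_pos hx]) hg₂ hc₂ h1
    (fun x y => by rw [hcx, hcx]; exact abs_sub_le_of_lipschitz hC _ _)
  have hdir : ∀ (s : FormSpace S) (w : X → ℝ), (∀ x, s x = if x ∈ F then w x else 0) →
      toDom hN s ∈ G.dirDom m := fun s w h => by
    have : toDom hN s = Dom.restrict F w := ext_fn fun x => by
      rw [toDom_apply, h, Dom.restrict_apply]
    rw [this]
    exact restrict_mem_dirDom _ _
  rw [bil_comm e, bil_comm e, bil_eq_bil_toDom hN hD (hdir e _ hex),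
    bil_eq_bil_toDom hN hD (hdir e _ hex)] at hmain
  have hfg := bil_sub_bil_toDom hN hD (hdir r _ hrx) g
  have hkc := bil_sub_bil_toDom hN hD (hdir rk _ hrkx) c
  rw [hg, sub_add_cancel, ← hg] at hfg
  rw [hc, sub_add_cancel, ← hc] at hkc
  have hsum := (((((Dom.hasSum_bil (toDom hN c₂) (toDom hN e)).sub
    (Dom.hasSum_bil (toDom hN g₂) (toDom hN e))).add
    (Dom.hasSum_bil (toDom hN f) (toDom hN f))).sub
    (Dom.hasSum_bil (toDom hN g) (toDom hN g))).sub
    (Dom.hasSum_bil (toDom hN k) (toDom hN k))).add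
    (Dom.hasSum_bil (toDom hN c) (toDom hN c))
  -- The `Q^(N)` terms left over are compared edge by edge. If exactly one end of an edge is in `F`,
  -- the terms from `g` and `g₂` cancel, as do those from `c` and `c₂`. What survives are the
  -- squares of `f` and `k` on edges and vertices meeting `F`.
  have hT : ∀ y, grad c₂ y * grad e y - grad g₂ y * grad e y + grad f y * grad f y -
      grad g y * grad g y - grad k y * grad k y + grad c y * grad c y =
      if (Sum.elim (fun p : X × X => p.1 ∈ F ∨ p.2 ∈ F) (fun x => x ∈ F) y) then
        grad f y ^ 2 - grad k y ^ 2 else 0 := by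
    intro y
    rcases y with p | x
    · simp only [grad_inl, Sum.elim_inl, hc₂, hg₂, hcx, hex, hgx, hkx]
      by_cases h1 : p.1 ∈ F <;> by_cases h2 : p.2 ∈ F <;> simp [h1, h2, h0] <;> ring
    · simp only [grad_inr, Sum.elim_inr, hc₂, hg₂, hcx, hex, hgx, hkx]
      by_cases h1 : x ∈ F <;> simp [h1, h0]
      ring
  have hle : ∀ y, grad k y ^ 2 ≤ grad f y ^ 2 := fun y => by
    rw [sq_le_sq]
    rcases y with p | x
    · simp only [grad_inl, hkx]
      exact abs_sub_le_of_lipschitz hC _ _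
    · simp only [grad_inr, hkx]
      exact abs_le_of_lipschitz hC h0 _
  -- The surviving terms are nonnegative by `hle`, so their sum may be cut down to `A`.
  have hA := sum_le_hasSum A (fun y _ => ?_) hsum
  · rw [Finset.sum_congr rfl (g := fun y => G.weight y * grad f y ^ 2 - G.weight y * grad k y ^ 2)
      fun y hy => ?_, Finset.sum_sub_distrib] at hA
    · linarith
    · simp only [toDom_coe, ← mul_add, ← mul_sub, hT]
      rw [if_pos]
      rcases y with p | x
      · exact Or.inl (hFl p hy).1
      · exact hFr x hy
  · simp only [toDom_coe, ← mul_add, ← mul_sub, hT]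
    refine mul_nonneg (G.weight_nonneg y) ?_
    split_ifs
    · exact sub_nonneg.2 (hle y)
    · exact le_rfl

/-- Truncation removes the boundedness assumption: the finite sums converge pointwise, and the
remaining form term is weakly lower semicontinuous. -/
theorem bil_cmp_add_sum_le (hN : G.neumann m ≤ S.value)
    (hD : S.value ≤ G.dirichlet m) (hM : IsMarkovian S.value) [CompleteSpace (FormSpace S)]
    {C : ℝ → ℝ} (hC : LipschitzWith 1 C) (h0 : C 0 = 0) (f : FormSpace S)
    (A : Finset ((X × X) ⊕ X)) :
    bil (cmp hM hC h0 f) (cmp hM hC h0 f) + ∑ y ∈ A, G.weight y * grad f y ^ 2 ≤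
      bil f f + ∑ y ∈ A, G.weight y * grad (cmp hM hC h0 f) y ^ 2 := by
  set k := cmp hM hC h0 f with hk
  set f' : ℕ → FormSpace S := fun n => cmp hM (lipschitz_clamp n) (clamp_zero n.cast_nonneg) f
    with hf'
  set k' : ℕ → FormSpace S := fun n => cmp hM hC h0 (f' n) with hk'
  have hfx : ∀ n x, f' n x = clamp n (f x) := fun n x => cmp_apply _ _ _ _ _
  have hkx : ∀ n x, k' n x = C (clamp n (f x)) := fun n x => by
    rw [hk', ← hfx]; exact cmp_apply _ _ _ _ _
  have hlf : ∀ x, Tendsto (fun n => f' n x) atTop (𝓝 (f x)) := fun x => by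
    simp only [hfx]
    exact tendsto_clamp _
  have hlk : ∀ x, Tendsto (fun n => k' n x) atTop (𝓝 (k x)) := fun x => by
    simp only [hkx]
    rw [hk, cmp_apply]
    exact (hC.continuous.tendsto _).comp (tendsto_clamp (f x))
  have hb : ∀ n, ‖k' n‖ ≤ ‖f‖ := fun n =>
    (norm_cmp_le hM hC h0 _).trans (norm_cmp_le hM _ _ f)
  have hsum : ∀ {u : ℕ → FormSpace S} {v : FormSpace S},
      (∀ x, Tendsto (fun n => u n x) atTop (𝓝 (v x))) →
      Tendsto (fun n => ∑ y ∈ A, G.weight y * grad (u n) y ^ 2) atTop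
        (𝓝 (∑ y ∈ A, G.weight y * grad v y ^ 2)) := fun h =>
    tendsto_finsetSum _ fun y _ => ((grad_tendsto h y).pow 2).const_mul _
  have hlim := (((tendsto_bil hb hlk k).const_mul 2).sub_const (bil k k)).add (hsum hlf)
  have hlim' := (hsum hlk).const_add (bil f f)
  -- Lower semicontinuity in linear form: `2 * bil (k' n) k - bil k k` bounds `bil (k' n) (k' n)`
  -- from below and converges to `bil k k`.
  have := le_of_tendsto_of_tendsto' hlim hlim' fun n => by
    have h1 := two_mul_bil_le (k' n) k
    have h2 := bil_cmp_add_sum_le_of_bounded hN hD hM hC h0 (f' n) (M := n) (fun x => by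
      rw [hfx]; exact abs_clamp_le n.cast_nonneg _) A
    have h3 := bil_cmp_le hM (lipschitz_clamp n) (clamp_zero n.cast_nonneg) f
    linarith
  linarith

/-- The difference of a Dirichlet form between `Q^(N)` and `Q^(D)` and `Q^(N)` is Markovian. -/
theorem bil_cmp_add_le (hN : G.neumann m ≤ S.value)
    (hD : S.value ≤ G.dirichlet m) (hM : IsMarkovian S.value) [CompleteSpace (FormSpace S)]
    {C : ℝ → ℝ} (hC : LipschitzWith 1 C) (h0 : C 0 = 0) (f : FormSpace S) :
    bil (cmp hM hC h0 f) (cmp hM hC h0 f) + bil (toDom hN f) (toDom hN f) ≤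
      bil f f + bil (toDom hN (cmp hM hC h0 f)) (toDom hN (cmp hM hC h0 f)) := by
  -- As `A` exhausts all edges and vertices, the finite sums become the full `Q^(N)` energies.
  refine le_of_tendsto_of_tendsto' (Tendsto.const_add _ (Dom.hasSum_bil_self (toDom hN f)))
    (Tendsto.const_add _ (Dom.hasSum_bil_self (toDom hN (cmp hM hC h0 f)))) fun A => ?_
  exact bil_cmp_add_sum_le hN hD hM hC h0 f A

end WGraph

theorem ofReal_parallelogram {a b c d : ℝ} (ha : 0 ≤ a) (hb : 0 ≤ b) (hc : 0 ≤ c) (hd : 0 ≤ d)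
    (h : a + b = 2 * c + 2 * d) : ENNReal.ofReal a + ENNReal.ofReal b =
      2 * ENNReal.ofReal c + 2 * ENNReal.ofReal d := by
  rw [← ENNReal.ofReal_add ha hb, h, ENNReal.ofReal_add (by linarith) (by linarith),
    ENNReal.ofReal_mul zero_le_two, ENNReal.ofReal_mul zero_le_two, ENNReal.ofReal_ofNat]

theorem diffOnDomain_lt_top {Ω : Type*} [MeasurableSpace Ω] {μ : Measure Ω}
    {q q' : Lp ℝ 2 μ → ℝ≥0∞} {φ : Lp ℝ 2 μ} : diffOnDomain q q' φ < ⊤ ↔ q φ < ⊤ := by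
  rw [diffOnDomain]
  split_ifs with h
  · exact iff_of_true (tsub_le_self.trans_lt h) h
  · exact iff_of_false (lt_irrefl _) h

namespace WGraph

open FormSpace

variable {X : Type*} [MeasurableSpace X] [Countable X] [DiscreteMeasurableSpace X]
  {G : WGraph X} {m : Measure X} [PosFiniteAtoms m]

/-! ### Trace forms -/

theorem dirichletToNeumann_traceL (hG : G.Connected) (o : X) (u : G.Dom m) :
    G.dirichletToNeumann m o (G.traceL m o u) = ENNReal.ofReal (‖harm u‖ ^ 2) := by
  rw [dirichletToNeumann, traceForm, if_pos ⟨incl u, Dom.neumann_incl_lt_top u, rfl⟩,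
    harmonicExtension_traceL hG, Dom.one_neumann_incl]

theorem exists_of_dirichletToNeumann_lt_top {o : X} {φ : G.L2Boundary m o}
    (h : G.dirichletToNeumann m o φ < ⊤) : ∃ u : G.Dom m, G.traceL m o u = φ := by
  rw [dirichletToNeumann, traceForm] at h
  split_ifs at h with h'
  · obtain ⟨f, hf, hφ⟩ := h'
    exact ⟨Dom.ofLp f hf, hφ⟩
  · exact absurd h (lt_irrefl _)

section TraceForm

variable {S : SymmPosForm (Lp ℝ 2 m)} (hN : G.neumann m ≤ S.value)
  (hD : S.value ≤ G.dirichlet m)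

/-- The harmonic part in the domain of a form between `Q^(N)` and `Q^(D)`. -/
def harmIn (v : FormSpace S) : FormSpace S :=
  v - ofDir hD (toDom hN v - harm (toDom hN v)) (sub_harm_mem _)

theorem toDom_harmIn (v : FormSpace S) : toDom hN (harmIn hN hD v) = harm (toDom hN v) :=
  incl_injective (by
    rw [incl_toDom, harmIn, map_sub, incl_ofDir, map_sub, incl_toDom, sub_sub_cancel])

theorem toDom_injective : Function.Injective (toDom hN) := fun u v h =>
  incl_injective (by rw [← incl_toDom hN u, h, incl_toDom])

theorem harmIn_add (u v : FormSpace S) :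
    harmIn hN hD (u + v) = harmIn hN hD u + harmIn hN hD v :=
  toDom_injective hN (by simp only [map_add, toDom_harmIn])

theorem harmIn_sub (u v : FormSpace S) :
    harmIn hN hD (u - v) = harmIn hN hD u - harmIn hN hD v :=
  toDom_injective hN (by simp only [map_sub, toDom_harmIn])

theorem harmIn_smul (c : ℝ) (v : FormSpace S) :
    harmIn hN hD (c • v) = c • harmIn hN hD v :=
  toDom_injective hN (by simp only [map_smul, toDom_harmIn])

theorem harmIn_harmIn (v : FormSpace S) : harmIn hN hD (harmIn hN hD v) = harmIn hN hD v :=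
  toDom_injective hN (by rw [toDom_harmIn, toDom_harmIn, harm_eq_self (harm_mem _)])

theorem traceL_toDom_harmIn (o : X) (v : FormSpace S) :
    G.traceL m o (toDom hN (harmIn hN hD v)) = G.traceL m o (toDom hN v) := by
  rw [toDom_harmIn, traceL_harm]

theorem norm_sq_sub_norm_sq_toDom (v : FormSpace S) :
    ‖v‖ ^ 2 - ‖toDom hN v‖ ^ 2 = bil v v - bil (toDom hN v) (toDom hN v) := by
  rw [norm_sq_eq_bil, norm_sq_eq_bil, incl_toDom]
  ring

/-- `Q - Q^(N)` ignores the part in `D(Q^(D))`, so it may be evaluated on the harmonic part, where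
the `ℓ²` terms of the two form norms cancel. -/
theorem norm_harmIn_sq_sub (v : FormSpace S) :
    ‖harmIn hN hD v‖ ^ 2 - ‖harm (toDom hN v)‖ ^ 2 =
      bil v v - bil (toDom hN v) (toDom hN v) := by
  have h := bil_sub_bil_toDom hN hD
    (d := ofDir hD (toDom hN v - harm (toDom hN v)) (sub_harm_mem _))
    (sub_harm_mem (toDom hN v)) (harmIn hN hD v)
  rw [← norm_sq_sub_norm_sq_toDom, ← norm_sq_sub_norm_sq_toDom, toDom_harmIn] at h
  rw [← h, ← norm_sq_sub_norm_sq_toDom, harmIn, sub_add_cancel]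

/-- The Royden decomposition is orthogonal for `Q_1` as well: it is so for `Q^(N)_1`, and `Q -
Q^(N)` only sees the harmonic part. -/
theorem norm_sq_eq_add_harmIn (v : FormSpace S) :
    ‖v‖ ^ 2 = ‖toDom hN v - harm (toDom hN v)‖ ^ 2 + ‖harmIn hN hD v‖ ^ 2 := by
  have h1 := norm_harmIn_sq_sub hN hD v
  have h2 := norm_sq_sub_norm_sq_toDom hN v
  have h3 := norm_sq_eq_add (toDom hN v)
  linarith

theorem norm_harmIn_le (v : FormSpace S) : ‖harmIn hN hD v‖ ≤ ‖v‖ := by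
  refine le_of_sq_le_sq ?_ (norm_nonneg _)
  rw [norm_sq_eq_add_harmIn hN hD v]
  exact le_add_of_nonneg_left (sq_nonneg _)

theorem bil_toDom_le (v : FormSpace S) : bil (toDom hN v) (toDom hN v) ≤ bil v v :=
  bil_le_of_value_le (by rw [neumannForm_value]; exact hN _)

theorem norm_toDom_le (v : FormSpace S) : ‖toDom hN v‖ ≤ ‖v‖ := by
  refine le_of_sq_le_sq ?_ (norm_nonneg _)
  linarith [norm_sq_sub_norm_sq_toDom hN v, bil_toDom_le hN v]

theorem toDom_cmp (hM : IsMarkovian S.value) {C : ℝ → ℝ} (hC : LipschitzWith 1 C) (h0 : C 0 = 0)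
    (v : FormSpace S) : toDom hN (cmp hM hC h0 v) = Dom.comp hC h0 (toDom hN v) :=
  incl_injective (by rw [Dom.incl_comp]; rfl)

variable (o : X)

theorem traceForm_traceL (hG : G.Connected) (v : FormSpace S) :
    G.traceForm m o S.value (G.traceL m o (toDom hN v)) =
      ENNReal.ofReal (‖harmIn hN hD v‖ ^ 2) := by
  rw [traceForm, if_pos ⟨incl v, value_incl_lt_top v, rfl⟩, harmonicExtension_traceL hG,
    ← toDom_harmIn hN hD, incl_toDom, one_value_incl]

variable {o} in
theorem exists_of_traceForm_lt_top {φ : G.L2Boundary m o}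
    (h : G.traceForm m o S.value φ < ⊤) :
    ∃ v : FormSpace S, G.traceL m o (toDom hN v) = φ := by
  rw [traceForm] at h
  split_ifs at h with h'
  · obtain ⟨f, hf, hφ⟩ := h'
    exact ⟨of f hf, hφ⟩
  · exact absurd h (lt_irrefl _)

theorem isRepresentedBy_traceForm (hN : G.neumann m ≤ S.value)
    (hD : S.value ≤ G.dirichlet m) (hG : G.Connected) :
    G.IsRepresentedBy m o S.value (G.traceForm m o S.value) := by
  refine ⟨fun f => ⟨fun hf => ⟨(hN f).trans_lt hf, ?_⟩, fun ⟨hf, hφ⟩ => ?_⟩, fun f hf => ?_⟩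
  · have : G.trace m o f = G.traceL m o (toDom hN (of f hf)) := rfl
    rw [this, traceForm_traceL hN hD o hG]
    exact ENNReal.ofReal_lt_top
  · obtain ⟨v, hv⟩ := exists_of_traceForm_lt_top hN hφ
    -- `f` and `v` have the same trace, so they differ by an element of `D(Q^(D))`, which is
    -- contained in `D(Q)`.
    have hd : Dom.ofLp f hf - toDom hN v ∈ G.dirDom m := by
      rw [← traceL_eq_iff hG o, hv, traceL_ofLp]
    have : f = incl (v + ofDir hD _ hd) := by
      rw [map_add, incl_ofDir, map_sub, incl_toDom, Dom.incl_ofLp, add_sub_cancel]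
    rw [this]
    exact value_incl_lt_top _
  · obtain ⟨v, rfl⟩ : ∃ v : FormSpace S, incl v = f := ⟨of f hf, rfl⟩
    have ht : G.trace m o (incl v) = G.traceL m o (toDom hN v) := rfl
    have hd := sub_harm_mem (toDom hN v)
    rw [ht, traceForm_traceL hN hD o hG, dirichletToNeumann_traceL hG]
    refine ⟨?_, incl (toDom hN v - harm (toDom hN v)), incl (harm (toDom hN v)),
      ⟨?_, (dirichlet_incl_lt_top_iff _).2 hd, Dom.neumann_incl_lt_top _,
        (isOneHarmonic_iff _).2 (harm_mem _)⟩, ?_⟩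
    · rw [← incl_toDom hN v, ← neumannForm_value, value_incl_eq, incl_toDom, value_incl_eq,
        ← ENNReal.ofReal_add (bil_nonneg _) (sq_nonneg _), ← ENNReal.ofReal_sub _ (sq_nonneg _)]
      congr 1
      linarith [norm_harmIn_sq_sub hN hD v]
    · rw [map_sub, sub_add_cancel, incl_toDom]
    · rw [one_value_incl, one, dirichlet_incl_of_mem hd]
      change _ = one (G.neumann m) (incl _) + _
      rw [Dom.one_neumann_incl, ← ENNReal.ofReal_add (sq_nonneg _) (sq_nonneg _),
        norm_sq_eq_add_harmIn hN hD v]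

theorem isForm_traceForm (hN : G.neumann m ≤ S.value)
    (hD : S.value ≤ G.dirichlet m) (hG : G.Connected) :
    IsForm (G.traceForm m o S.value) := by
  have key := traceForm_traceL hN hD o hG
  refine IsForm.of_parallelogram ?_ (fun c φ h => ?_) (fun φ ψ hφ hψ => ?_)
  · have : (0 : G.L2Boundary m o) = G.traceL m o (toDom hN 0) := by rw [map_zero, map_zero]
    rw [this, key]
    exact ENNReal.ofReal_lt_top
  · obtain ⟨v, rfl⟩ := exists_of_traceForm_lt_top hN h
    rw [← map_smul, ← map_smul, key, key, harmIn_smul, norm_smul, mul_pow, Real.norm_eq_abs,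
      sq_abs, ENNReal.ofReal_mul (sq_nonneg c)]
  · obtain ⟨v, rfl⟩ := exists_of_traceForm_lt_top hN hφ
    obtain ⟨w, rfl⟩ := exists_of_traceForm_lt_top hN hψ
    rw [← map_add, ← map_add, ← map_sub, ← map_sub, key, key, key, key, harmIn_add, harmIn_sub]
    refine ofReal_parallelogram (sq_nonneg _) (sq_nonneg _) (sq_nonneg _) (sq_nonneg _) ?_
    rw [norm_add_sq_real, norm_sub_sq_real]
    ring

/-- Harmonic representatives turn a Cauchy sequence for the trace form into one for `Q_1`;
boundedness of `γ` carries its limit back to the boundary. -/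
theorem isClosedForm_traceForm (hN : G.neumann m ≤ S.value)
    (hD : S.value ≤ G.dirichlet m) [CompleteSpace (FormSpace S)] (hG : G.Connected) :
    IsClosedForm (G.traceForm m o S.value) := by
  have key := traceForm_traceL hN hD o hG
  refine ⟨isForm_traceForm o hN hD hG, fun φ hφ hc => ?_⟩
  choose v hv using fun n => exists_of_traceForm_lt_top hN (hφ n)
  set h : ℕ → FormSpace S := fun n => harmIn hN hD (v n) with hh
  have hh' : ∀ n, G.traceL m o (toDom hN (h n)) = φ n := fun n => by
    rw [hh, traceL_toDom_harmIn, hv]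
  have hcauchy : CauchySeq h := by
    rw [Metric.cauchySeq_iff]
    intro ε hε
    obtain ⟨N, hN'⟩ := hc (ENNReal.ofReal (ε ^ 2)) (by simpa using pow_pos hε 2)
    refine ⟨N, fun n hn k hk => ?_⟩
    rw [dist_eq_norm, ← FormSpace.ofReal_sq_lt_iff (norm_nonneg _) hε, hh, ← harmIn_sub,
      ← key, map_sub, map_sub, hv, hv]
    exact le_self_add.trans_lt (hN' n hn k hk)
  obtain ⟨h₀, hlim⟩ := cauchySeq_tendsto_of_complete hcauchy
  refine ⟨G.traceL m o (toDom hN h₀), ?_, ?_⟩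
  · rw [key]
    exact ENNReal.ofReal_lt_top
  -- The constant is `1` for the trace form itself plus `green(o) + 1` for the `L²` norm of the
  -- trace.
  · have hz : Tendsto (fun n => ENNReal.ofReal ((G.green m o o + 2) * ‖h n - h₀‖ ^ 2)) atTop
        (𝓝 0) := by
      have := ENNReal.tendsto_ofReal
        (((tendsto_iff_norm_sub_tendsto_zero.1 hlim).pow 2).const_mul (G.green m o o + 2))
      simpa using this
    refine tendsto_of_tendsto_of_tendsto_of_le_of_le tendsto_const_nhds hz
      (fun n => zero_le) fun n => ?_
    rw [one, ← hh', ← map_sub, ← map_sub, key, ← ENNReal.ofReal_add (sq_nonneg _) (sq_nonneg _)]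
    refine ENNReal.ofReal_le_ofReal ?_
    have h1 := pow_le_pow_left₀ (norm_nonneg _) (norm_harmIn_le hN hD (h n - h₀)) 2
    have h2 := norm_traceL_sq_le o (toDom hN (h n - h₀))
    have h3 := pow_le_pow_left₀ (norm_nonneg _) (norm_toDom_le hN (h n - h₀)) 2
    have h4 := mul_le_mul_of_nonneg_left h3
      (add_nonneg (green_self_nonneg (G := G) (m := m) o) zero_le_one)
    linarith

/-- For a harmonic extension `h` of `φ`, the function `C ∘ h` has trace `C ∘ φ` and no larger form
norm, and passing to its harmonic part decreases the norm further. -/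
theorem isMarkovian_traceForm (hN : G.neumann m ≤ S.value)
    (hD : S.value ≤ G.dirichlet m) (hM : IsMarkovian S.value) (hG : G.Connected) :
    IsMarkovian (G.traceForm m o S.value) := by
  intro C hC h0 φ
  have key := traceForm_traceL hN hD o hG
  rcases eq_top_or_lt_top (G.traceForm m o S.value φ) with h | h
  · rw [h]
    exact le_top
  · obtain ⟨v, rfl⟩ := exists_of_traceForm_lt_top hN h
    rw [← traceL_toDom_harmIn hN hD, ← traceL_comp, ← toDom_cmp hN hM, key,
      key, harmIn_harmIn]
    refine ENNReal.ofReal_le_ofReal (pow_le_pow_left₀ (norm_nonneg _) ?_ 2)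
    exact (norm_harmIn_le hN hD _).trans (norm_cmp_le hM hC h0 _)

theorem dirichletToNeumann_le_traceForm (hN : G.neumann m ≤ S.value)
    (hD : S.value ≤ G.dirichlet m) (hG : G.Connected) :
    G.dirichletToNeumann m o ≤ G.traceForm m o S.value := by
  intro φ
  rcases eq_top_or_lt_top (G.traceForm m o S.value φ) with h | h
  · rw [h]
    exact le_top
  · obtain ⟨v, rfl⟩ := exists_of_traceForm_lt_top hN h
    rw [dirichletToNeumann_traceL hG, traceForm_traceL hN hD o hG, ← toDom_harmIn hN hD]
    exact ENNReal.ofReal_le_ofReal (pow_le_pow_left₀ (norm_nonneg _) (norm_toDom_le hN _) 2)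

/-- `Tr Q - q^{DN}` at `γv` equals `Q - Q^(N)` at any representative `v`. So `C ∘ v` can be inserted
without taking harmonic parts, and `bil_cmp_add_le` applies. -/
theorem isMarkovian_diffOnDomain_traceForm (hN : G.neumann m ≤ S.value)
    (hD : S.value ≤ G.dirichlet m) (hM : IsMarkovian S.value) [CompleteSpace (FormSpace S)]
    (hG : G.Connected) :
    IsMarkovian (diffOnDomain (G.traceForm m o S.value) (G.dirichletToNeumann m o)) := by
  intro C hC h0 φ
  have key : ∀ v : FormSpace S, diffOnDomain (G.traceForm m o S.value)
      (G.dirichletToNeumann m o) (G.traceL m o (toDom hN v)) =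
      ENNReal.ofReal (bil v v - bil (toDom hN v) (toDom hN v)) := fun v => by
    rw [diffOnDomain, traceForm_traceL hN hD o hG, if_pos ENNReal.ofReal_lt_top,
      dirichletToNeumann_traceL hG, ← ENNReal.ofReal_sub _ (sq_nonneg _), norm_harmIn_sq_sub]
  rcases eq_top_or_lt_top (G.traceForm m o S.value φ) with h | h
  · have : ¬ diffOnDomain (G.traceForm m o S.value) (G.dirichletToNeumann m o) φ < ⊤ := by
      rw [diffOnDomain_lt_top, h]
      exact lt_irrefl _
    rw [not_lt_top_iff.1 this]
    exact le_top
  · obtain ⟨v, rfl⟩ := exists_of_traceForm_lt_top hN h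
    rw [← traceL_comp, ← toDom_cmp hN hM, key, key]
    exact ENNReal.ofReal_le_ofReal (by linarith [bil_cmp_add_le hN hD hM hC h0 v])

end TraceForm

theorem traceForm_mem_traceClass (hG : G.Connected) (o : X) {Q : Lp ℝ 2 m → ℝ≥0∞}
    (hQ : Q ∈ G.formClass m) :
    G.traceForm m o Q ∈ G.traceClass m o ∧ G.IsRepresentedBy m o Q (G.traceForm m o Q) := by
  obtain ⟨⟨⟨hcl, hM⟩, -⟩, hN, hD⟩ := hQ
  obtain ⟨S, rfl⟩ := hcl.1
  have := FormSpace.completeSpace hcl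
  exact ⟨⟨⟨isClosedForm_traceForm o hN hD hG, isMarkovian_traceForm o hN hD hM hG⟩,
    dirichletToNeumann_le_traceForm o hN hD hG,
    isMarkovian_diffOnDomain_traceForm o hN hD hM hG⟩, isRepresentedBy_traceForm o hN hD hG⟩

/-! ### Forms given by their traces -/

variable (G m) in
/-- The form `Q^(N)(f) + (q - q^{DN})(γf)`. -/
def formOfTrace (o : X) (q : G.L2Boundary m o → ℝ≥0∞) (f : Lp ℝ 2 m) : ℝ≥0∞ :=
  G.neumann m f + diffOnDomain q (G.dirichletToNeumann m o) (G.trace m o f)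

variable {o : X}

theorem formOfTrace_lt_top_iff {q : G.L2Boundary m o → ℝ≥0∞} {f : Lp ℝ 2 m} :
    G.formOfTrace m o q f < ⊤ ↔ G.neumann m f < ⊤ ∧ q (G.trace m o f) < ⊤ := by
  rw [formOfTrace, ENNReal.add_lt_top, diffOnDomain_lt_top]

/-- A represented form is determined by `q`. Reordering the subtraction in `[0,∞]` is legitimate
because `q^{DN} ≤ q` and both are finite at `γf`. -/
theorem eq_formOfTrace {Q : Lp ℝ 2 m → ℝ≥0∞} {q : G.L2Boundary m o → ℝ≥0∞}
    (hle : G.dirichletToNeumann m o ≤ q) (h : G.IsRepresentedBy m o Q q) :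
    Q = G.formOfTrace m o q := by
  funext f
  by_cases hf : Q f < ⊤
  · have hf' := (h.1 f).1 hf
    rw [(h.2 f hf).1, formOfTrace, diffOnDomain, if_pos hf'.2]
    exact AddLECancellable.add_tsub_assoc_of_le
      (ENNReal.cancel_of_ne ((hle _).trans_lt hf'.2).ne) (hle _) _
  · have hf' : ¬ G.formOfTrace m o q f < ⊤ := by
      rw [formOfTrace_lt_top_iff, ← h.1]
      exact hf
    rw [not_lt_top_iff.1 hf, not_lt_top_iff.1 hf']

section FormOfTrace

variable {T : SymmPosForm (G.L2Boundary m o)}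

theorem formOfTrace_incl (hG : G.Connected) (u : G.Dom m) (w : FormSpace T)
    (h : G.traceL m o u = incl w) (hle : G.dirichletToNeumann m o ≤ T.value) :
    G.formOfTrace m o T.value (incl u) =
      ENNReal.ofReal (bil u u + (bil w w - ‖harm u‖ ^ 2)) ∧ ‖harm u‖ ^ 2 ≤ bil w w := by
  have h1 : ‖harm u‖ ^ 2 ≤ bil w w := by
    have := hle (G.traceL m o u)
    rwa [dirichletToNeumann_traceL hG, h, value_incl_eq,
      ENNReal.ofReal_le_ofReal_iff (bil_nonneg _)] at this
  refine ⟨?_, h1⟩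
  have ht : G.trace m o (incl u) = incl w := h
  rw [formOfTrace, ht, diffOnDomain, if_pos (value_incl_lt_top w), ← h,
    dirichletToNeumann_traceL hG, h, value_incl_eq, ← neumannForm_value, value_incl_eq,
    ← ENNReal.ofReal_sub _ (sq_nonneg _), ← ENNReal.ofReal_add (bil_nonneg _) (by linarith)]

/-- The harmonic part of `Q^(N)_1` is precisely `q^{DN}(γu)`, which cancels and leaves the Dirichlet
part and `q`. -/
theorem one_formOfTrace_incl (hG : G.Connected) (u : G.Dom m) (w : FormSpace T)
    (h : G.traceL m o u = incl w) (hle : G.dirichletToNeumann m o ≤ T.value) :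
    one (G.formOfTrace m o T.value) (incl u) =
      ENNReal.ofReal (‖u - harm u‖ ^ 2 + bil w w) := by
  obtain ⟨h1, h2⟩ := formOfTrace_incl hG u w h hle
  rw [one, h1, ← ENNReal.ofReal_add (by linarith [bil_nonneg u]) (sq_nonneg _)]
  congr 1
  linarith [norm_sq_eq_bil u, norm_sq_eq_add u]

theorem exists_of_formOfTrace_lt_top {f : Lp ℝ 2 m} (h : G.formOfTrace m o T.value f < ⊤) :
    ∃ (u : G.Dom m) (w : FormSpace T), incl u = f ∧ G.traceL m o u = incl w := by
  obtain ⟨h1, h2⟩ := formOfTrace_lt_top_iff.1 h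
  exact ⟨Dom.ofLp f h1, of _ h2, rfl, rfl⟩

theorem isForm_formOfTrace (hG : G.Connected) (hle : G.dirichletToNeumann m o ≤ T.value) :
    IsForm (G.formOfTrace m o T.value) := by
  refine IsForm.of_parallelogram ?_ (fun c f hf => ?_) (fun f g hf hg => ?_)
  · have := (formOfTrace_incl hG (0 : G.Dom m) (0 : FormSpace T) (by simp) hle).1
    rw [map_zero] at this
    rw [this]
    exact ENNReal.ofReal_lt_top
  · obtain ⟨u, w, rfl, huw⟩ := exists_of_formOfTrace_lt_top hf
    rw [← map_smul, (formOfTrace_incl hG u w huw hle).1,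
      (formOfTrace_incl hG (c • u) (c • w) (by rw [map_smul, map_smul, huw]) hle).1,
      ← ENNReal.ofReal_mul (sq_nonneg c)]
    simp only [map_smul, LinearMap.smul_apply, smul_eq_mul, norm_smul, mul_pow, Real.norm_eq_abs,
      sq_abs]
    congr 1
    ring
  · obtain ⟨u, w, rfl, huw⟩ := exists_of_formOfTrace_lt_top hf
    obtain ⟨u', w', rfl, huw'⟩ := exists_of_formOfTrace_lt_top hg
    have h1 := formOfTrace_incl hG u w huw hle
    have h2 := formOfTrace_incl hG u' w' huw' hle
    have h3 := formOfTrace_incl hG (u + u') (w + w') (by rw [map_add, map_add, huw, huw']) hle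
    have h4 := formOfTrace_incl hG (u - u') (w - w') (by rw [map_sub, map_sub, huw, huw']) hle
    have n1 := bil_nonneg u
    have n2 := bil_nonneg u'
    have n3 := bil_nonneg (u + u')
    have n4 := bil_nonneg (u - u')
    rw [← map_add, ← map_sub, h1.1, h2.1, h3.1, h4.1]
    refine ofReal_parallelogram (by linarith) (by linarith) (by linarith) (by linarith) ?_
    rw [map_add harm, map_sub harm, norm_add_sq_real, norm_sub_sq_real]
    simp only [bil_add_self, bil_sub_self]
    ring

/-- A Cauchy sequence splits into one in `D(Q^(N))` and one in the form space of `q`. Both spaces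
are complete, and continuity of `γ` matches the two limits. -/
theorem isClosedForm_formOfTrace (hG : G.Connected) (hT : IsClosedForm T.value)
    (hle : G.dirichletToNeumann m o ≤ T.value) : IsClosedForm (G.formOfTrace m o T.value) := by
  refine ⟨isForm_formOfTrace hG hle, fun f hf hc => ?_⟩
  choose u w hu huw using fun n => exists_of_formOfTrace_lt_top (hf n)
  obtain rfl : (fun n => incl (u n)) = f := funext hu
  have hone : ∀ n k, one (G.formOfTrace m o T.value) (incl (u n) - incl (u k)) =
      ENNReal.ofReal (‖(u n - u k) - harm (u n - u k)‖ ^ 2 + bil (w n - w k) (w n - w k)) :=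
    fun n k => by
      rw [← map_sub, one_formOfTrace_incl hG _ (w n - w k)
        (by rw [map_sub, map_sub, huw, huw]) hle]
  have hhw : ∀ n k, ‖harm (u n - u k)‖ ^ 2 ≤ bil (w n - w k) (w n - w k) := fun n k =>
    (formOfTrace_incl hG (u n - u k) (w n - w k) (by rw [map_sub, map_sub, huw, huw]) hle).2
  have := FormSpace.completeSpace hT
  have hcu : CauchySeq u := by
    rw [Metric.cauchySeq_iff]
    intro ε hε
    obtain ⟨N, hN⟩ := hc (ENNReal.ofReal (ε ^ 2)) (by simpa using pow_pos hε 2)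
    refine ⟨N, fun n hn k hk => ?_⟩
    rw [dist_eq_norm, ← FormSpace.ofReal_sq_lt_iff (norm_nonneg _) hε]
    refine lt_of_le_of_lt ?_ (hN n hn k hk)
    rw [hone]
    exact ENNReal.ofReal_le_ofReal (by linarith [norm_sq_eq_add (u n - u k), hhw n k])
  have hgr : 0 ≤ G.green m o o + 1 := add_nonneg (green_self_nonneg o) zero_le_one
  -- The form contributes `1` to the constant. The `L²` norm contributes `green(o) + 1`, after the
  -- harmonic part of the norm has been bounded by `q`.
  have hbound : ∀ n k, ‖w n - w k‖ ^ 2 ≤ (G.green m o o + 2) *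
      (‖(u n - u k) - harm (u n - u k)‖ ^ 2 + bil (w n - w k) (w n - w k)) := fun n k => by
    have h1 := norm_traceL_sq_le o (u n - u k)
    rw [map_sub, huw, huw, ← map_sub] at h1
    rw [norm_sq_eq_bil]
    have h2 := mul_le_mul_of_nonneg_left (add_le_add_right (hhw n k)
      (‖(u n - u k) - harm (u n - u k)‖ ^ 2)) hgr
    rw [← norm_sq_eq_add] at h2
    nlinarith [sq_nonneg ‖(u n - u k) - harm (u n - u k)‖]
  have hcw : CauchySeq w := by
    rw [Metric.cauchySeq_iff]
    intro ε hε
    have hK : 0 < G.green m o o + 2 := by linarith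
    obtain ⟨N, hN⟩ := hc (ENNReal.ofReal (ε ^ 2 / (G.green m o o + 2)))
      (ENNReal.ofReal_pos.2 (div_pos (pow_pos hε 2) hK))
    refine ⟨N, fun n hn k hk => ?_⟩
    have h1 := hN n hn k hk
    rw [hone, ENNReal.ofReal_lt_ofReal_iff (div_pos (pow_pos hε 2) hK), lt_div_iff₀ hK] at h1
    rw [dist_eq_norm]
    refine lt_of_pow_lt_pow_left₀ 2 hε.le ((hbound n k).trans_lt ?_)
    rwa [mul_comm]
  obtain ⟨u₀, hu₀⟩ := cauchySeq_tendsto_of_complete hcu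
  obtain ⟨w₀, hw₀⟩ := cauchySeq_tendsto_of_complete hcw
  have hlu := tendsto_iff_norm_sub_tendsto_zero.1 hu₀
  have hlw := tendsto_iff_norm_sub_tendsto_zero.1 hw₀
  have huw₀ : G.traceL m o u₀ = incl w₀ := by
    have h1 : Tendsto (fun n => G.traceL m o (u n)) atTop (𝓝 (incl w₀)) := by
      simp only [huw]
      exact (incl.continuous.tendsto w₀).comp hw₀
    refine tendsto_nhds_unique ?_ h1
    rw [tendsto_iff_norm_sub_tendsto_zero]
    have h2 : Tendsto (fun n => Real.sqrt ((G.green m o o + 1) * ‖u n - u₀‖ ^ 2)) atTop (𝓝 0) := by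
      simpa using ((hlu.pow 2).const_mul (G.green m o o + 1)).sqrt
    refine squeeze_zero (fun n => norm_nonneg _) (fun n => ?_) h2
    rw [← map_sub]
    exact Real.le_sqrt_of_sq_le (norm_traceL_sq_le o _)
  refine ⟨incl u₀, ?_, ?_⟩
  · rw [(formOfTrace_incl hG u₀ w₀ huw₀ hle).1]
    exact ENNReal.ofReal_lt_top
  · have hz : Tendsto (fun n => ENNReal.ofReal (‖u n - u₀‖ ^ 2 + ‖w n - w₀‖ ^ 2)) atTop
        (𝓝 0) := by
      simpa using ENNReal.tendsto_ofReal ((hlu.pow 2).add (hlw.pow 2))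
    refine tendsto_of_tendsto_of_tendsto_of_le_of_le tendsto_const_nhds hz
      (fun n => zero_le) fun n => ?_
    rw [← map_sub, one_formOfTrace_incl hG _ (w n - w₀)
        (by rw [map_sub, map_sub, huw, huw₀]) hle]
    refine ENNReal.ofReal_le_ofReal (add_le_add ?_ ?_)
    · linarith [norm_sq_eq_add (u n - u₀), sq_nonneg ‖harm (u n - u₀)‖]
    · linarith [norm_sq_eq_bil (w n - w₀), sq_nonneg ‖incl (w n - w₀)‖]

end FormOfTrace

/-- Both summands are Markovian, and `γ` commutes with normal contractions. -/
theorem isMarkovian_formOfTrace {q : G.L2Boundary m o → ℝ≥0∞}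
    (hM : IsMarkovian (diffOnDomain q (G.dirichletToNeumann m o))) :
    IsMarkovian (G.formOfTrace m o q) := by
  intro C hC h0 f
  rcases eq_top_or_lt_top (G.neumann m f) with h | h
  · rw [formOfTrace, formOfTrace, h, top_add]
    exact le_top
  · have e1 : hC.compLp h0 f = incl (Dom.comp hC h0 (Dom.ofLp f h)) := by
      rw [Dom.incl_comp, Dom.incl_ofLp]
    have e2 : G.trace m o (hC.compLp h0 f) = hC.compLp h0 (G.trace m o f) := by
      rw [e1, ← traceL_apply, traceL_comp, traceL_ofLp]
    rw [formOfTrace, formOfTrace, e2]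
    refine add_le_add (G.energy_mono fun y => ?_) (hM C hC h0 _)
    rw [e1]
    exact sq_le_sq.2 (Dom.abs_grad_comp_le hC h0 (Dom.ofLp f h) y)

theorem formOfTrace_le_dirichlet {T : SymmPosForm (G.L2Boundary m o)} :
    G.formOfTrace m o T.value ≤ G.dirichlet m := by
  intro f
  rcases eq_top_or_lt_top (G.dirichlet m f) with h | h
  · rw [h]
    exact le_top
  · have hN := (neumann_le_dirichlet f).trans_lt h
    have hd := (dirichlet_incl_lt_top_iff (Dom.ofLp f hN)).1 h
    have ht : G.trace m o f = 0 := by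
      rw [← traceL_ofLp o f hN]
      exact traceL_eq_zero_of_mem o hd
    have h0 : T.value 0 = 0 := by
      have := value_incl_eq (0 : FormSpace T)
      simpa using this
    rw [formOfTrace, ht, diffOnDomain, h0, if_pos ENNReal.zero_lt_top, zero_tsub, add_zero]
    exact neumann_le_dirichlet f

/-- Density comes from the finitely supported functions: they have trace zero, so they lie in the
domain whatever the domain of `q` is. -/
theorem formOfTrace_mem_formClass (hG : G.Connected) {q : G.L2Boundary m o → ℝ≥0∞}
    (hq : q ∈ G.traceClass m o) : G.formOfTrace m o q ∈ G.formClass m := by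
  obtain ⟨⟨hcl, -⟩, hle, hM⟩ := hq
  obtain ⟨T, rfl⟩ := hcl.1
  refine ⟨⟨⟨isClosedForm_formOfTrace hG hcl hle, isMarkovian_formOfTrace hM⟩, fun f => ?_⟩,
    fun f => le_self_add, formOfTrace_le_dirichlet⟩
  refine mem_closure_of_tendsto (G.tendsto_lpRestrict f) (Eventually.of_forall fun s => ?_)
  exact (formOfTrace_le_dirichlet _).trans_lt
    ((dirichlet_incl_lt_top_iff _).2 (restrict_mem_dirDom s f))

/-- On a harmonic extension the Dirichlet part of the form norm vanishes, so only `q` remains. Every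
element of `D(q)` is a trace, because `q^{DN} ≤ q`. -/
theorem traceForm_formOfTrace (hG : G.Connected) {q : G.L2Boundary m o → ℝ≥0∞}
    (hq : q ∈ G.traceClass m o) : G.traceForm m o (G.formOfTrace m o q) = q := by
  obtain ⟨⟨hcl, -⟩, hle, -⟩ := hq
  obtain ⟨T, rfl⟩ := hcl.1
  funext φ
  by_cases h : T.value φ < ⊤
  · obtain ⟨u, rfl⟩ := exists_of_dirichletToNeumann_lt_top ((hle φ).trans_lt h)
    have hfin : G.formOfTrace m o T.value (incl u) < ⊤ :=
      formOfTrace_lt_top_iff.2 ⟨Dom.neumann_incl_lt_top u, h⟩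
    rw [traceForm, if_pos ⟨incl u, hfin, rfl⟩, harmonicExtension_traceL hG,
      one_formOfTrace_incl hG _ (of _ h) (by rw [traceL_harm, incl_of]) hle,
      harm_eq_self (harm_mem u), sub_self, norm_zero, zero_pow two_ne_zero, zero_add,
      ← value_incl_eq, incl_of]
  · rw [traceForm, if_neg, not_lt_top_iff.1 h]
    rintro ⟨f, hf, rfl⟩
    exact h (formOfTrace_lt_top_iff.1 hf).2

theorem mem_formClass_iff (hG : G.Connected) (o : X) (Q : Lp ℝ 2 m → ℝ≥0∞) :
    Q ∈ G.formClass m ↔ ∃ q ∈ G.traceClass m o, G.IsRepresentedBy m o Q q := by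
  constructor
  · exact fun hQ => ⟨_, traceForm_mem_traceClass hG o hQ⟩
  · rintro ⟨q, hq, h⟩
    rw [eq_formOfTrace hq.2.1 h]
    exact formOfTrace_mem_formClass hG hq

/-- Injectivity holds because `Q` is recovered from `Tr Q` by `formOfTrace`; surjectivity because
`formOfTrace` has trace `q`. -/
theorem bijOn_traceForm (hG : G.Connected) (o : X) :
    Set.BijOn (G.traceForm m o) (G.formClass m) (G.traceClass m o) := by
  refine ⟨fun Q hQ => (traceForm_mem_traceClass hG o hQ).1, fun Q hQ Q' hQ' h => ?_,
    fun q hq => ⟨_, formOfTrace_mem_formClass hG hq, traceForm_formOfTrace hG hq⟩⟩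
  obtain ⟨h1, h2⟩ := traceForm_mem_traceClass hG o hQ
  obtain ⟨h1', h2'⟩ := traceForm_mem_traceClass hG o hQ'
  rw [eq_formOfTrace h1.2.1 h2, eq_formOfTrace h1'.2.1 h2', h]

end WGraph

end GraphForms

end

theorem mainTheorem1 {X : Type*} [Countable X] [MeasurableSpace X] [DiscreteMeasurableSpace X]
    (m : MeasureTheory.Measure X) (hm_pos : ∀ x, 0 < m {x}) (hm_fin : ∀ x, m {x} < ⊤)
    (G : GraphForms.WGraph X) (hG : G.Connected) (o : X) :
    (∀ Q : MeasureTheory.Lp ℝ 2 m → ENNReal, GraphForms.IsClosedForm Q →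
      (Q ∈ G.formClass m ↔ ∃ q ∈ G.traceClass m o, G.IsRepresentedBy m o Q q)) ∧
    (∀ Q ∈ G.formClass m,
      G.traceForm m o Q ∈ G.traceClass m o ∧ G.IsRepresentedBy m o Q (G.traceForm m o Q)) ∧
    Set.BijOn (G.traceForm m o) (G.formClass m) (G.traceClass m o) := by
  have : GraphForms.PosFiniteAtoms m := ⟨hm_pos, hm_fin⟩
  exact ⟨fun Q _ => GraphForms.WGraph.mem_formClass_iff hG o Q,
    fun Q hQ => GraphForms.WGraph.traceForm_mem_traceClass hG o hQ,
    GraphForms.WGraph.bijOn_traceForm hG o⟩
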